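/- Let $n\ge 2$ and let $B^k$ denote the open unit ball of $\mathbb R^k$. Let $\phi\colon B^n\times B^{n-1}\to\mathbb R$ be smooth and satisfy (H1) $\operatorname{rank}\,\partial^2_{\omega x}\phi(x;\omega)=n-1$ for all $(x;\omega)\in B^n\times B^{n-1}$. Put $G(x;\omega):=G_0(x;\omega)/|G_0(x;\omega)|$, where $G_0(x;\omega):=\bigwedge_{j=1}^{n-1}\partial_{\omega_j}\partial_x\phi(x;\omega)$ is identified with a vector of $\mathbb R^n$ in the usual way. An *amplitude* for $\phi$ is a non-negative $a\in C_c^\infty(\mathbb R^n\times\mathbb R^{n-1})$, with compact support contained in $B^n\times B^{n-1}$, such that (H2) $\det\partial^2_{\omega\omega}\langle\partial_x\phi(x;\omega),G(x;\omega_0)\rangle|_{\omega=\omega_0}\ne 0$ for all $(x;\omega_0)\in\operatorname{supp}a$. For an amplitude $a$ and $\lambda\ge 1$ let $$T^\lambda_a f(x):=\int_{B^{n-1}}e^{2\pi i\lambda\phi(x/\lambda;\omega)}\,a(x/\lambda;\omega)f(\omega)\,d\omega$$ be the associated Hörmander-type operator. Let $2\le\bar p\le\infty$. Exponents $p$ below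 range over $[\bar p,\infty]$, constants may depend on $n$ and $p$, and all estimates are for $f\in L^p(B^{n-1})$. Consider the following statements. (L) For every $p\ge\bar p$, every $\varepsilon>0$ and every amplitude $a$ for $\phi$, $$\|T^\lambda_af\|_{L^p(B_R)}\lesssim_{\varepsilon,\phi,a}R^\varepsilon\|f\|_{L^p(B^{n-1})}$$ for all $1\le R\le\lambda$ and all balls $B_R\subset\mathbb R^n$ of radius $R$. (G) For every $p>\bar p$ and every amplitude $a$ for $\phi$, $$\|T^\lambda_af\|_{L^p(\mathbb R^n)}\lesssim_{\phi,a}\|f\|_{L^p(B^{n-1})}$$ for all $\lambda\ge1$. ($S_p$) For every $\varepsilon>0$ and every amplitude $a$ for $\phi$, $$\|T^\lambda_af\|_{L^p(S)}\lesssim_{\varepsilon,\phi,a}R^\varepsilon\|f\|_{L^p(B^{n-1})}$$ for all $\lambda\ge1$, all $R\ge1$ and all $S=\bigcup_{j=1}^NB(x_j,R)$ for which $\{B(x_j,R)\}_{j=1}^N$ is sparse, that is, $|x_i-x_j|\ge(RN)^{\bar C}$ for all $i\ne j$. Then: 1. ($\varepsilon$-removal) (L) implies (G). Moreover, there is a constant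 $C_0\ge1$, depending only on $n$, such that for every choice of the exponent $\bar C\ge C_0$ in the definition of sparseness, and for all $\phi$ and $\bar p$ as above: 2. (reduction to sparse collections) ($S_{\bar p}$) implies (G); 3. (estimates over sparse collections) (L) implies ($S_p$) for every $p\ge\bar p$. -/

import Mathlib

open MeasureTheory Metric Set
open scoped ENNReal NNReal RealInnerProductSpace

noncomputable section

namespace EpsRemoval

/-- Euclidean space `ℝ^k`. Throughout, `n = d + 1` is the dimension of the `x`-space and
`n - 1 = d` is the dimension of the `ω`-space. -/
abbrev E (k : ℕ) : Type := EuclideanSpace ℝ (Fin k)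

/-- The open unit ball `B^k` of `ℝ^k`. -/
abbrev B (k : ℕ) : Set (E k) := ball 0 1

/-- The wedge product `v₁ ∧ ⋯ ∧ v_d` of `d` vectors in `ℝ^(d+1)`, identified with a vector in the
usual manner (the generalised cross product): its inner product with `w` is
`det (w, v₁, …, v_d)`. -/
def wedge {d : ℕ} (v : Fin d → E (d + 1)) : E (d + 1) :=
  WithLp.toLp 2 fun i => (-1) ^ (i : ℕ) * (Matrix.of fun j k => v j (i.succAbove k)).det

/-- `∂_x φ(x; ω)`. -/
def gradX {d : ℕ} (φ : E (d + 1) → E d → ℝ) (x : E (d + 1)) (ω : E d) : E (d + 1) :=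
  gradient (fun y => φ y ω) x

/-- `∂_{ω_j} ∂_x φ(x; ω)`. -/
def dOmegaGradX {d : ℕ} (φ : E (d + 1) → E d → ℝ) (x : E (d + 1)) (ω : E d) (j : Fin d) :
    E (d + 1) :=
  fderiv ℝ (fun ω' => gradX φ x ω') ω (EuclideanSpace.single j 1)

/-- The mixed Hessian `∂²_{ωx} φ(x; ω)`, a `d × (d+1)` matrix. -/
def mixedHessian {d : ℕ} (φ : E (d + 1) → E d → ℝ) (x : E (d + 1)) (ω : E d) :
    Matrix (Fin d) (Fin (d + 1)) ℝ :=
  Matrix.of fun j i => dOmegaGradX φ x ω j i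

/-- `G₀(x; ω) = ⋀_j ∂_{ω_j} ∂_x φ(x; ω)`. -/
def gauss₀ {d : ℕ} (φ : E (d + 1) → E d → ℝ) (x : E (d + 1)) (ω : E d) : E (d + 1) :=
  wedge (dOmegaGradX φ x ω)

/-- The generalised Gauss map `G(x; ω) = G₀(x; ω) / |G₀(x; ω)|`. -/
def gauss {d : ℕ} (φ : E (d + 1) → E d → ℝ) (x : E (d + 1)) (ω : E d) : E (d + 1) :=
  ‖gauss₀ φ x ω‖⁻¹ • gauss₀ φ x ω

/-- The Hessian matrix of `h : ℝ^d → ℝ` at `ω`. -/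
def hessian {d : ℕ} (h : E d → ℝ) (ω : E d) : Matrix (Fin d) (Fin d) ℝ :=
  Matrix.of fun j k =>
    fderiv ℝ (fderiv ℝ h) ω (EuclideanSpace.single j 1) (EuclideanSpace.single k 1)

/-- The curvature matrix `∂²_{ωω} ⟨∂_x φ(x; ω), G(x; ω₀)⟩ |_{ω = ω₀}`. -/
def curvatureMatrix {d : ℕ} (φ : E (d + 1) → E d → ℝ) (x : E (d + 1)) (ω₀ : E d) :
    Matrix (Fin d) (Fin d) ℝ :=
  hessian (fun ω => ⟪gradX φ x ω, gauss φ x ω₀⟫) ω₀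

/-- A smooth phase on `B^n × B^(n-1)` satisfying the rank condition H1. -/
structure IsPhase {d : ℕ} (φ : E (d + 1) → E d → ℝ) : Prop where
  smooth : ContDiffOn ℝ (⊤ : ℕ∞) (Function.uncurry φ) (B (d + 1) ×ˢ B d)
  rank_eq : ∀ x ∈ B (d + 1), ∀ ω ∈ B d, (mixedHessian φ x ω).rank = d

/-- `a` is an admissible amplitude for the phase `φ`: it is smooth, non-negative, compactly
supported in `B^n × B^(n-1)`, and the curvature condition H2 for `φ` holds on its support. Thus,
if `IsPhase φ` and `IsAmplitude φ a`, then the operators `T φ a lam` below are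
Hörmander-type operators. -/
structure IsAmplitude {d : ℕ} (φ : E (d + 1) → E d → ℝ) (a : E (d + 1) → E d → ℝ) : Prop where
  smooth : ContDiff ℝ (⊤ : ℕ∞) (Function.uncurry a)
  nonneg : ∀ x ω, 0 ≤ a x ω
  compact : HasCompactSupport (Function.uncurry a)
  support : tsupport (Function.uncurry a) ⊆ B (d + 1) ×ˢ B d
  curvature : ∀ x ω, (x, ω) ∈ tsupport (Function.uncurry a) → (curvatureMatrix φ x ω).det ≠ 0

/-- The operator
`T^λ f(x) = ∫_{B^(n-1)} exp(2πi λ φ(x/λ; ω)) a(x/λ; ω) f(ω) dω`. -/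
def T {d : ℕ} (φ a : E (d + 1) → E d → ℝ) (lam : ℝ) (f : E d → ℂ) (x : E (d + 1)) : ℂ :=
  ∫ ω in B d,
    Complex.exp (2 * Real.pi * Complex.I * ((lam * φ (lam⁻¹ • x) ω : ℝ) : ℂ)) *
      ((a (lam⁻¹ • x) ω : ℝ) : ℂ) * f ω

/-- The local estimates with `R^ε`-loss: for every exponent `p ≥ pbar`, every `ε > 0` and every
choice of amplitude `a`, one has `‖T^λ f‖_{L^p(B_R)} ≤ C R^ε ‖f‖_{L^p(B^(n-1))}` for all
`1 ≤ R ≤ λ` and all `R`-balls `B_R`. -/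
def LocalBounds {d : ℕ} (φ : E (d + 1) → E d → ℝ) (pbar : ℝ≥0∞) : Prop :=
  ∀ p : ℝ≥0∞, pbar ≤ p → ∀ ε : ℝ, 0 < ε → ∀ a : E (d + 1) → E d → ℝ, IsAmplitude φ a →
    ∃ C : ℝ≥0, ∀ lam R : ℝ, 1 ≤ R → R ≤ lam → ∀ x₀ : E (d + 1), ∀ f : E d → ℂ,
      MemLp f p (volume.restrict (B d)) →
        eLpNorm (T φ a lam f) p (volume.restrict (ball x₀ R)) ≤
          C * ENNReal.ofReal (R ^ ε) * eLpNorm f p (volume.restrict (B d))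

/-- The global estimate `‖T^λ f‖_{L^p(ℝ^n)} ≤ C ‖f‖_{L^p(B^(n-1))}`, uniformly in `λ ≥ 1`. -/
def GlobalBound {d : ℕ} (φ a : E (d + 1) → E d → ℝ) (p : ℝ≥0∞) : Prop :=
  ∃ C : ℝ≥0, ∀ lam : ℝ, 1 ≤ lam → ∀ f : E d → ℂ, MemLp f p (volume.restrict (B d)) →
    eLpNorm (T φ a lam f) p volume ≤ C * eLpNorm f p (volume.restrict (B d))

/-- The collection of balls `B(x_j, R)`, `1 ≤ j ≤ N`, is sparse (with exponent `Cbar`): the centres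
are `(R N)^Cbar`-separated. -/
def IsSparse {k N : ℕ} (Cbar R : ℝ) (x : Fin N → E k) : Prop :=
  ∀ i j : Fin N, i ≠ j → (R * N) ^ Cbar ≤ dist (x i) (x j)

/-- The `L^p` estimates with `R^ε`-loss over unions of sparse collections of `R`-balls, for every
`ε > 0` and every choice of amplitude `a`. -/
def SparseBounds {d : ℕ} (φ : E (d + 1) → E d → ℝ) (Cbar : ℝ) (p : ℝ≥0∞) : Prop :=
  ∀ ε : ℝ, 0 < ε → ∀ a : E (d + 1) → E d → ℝ, IsAmplitude φ a →
    ∃ C : ℝ≥0, ∀ lam R : ℝ, 1 ≤ lam → 1 ≤ R →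
      ∀ (N : ℕ) (x : Fin N → E (d + 1)), IsSparse Cbar R x → ∀ f : E d → ℂ,
        MemLp f p (volume.restrict (B d)) →
          eLpNorm (T φ a lam f) p (volume.restrict (⋃ j, ball (x j) R)) ≤
            C * ENNReal.ofReal (R ^ ε) * eLpNorm f p (volume.restrict (B d))

end EpsRemoval

end

/-! Write n = d + 1. Statement 1 is statement 3 at p = pbar followed by statement 2, so there are
two independent implications to prove.

Sparse bounds imply global bounds. Since B^d has finite measure, f may be normalised in L^pbar.
Differentiating exp(2πiλφ(x/λ; ω)) in x costs λ · λ⁻¹ = 1, so g = T f is bounded and its k-th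
differences are at most D|v|^k, uniformly in λ. This smoothness plays the role of an uncertainty
principle: if |g(y)| > α, averaging the k-th difference at y over |v| < r with r^k ~ α gives
∫_{B(y,k)} |g| ≳ α^(1+n/k), a negligible loss for large k (`exists_lintegral_ball_ge`). Let X be a
2k-separated set of N points in {|g| > α}. Pigeonholing over K rapidly increasing radii r_j
(`exists_sparse_subset`) yields one scale and a sparse set of centres whose r_j-balls hold at least
N^(1-1/K)/K points of X. There the sparse estimate applies, and its loss R^ε is only a small power
of N; hence N^(1-η) ≲ α^(-(1+n/k)pbar) (`card_le_of_sparse_bound`). This is a weak-type bound at an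
exponent slightly above pbar, and since g is bounded the layer-cake formula gives every p > pbar.

Local bounds imply sparse bounds. Cut ω-space into cubes of side s = η(RN)^(-(d+2)). On B(x_j, R)
the kernel, demodulated by e_j = exp(2πiλφ(x_j/λ; ·)), varies by O(Rs) on each cube. There f may be
replaced by P_j f, obtained by averaging e_j f over cubes and multiplying back by the conjugate of
e_j. The local estimate is applied to each P_j f, and it remains to see that Σ_j ‖P_j f‖_p^p ≲
‖f‖_p^p. On one cube this concerns the integrals of f against the e_j. Their Gram matrix has
off-diagonal entries O(|x_j - x_k|^(-1/3)) (`exists_decay`), which sparseness makes O(s^d/N).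
Bessel's inequality then gives p = 2, and the trivial bound for averages gives all finite p ≥ 2
without interpolation (`sum_average_rpow_le`).

The decay rests on H1 and H2. A direction θ either is outside the kernel of the mixed Hessian, so
that some ∂_{ω_j}⟨∂_xφ, θ⟩ is nonzero, or is a multiple of G, and then H2 makes some second
ω-derivative nonzero (`exists_deriv_ne_zero`). Compactness makes this uniform, and integration by
parts along a coordinate axis gives the power 1/3. Any positive power would do, since the sparseness
exponent can be taken large. -/

namespace EpsRemoval

/-! ### Oscillating kernels and their iterated differences in x. -/

/-- Complex-valued smooth functions with compact support in `B^n × B^(n-1)`. -/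
structure IsTest {d : ℕ} (b : E (d + 1) × E d → ℂ) : Prop where
  smooth : ContDiff ℝ (⊤ : ℕ∞) b
  compact : HasCompactSupport b
  support : tsupport b ⊆ B (d + 1) ×ˢ B d

/-- The oscillating kernel `exp(2πi λ φ) b`. -/
noncomputable def osc {d : ℕ} (φ : E (d + 1) → E d → ℝ) (lam : ℝ) (b : E (d + 1) × E d → ℂ)
    (p : E (d + 1) × E d) : ℂ :=
  Complex.exp (2 * Real.pi * Complex.I * ((lam * φ p.1 p.2 : ℝ) : ℂ)) * b p

lemma isOpen_domain (d : ℕ) : IsOpen (B (d + 1) ×ˢ B d) := isOpen_ball.prod isOpen_ball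

lemma norm_exp_phase (t : ℝ) : ‖Complex.exp (2 * Real.pi * Complex.I * (t : ℂ))‖ = 1 := by
  have : 2 * (Real.pi : ℂ) * Complex.I * (t : ℂ) = ((2 * Real.pi * t : ℝ) : ℂ) * Complex.I := by
    push_cast; ring
  rw [this, Complex.norm_exp_ofReal_mul_I]

lemma norm_osc {d : ℕ} (φ : E (d + 1) → E d → ℝ) (lam : ℝ) (b : E (d + 1) × E d → ℂ)
    (p : E (d + 1) × E d) : ‖osc φ lam b p‖ = ‖b p‖ := by
  rw [osc, norm_mul, norm_exp_phase, one_mul]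

lemma IsAmplitude.isTest {d : ℕ} {φ a : E (d + 1) → E d → ℝ} (ha : IsAmplitude φ a) :
    IsTest (fun p : E (d + 1) × E d => ((a p.1 p.2 : ℝ) : ℂ)) := by
  have hs : tsupport (fun p : E (d + 1) × E d => ((a p.1 p.2 : ℝ) : ℂ)) =
      tsupport (Function.uncurry a) := by
    simp only [tsupport]
    congr 1
    ext p
    simp [Function.uncurry]
  refine ⟨?_, ?_, ?_⟩
  · exact Complex.ofRealCLM.contDiff.comp ha.smooth
  · unfold HasCompactSupport
    rw [hs]; exact ha.compact
  · rw [hs]; exact ha.support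

section

variable {d : ℕ} {φ : E (d + 1) → E d → ℝ} {b : E (d + 1) × E d → ℂ}

lemma IsTest.eventually_zero (hb : IsTest b) {p : E (d + 1) × E d}
    (hp : p ∉ B (d + 1) ×ˢ B d) : b =ᶠ[nhds p] 0 :=
  notMem_tsupport_iff_eventuallyEq.mp fun h => hp (hb.support h)

/-- Smoothness of g on the open domain suffices, because b vanishes near every point outside it; the
values of φ off the domain therefore never matter. -/
lemma IsTest.mul_of_contDiffOn (hb : IsTest b) {g : E (d + 1) × E d → ℂ}
    (hg : ContDiffOn ℝ (⊤ : ℕ∞) g (B (d + 1) ×ˢ B d)) : IsTest (fun p => g p * b p) := by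
  have hsub : tsupport (fun p => g p * b p) ⊆ tsupport b :=
    closure_mono fun p hp => by
      simp only [Function.mem_support] at hp ⊢
      exact right_ne_zero_of_mul hp
  refine ⟨?_, hb.compact.of_isClosed_subset (isClosed_tsupport _) hsub, hsub.trans hb.support⟩
  rw [contDiff_iff_contDiffAt]
  intro p
  by_cases hp : p ∈ B (d + 1) ×ˢ B d
  · exact (hg.contDiffAt ((isOpen_domain d).mem_nhds hp)).mul hb.smooth.contDiffAt
  · have : (fun p => g p * b p) =ᶠ[nhds p] fun _ => 0 := by
      filter_upwards [hb.eventually_zero hp] with q hq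
      simp [hq]
    exact contDiffAt_const.congr_of_eventuallyEq this

lemma IsTest.osc (hφ : ContDiffOn ℝ (⊤ : ℕ∞) (Function.uncurry φ) (B (d + 1) ×ˢ B d))
    (hb : IsTest b) (lam : ℝ) : IsTest (osc φ lam b) := by
  refine hb.mul_of_contDiffOn ?_
  refine ContDiffOn.cexp (contDiffOn_const.mul ?_)
  exact Complex.ofRealCLM.contDiff.comp_contDiffOn (contDiffOn_const.mul hφ)

lemma IsTest.fderiv_apply (hb : IsTest b) (w : E (d + 1) × E d) :
    IsTest (fun p => fderiv ℝ b p w) := by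
  have hsub : tsupport (fun p => fderiv ℝ b p w) ⊆ tsupport b := by
    refine (closure_mono ?_).trans (tsupport_fderiv_subset ℝ (f := b))
    intro p hp
    simp only [Function.mem_support] at hp ⊢
    intro h
    exact hp (by simp [h])
  refine ⟨?_, hb.compact.of_isClosed_subset (isClosed_tsupport _) hsub, hsub.trans hb.support⟩
  exact (hb.smooth.fderiv_right (m := (⊤ : ℕ∞)) (by simp)).clm_apply contDiff_const

lemma contDiffOn_fderiv_apply {F : Type*} [NormedAddCommGroup F] [NormedSpace ℝ F]
    {V : Type*} [NormedAddCommGroup V] [NormedSpace ℝ V] {g : V → F} {O : Set V}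
    (hO : IsOpen O) (hg : ContDiffOn ℝ (⊤ : ℕ∞) g O) (w : V) :
    ContDiffOn ℝ (⊤ : ℕ∞) (fun p => fderiv ℝ g p w) O :=
  (hg.fderiv_of_isOpen hO (m := (⊤ : ℕ∞)) (by simp)).clm_apply contDiffOn_const

lemma IsTest.phase_deriv_mul
    (hφ : ContDiffOn ℝ (⊤ : ℕ∞) (Function.uncurry φ) (B (d + 1) ×ˢ B d))
    (hb : IsTest b) (w : E (d + 1) × E d) :
    IsTest (fun p => 2 * Real.pi * Complex.I *
      ((fderiv ℝ (Function.uncurry φ) p w : ℝ) : ℂ) * b p) := by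
  refine hb.mul_of_contDiffOn (contDiffOn_const.mul ?_)
  exact Complex.ofRealCLM.contDiff.comp_contDiffOn
    (contDiffOn_fderiv_apply (isOpen_domain d) hφ w)

/-- Both terms are again oscillating kernels with test amplitudes, so derivatives of every order
stay in one class, and λ appears only next to a derivative of the phase. -/
lemma fderiv_osc (hφ : ContDiffOn ℝ (⊤ : ℕ∞) (Function.uncurry φ) (B (d + 1) ×ˢ B d))
    (hb : IsTest b) (lam : ℝ) (p w : E (d + 1) × E d) :
    fderiv ℝ (EpsRemoval.osc φ lam b) p w =
      lam * EpsRemoval.osc φ lam (fun p => 2 * Real.pi * Complex.I *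
        ((fderiv ℝ (Function.uncurry φ) p w : ℝ) : ℂ) * b p) p +
      EpsRemoval.osc φ lam (fun p => fderiv ℝ b p w) p := by
  by_cases hp : p ∈ B (d + 1) ×ˢ B d
  · have h1 : HasFDerivAt (Function.uncurry φ) (fderiv ℝ (Function.uncurry φ) p) p :=
      ((hφ.contDiffAt ((isOpen_domain d).mem_nhds hp)).differentiableAt (by simp)).hasFDerivAt
    have h2 : HasFDerivAt b (fderiv ℝ b p) p :=
      (hb.smooth.contDiffAt.differentiableAt (by simp)).hasFDerivAt
    have h3 : HasFDerivAt (fun p => ((lam * Function.uncurry φ p : ℝ) : ℂ)) _ p :=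
      Complex.ofRealCLM.hasFDerivAt.comp p (h1.const_mul lam)
    have h4 : HasFDerivAt (EpsRemoval.osc φ lam b) _ p :=
      ((h3.const_mul (2 * Real.pi * Complex.I)).cexp).mul h2
    rw [h4.fderiv]
    simp [EpsRemoval.osc, Function.uncurry]
    ring
  · have h0 := hb.eventually_zero hp
    have h1 : EpsRemoval.osc φ lam b =ᶠ[nhds p] fun _ => 0 := by
      filter_upwards [h0] with q hq
      simp [EpsRemoval.osc, hq]
    rw [h1.fderiv_eq]
    have h2 : fderiv ℝ b p = 0 := by
      rw [Filter.EventuallyEq.fderiv_eq (f := fun _ => (0 : ℂ)) h0]; simp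
    simp [EpsRemoval.osc, h2, h0.eq_of_nhds]

lemma IsTest.exists_bound (hb : IsTest b) : ∃ C : ℝ, 0 ≤ C ∧ ∀ p, ‖b p‖ ≤ C := by
  obtain ⟨C, hC⟩ := hb.compact.exists_bound_of_continuous hb.smooth.continuous
  exact ⟨C, (norm_nonneg _).trans (hC 0), hC⟩

lemma hasFDerivAt_fwdDiff_iter {V F : Type*} [NormedAddCommGroup V] [NormedSpace ℝ V]
    [NormedAddCommGroup F] [NormedSpace ℝ F] {g : V → F} {g' : V → V →L[ℝ] F}
    (h : ∀ x, HasFDerivAt g (g' x) x) (v : V) (k : ℕ) (x : V) :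
    HasFDerivAt ((fwdDiff v)^[k] g) ((fwdDiff v)^[k] g' x) x := by
  induction k generalizing x with
  | zero => exact h x
  | succ k ih =>
    rw [Function.iterate_succ_apply', Function.iterate_succ_apply']
    exact ((hasFDerivAt_comp_add_right v).2 (ih (x + v))).sub (ih x)

lemma fwdDiff_iter_clm_apply {V F : Type*} [NormedAddCommGroup V] [NormedSpace ℝ V]
    [NormedAddCommGroup F] [NormedSpace ℝ F] (g' : V → V →L[ℝ] F) (v w : V) (k : ℕ) (x : V) :
    (fwdDiff v)^[k] g' x w = (fwdDiff v)^[k] (fun y => g' y w) x := by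
  induction k generalizing x with
  | zero => rfl
  | succ k ih =>
    rw [Function.iterate_succ_apply', Function.iterate_succ_apply']
    simp [fwdDiff, ih]

/-- The iterated differences in `x` of the rescaled kernel are bounded uniformly in `λ ≥ 1`. -/
lemma norm_fwdDiff_iter_osc_le
    (hφ : ContDiffOn ℝ (⊤ : ℕ∞) (Function.uncurry φ) (B (d + 1) ×ˢ B d)) (k : ℕ) :
    ∀ b : E (d + 1) × E d → ℂ, IsTest b → ∃ C : ℝ, 0 ≤ C ∧ ∀ lam : ℝ, 1 ≤ lam → ∀ ω x v,
      ‖(fwdDiff v)^[k] (fun y => EpsRemoval.osc φ lam b (lam⁻¹ • y, ω)) x‖ ≤ C * ‖v‖ ^ k := by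
  induction k with
  | zero =>
    intro b hb
    obtain ⟨C, hC0, hC⟩ := hb.exists_bound
    exact ⟨C, hC0, fun lam _ ω x v => by simpa [norm_osc] using hC _⟩
  | succ k ih =>
    intro b hb
    -- Only coordinate derivatives enter, so the new amplitudes, and the constants supplied by the
    -- induction hypothesis, do not depend on v.
    let e : Fin (d + 1) → E (d + 1) × E d := fun i => (EuclideanSpace.single i 1, 0)
    choose C₁ hC₁0 hC₁ using fun i => ih _ (hb.phase_deriv_mul hφ (e i))
    choose C₂ hC₂0 hC₂ using fun i => ih _ (hb.fderiv_apply (e i))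
    refine ⟨∑ i, (C₁ i + C₂ i), Finset.sum_nonneg fun i _ => add_nonneg (hC₁0 i) (hC₂0 i), ?_⟩
    intro lam hlam ω x v
    have hlam0 : lam ≠ 0 := by positivity
    set κ : E (d + 1) → ℂ := fun y => EpsRemoval.osc φ lam b (lam⁻¹ • y, ω) with hκ
    let L : E (d + 1) →L[ℝ] E (d + 1) × E d :=
      (lam⁻¹ • ContinuousLinearMap.id ℝ (E (d + 1))).prod 0
    have hκd : ∀ y, HasFDerivAt κ
        ((fderiv ℝ (EpsRemoval.osc φ lam b) (lam⁻¹ • y, ω)).comp L) y := fun y =>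
      HasFDerivAt.comp y
        (((hb.osc hφ lam).smooth.contDiffAt.differentiableAt (by simp)).hasFDerivAt)
        (HasFDerivAt.prodMk ((hasFDerivAt_id y).const_smul lam⁻¹) (hasFDerivAt_const ω y))
    -- The chain rule through y ↦ λ⁻¹ y cancels the factor λ from the phase and leaves λ⁻¹ ≤ 1 in
    -- front of the derivative of the amplitude.
    let D : Fin (d + 1) → E (d + 1) → ℂ := fun i => ((v i : ℝ) : ℂ) •
      ((fun y => EpsRemoval.osc φ lam (fun p => 2 * Real.pi * Complex.I *
        ((fderiv ℝ (Function.uncurry φ) p (e i) : ℝ) : ℂ) * b p) (lam⁻¹ • y, ω)) +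
        ((lam⁻¹ : ℝ) : ℂ) • fun y => EpsRemoval.osc φ lam (fun p => fderiv ℝ b p (e i))
          (lam⁻¹ • y, ω))
    have hsum : ∀ y, (fderiv ℝ (EpsRemoval.osc φ lam b) (lam⁻¹ • y, ω)).comp L v =
        (∑ i, D i) y := by
      intro y
      have hv : L v = ∑ i, (v i * lam⁻¹) • e i := by
        have h1 : v = ∑ i, v i • (EuclideanSpace.single i (1 : ℝ) : E (d + 1)) := by
          ext j
          simp [Finset.sum_apply, Pi.single_apply]
        have h2 : L v = (lam⁻¹ • v, 0) := rfl
        rw [h2]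
        refine Prod.ext ?_ ?_
        · simp only [Prod.fst_sum, Prod.smul_fst, e]
          conv_lhs => rw [h1]
          rw [Finset.smul_sum]
          refine Finset.sum_congr rfl fun i _ => ?_
          rw [smul_smul, mul_comm]
        · simp [Prod.snd_sum, e]
      rw [ContinuousLinearMap.comp_apply, hv, map_sum, Finset.sum_apply]
      refine Finset.sum_congr rfl fun i _ => ?_
      rw [map_smul, fderiv_osc hφ hb]
      have : ((lam : ℝ) : ℂ) ≠ 0 := by exact_mod_cast hlam0
      simp only [D, Pi.smul_apply, Pi.add_apply, Complex.real_smul, smul_eq_mul]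
      push_cast
      field_simp
    have hder : ∀ y, ‖(fwdDiff v)^[k]
        (fun y => (fderiv ℝ (EpsRemoval.osc φ lam b) (lam⁻¹ • y, ω)).comp L) y v‖ ≤
        (∑ i, (C₁ i + C₂ i)) * ‖v‖ ^ (k + 1) := by
      intro y
      rw [fwdDiff_iter_clm_apply]
      simp only [hsum]
      rw [fwdDiff_iter_finsetSum, Finset.sum_apply, Finset.sum_mul]
      refine (norm_sum_le _ _).trans (Finset.sum_le_sum fun i _ => ?_)
      simp only [D]
      rw [fwdDiff_iter_const_smul]
      rw [fwdDiff_iter_add, fwdDiff_iter_const_smul, Pi.smul_apply, norm_smul, Pi.add_apply,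
        Pi.smul_apply]
      have hvi : ‖((v i : ℝ) : ℂ)‖ ≤ ‖v‖ := by
        rw [Complex.norm_real]; exact PiLp.norm_apply_le v i
      have hl : ‖((lam⁻¹ : ℝ) : ℂ)‖ ≤ 1 := by
        rw [Complex.norm_real, Real.norm_of_nonneg (by positivity)]
        exact inv_le_one_of_one_le₀ hlam
      have h1 := hC₁ i lam hlam ω y v
      have h2 := hC₂ i lam hlam ω y v
      calc _ ≤ ‖v‖ * (C₁ i * ‖v‖ ^ k + 1 * (C₂ i * ‖v‖ ^ k)) := by
            refine mul_le_mul hvi ((norm_add_le _ _).trans (add_le_add h1 ?_)) (norm_nonneg _)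
              (norm_nonneg _)
            rw [norm_smul]
            exact mul_le_mul hl h2 (norm_nonneg _) zero_le_one
        _ = _ := by ring
    rw [Function.iterate_succ_apply']
    change ‖(fwdDiff v)^[k] κ (x + v) - (fwdDiff v)^[k] κ x‖ ≤ _
    -- The outermost difference is traded for a derivative along the segment from x to x + v, which
    -- gains one more factor ‖v‖.
    have hline : ∀ t ∈ Icc (0 : ℝ) 1, HasDerivWithinAt (fun t : ℝ => (fwdDiff v)^[k] κ (x + t • v))
        ((fwdDiff v)^[k] (fun y => (fderiv ℝ (EpsRemoval.osc φ lam b) (lam⁻¹ • y, ω)).comp L)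
          (x + t • v) v) (Icc 0 1) t := by
      intro t _
      have h1 : HasDerivAt (fun t : ℝ => x + t • v) v t := by
        simpa using ((hasDerivAt_id t).smul_const v).const_add x
      exact ((hasFDerivAt_fwdDiff_iter hκd v k (x + t • v)).comp_hasDerivAt t h1).hasDerivWithinAt
    have := norm_image_sub_le_of_norm_deriv_le_segment' hline (fun t _ => hder (x + t • v)) 1
      (by simp)
    simpa using this

end

/-! ### Uniform boundedness and smoothness of T f. -/

section

variable {d : ℕ} {φ a : E (d + 1) → E d → ℝ}

lemma T_eq (lam : ℝ) (f : E d → ℂ) (x : E (d + 1)) :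
    T φ a lam f x = ∫ ω in B d, osc φ lam (fun p => ((a p.1 p.2 : ℝ) : ℂ)) (lam⁻¹ • x, ω) * f ω :=
  rfl

lemma integrable_fwdDiff_iter_osc_mul
    (hφ : ContDiffOn ℝ (⊤ : ℕ∞) (Function.uncurry φ) (B (d + 1) ×ˢ B d))
    {b : E (d + 1) × E d → ℂ} (hb : IsTest b) (lam : ℝ) {f : E d → ℂ} {s : Set (E d)}
    (hf : IntegrableOn f s) (v : E (d + 1)) (k : ℕ) (x : E (d + 1)) :
    IntegrableOn (fun ω => (fwdDiff v)^[k] (fun y => osc φ lam b (lam⁻¹ • y, ω)) x * f ω) s := by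
  induction k generalizing x with
  | zero =>
    obtain ⟨C, _, hC⟩ := hb.exists_bound
    have hc : Continuous fun ω => osc φ lam b (lam⁻¹ • x, ω) :=
      (hb.osc hφ lam).smooth.continuous.comp (by fun_prop)
    exact hf.bdd_mul (c := C) hc.aestronglyMeasurable
      (Filter.Eventually.of_forall fun ω => (norm_osc φ lam b _).trans_le (hC _))
  | succ k ih =>
    simp only [Function.iterate_succ_apply', fwdDiff, sub_mul]
    exact (ih _).sub (ih _)

/-- Finite differences pass through the integral by linearity, so no differentiation under the
integral sign is needed. -/
lemma fwdDiff_iter_T (hφ : ContDiffOn ℝ (⊤ : ℕ∞) (Function.uncurry φ) (B (d + 1) ×ˢ B d))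
    (ha : IsAmplitude φ a) (lam : ℝ) {f : E d → ℂ} (hf : IntegrableOn f (B d))
    (v : E (d + 1)) (k : ℕ) (x : E (d + 1)) :
    (fwdDiff v)^[k] (T φ a lam f) x = ∫ ω in B d, (fwdDiff v)^[k]
      (fun y => osc φ lam (fun p => ((a p.1 p.2 : ℝ) : ℂ)) (lam⁻¹ • y, ω)) x * f ω := by
  induction k generalizing x with
  | zero => rfl
  | succ k ih =>
    simp only [Function.iterate_succ_apply', fwdDiff, sub_mul]
    rw [ih, ih, integral_sub]
    · exact integrable_fwdDiff_iter_osc_mul hφ ha.isTest lam hf v k _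
    · exact integrable_fwdDiff_iter_osc_mul hφ ha.isTest lam hf v k _

lemma norm_fwdDiff_iter_T_le
    (hφ : ContDiffOn ℝ (⊤ : ℕ∞) (Function.uncurry φ) (B (d + 1) ×ˢ B d))
    (ha : IsAmplitude φ a) (k : ℕ) : ∃ C : ℝ, 0 ≤ C ∧ ∀ lam : ℝ, 1 ≤ lam → ∀ f : E d → ℂ,
      IntegrableOn f (B d) → ∀ x v,
        ‖(fwdDiff v)^[k] (T φ a lam f) x‖ ≤ C * ‖v‖ ^ k * ∫ ω in B d, ‖f ω‖ := by
  obtain ⟨C, hC0, hC⟩ := norm_fwdDiff_iter_osc_le hφ k _ ha.isTest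
  refine ⟨C, hC0, fun lam hlam f hf x v => ?_⟩
  rw [fwdDiff_iter_T hφ ha lam hf, ← integral_const_mul]
  refine norm_integral_le_of_norm_le (hf.norm.const_mul _) (Filter.Eventually.of_forall fun ω => ?_)
  rw [norm_mul]
  exact mul_le_mul_of_nonneg_right (hC lam hlam ω x v) (norm_nonneg _)

lemma norm_T_le (hφ : ContDiffOn ℝ (⊤ : ℕ∞) (Function.uncurry φ) (B (d + 1) ×ˢ B d))
    (ha : IsAmplitude φ a) : ∃ C : ℝ, 0 ≤ C ∧ ∀ lam : ℝ, 1 ≤ lam → ∀ f : E d → ℂ,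
      IntegrableOn f (B d) → ∀ x, ‖T φ a lam f x‖ ≤ C * ∫ ω in B d, ‖f ω‖ := by
  obtain ⟨C, hC0, hC⟩ := norm_fwdDiff_iter_T_le hφ ha 0
  exact ⟨C, hC0, fun lam hlam f hf x => by simpa using hC lam hlam f hf x 0⟩

lemma continuous_T (hφ : ContDiffOn ℝ (⊤ : ℕ∞) (Function.uncurry φ) (B (d + 1) ×ˢ B d))
    (ha : IsAmplitude φ a) {lam : ℝ} (hlam : 1 ≤ lam) {f : E d → ℂ} (hf : IntegrableOn f (B d)) :
    Continuous (T φ a lam f) := by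
  obtain ⟨C, hC0, hC⟩ := norm_fwdDiff_iter_T_le hφ ha 1
  have : LipschitzWith (Real.toNNReal (C * ∫ ω in B d, ‖f ω‖)) (T φ a lam f) := by
    refine LipschitzWith.of_dist_le_mul fun x y => ?_
    rw [Real.coe_toNNReal _ (mul_nonneg hC0 (integral_nonneg fun _ => norm_nonneg _)),
      dist_eq_norm, dist_eq_norm]
    have := hC lam hlam f hf y (x - y)
    simp only [Function.iterate_one, fwdDiff, add_sub_cancel, pow_one] at this
    linarith
  exact this.continuous

lemma T_const_mul (lam : ℝ) (c : ℂ) (f : E d → ℂ) (x : E (d + 1)) :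
    T φ a lam (fun ω => c * f ω) x = c * T φ a lam f x := by
  rw [T_eq, T_eq, ← integral_const_mul]
  congr 1
  ext ω
  ring

end

/-! ### Large values force large local mass. -/

section

variable {n : ℕ}

-- The dilation v ↦ j v has Jacobian factor j^(-n) ≤ 1 and sends the ball of radius r ≤ 1 into the
-- ball of radius k.
open scoped Pointwise in
lemma setIntegral_ball_comp_add_smul_le {g : E n → ℝ} (hg : Continuous g) (hg0 : ∀ x, 0 ≤ g x)
    (y : E n) {r : ℝ} (hr1 : r ≤ 1) {j k : ℕ} (hj : 1 ≤ j) (hjk : j ≤ k) :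
    ∫ v in ball (0 : E n) r, g (y + j • v) ≤ ∫ x in ball y k, g x := by
  have hj0 : (0 : ℝ) < j := by exact_mod_cast hj
  have h1 := Measure.setIntegral_comp_smul_of_pos (volume : Measure (E n))
    (fun v => g (y + v)) (ball (0 : E n) r) hj0
  have h2 : ((j : ℝ) • ball (0 : E n) r) = ball (0 : E n) (j * r) := by
    rw [_root_.smul_ball hj0.ne', smul_zero, Real.norm_of_nonneg hj0.le]
  have h3 : ∫ x in ball y k, g x = ∫ v in ball (0 : E n) k, g (y + v) := by
    have := (measurePreserving_add_left (volume : Measure (E n)) y).setIntegral_preimage_emb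
      (measurableEmbedding_addLeft y) g (ball y k)
    rw [← this, preimage_add_ball, sub_self]
  have hint : IntegrableOn (fun v => g (y + v)) (ball (0 : E n) k) :=
    ((hg.comp (continuous_const.add continuous_id)).continuousOn.integrableOn_compact
      (isCompact_closedBall (0 : E n) k)).mono_set ball_subset_closedBall
  have hnn : ∀ s : Set (E n), 0 ≤ ∫ v in s, g (y + v) := fun s => integral_nonneg fun _ => hg0 _
  rw [h3]
  simp only [← Nat.cast_smul_eq_nsmul ℝ]
  rw [h1, h2, smul_eq_mul]
  have h4 : ((j : ℝ) ^ Module.finrank ℝ (E n))⁻¹ ≤ 1 :=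
    inv_le_one_of_one_le₀ (one_le_pow₀ (by exact_mod_cast hj))
  refine (mul_le_of_le_one_left (hnn _) h4).trans ?_
  refine setIntegral_mono_set hint (Filter.Eventually.of_forall fun _ => hg0 _)
    (LE.le.eventuallyLE (ball_subset_ball ?_))
  have : (j : ℝ) ≤ k := by exact_mod_cast hjk
  nlinarith

/-- Control of a value by an average, up to a high-order difference. -/
lemma norm_le_average_add (k : ℕ) : ∃ C : ℝ, 0 < C ∧ ∀ g : E n → ℂ, Continuous g →
    ∀ (D : ℝ) (y : E n), 0 ≤ D → (∀ v, ‖(fwdDiff v)^[k] g y‖ ≤ D * ‖v‖ ^ k) →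
      ∀ r : ℝ, 0 < r → r ≤ 1 →
        ‖g y‖ ≤ C * (r ^ n)⁻¹ * (∫ x in ball y k, ‖g x‖) + D * r ^ k := by
  set V := (volume : Measure (E n)).real (ball 0 1) with hV
  have hV0 : 0 < V :=
    ENNReal.toReal_pos (measure_ball_pos _ _ one_pos).ne' measure_ball_lt_top.ne
  refine ⟨2 ^ k * V⁻¹, by positivity, fun g hg D y hD hv r hr hr1 => ?_⟩
  have hVr : (volume : Measure (E n)).real (ball 0 r) = r ^ n * V := by
    rw [measureReal_def, Measure.addHaar_ball_of_pos _ _ hr, ENNReal.toReal_mul,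
      ENNReal.toReal_ofReal (by positivity)]
    simp [hV, measureReal_def]
  set I := ∫ x in ball y k, ‖g x‖ with hI
  have hI0 : 0 ≤ I := integral_nonneg fun _ => norm_nonneg _
  -- In the expansion of the k-th difference as Σ (-1)^(k-j) (k choose j) g(y + j v), the term j = 0
  -- is ±g(y). It is isolated here, before averaging over v.
  have hpt : ∀ v ∈ ball (0 : E n) r, ‖g y‖ ≤
      ∑ j ∈ Finset.range k, (k.choose (j + 1) : ℝ) * ‖g (y + (j + 1) • v)‖ + D * r ^ k := by
    intro v hvr
    have h1 := hv v
    rw [fwdDiff_iter_eq_sum_shift, Finset.sum_range_succ'] at h1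
    set S := ∑ j ∈ Finset.range k, ((-1 : ℤ) ^ (k - (j + 1)) * (k.choose (j + 1) : ℤ)) •
      g (y + (j + 1) • v) with hS
    have h2 : ‖S‖ ≤ ∑ j ∈ Finset.range k, (k.choose (j + 1) : ℝ) * ‖g (y + (j + 1) • v)‖ := by
      refine (norm_sum_le _ _).trans (Finset.sum_le_sum fun j _ => le_of_eq ?_)
      rw [zsmul_eq_mul, norm_mul]
      push_cast
      rw [norm_mul, norm_pow, norm_neg, norm_one, one_pow, one_mul]
      simp
    have h3 : ‖((-1 : ℤ) ^ (k - 0) * (k.choose 0 : ℤ)) • g (y + 0 • v)‖ = ‖g y‖ := by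
      rw [zsmul_eq_mul, norm_mul]
      simp
    have h4 : ‖v‖ ^ k ≤ r ^ k := by
      rw [mem_ball_zero_iff] at hvr
      exact pow_le_pow_left₀ (norm_nonneg _) hvr.le k
    have h5 : ‖((-1 : ℤ) ^ (k - 0) * (k.choose 0 : ℤ)) • g (y + 0 • v)‖ ≤ ‖S‖ +
        ‖S + ((-1 : ℤ) ^ (k - 0) * (k.choose 0 : ℤ)) • g (y + 0 • v)‖ := by
      have := norm_sub_le (S + ((-1 : ℤ) ^ (k - 0) * (k.choose 0 : ℤ)) • g (y + 0 • v)) S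
      rw [add_sub_cancel_left] at this
      linarith
    rw [h3] at h5
    have h6 := mul_le_mul_of_nonneg_left h4 hD
    linarith
  have hfin : volume (ball (0 : E n) r) ≠ ∞ := measure_ball_lt_top.ne
  have hint : ∀ j : ℕ, IntegrableOn
      (fun v => (k.choose (j + 1) : ℝ) * ‖g (y + (j + 1) • v)‖) (ball (0 : E n) r) := fun j =>
    ((by fun_prop : Continuous fun v => (k.choose (j + 1) : ℝ) *
      ‖g (y + (j + 1) • v)‖).continuousOn.integrableOn_compact
      (isCompact_closedBall (0 : E n) r)).mono_set ball_subset_closedBall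
  have hmono := setIntegral_mono_on (μ := volume) (s := ball (0 : E n) r)
    (integrableOn_const (C := ‖g y‖) hfin)
    ((integrable_finsetSum _ fun j _ => hint j).add (integrableOn_const (C := D * r ^ k) hfin))
    measurableSet_ball hpt
  simp only [Pi.add_apply] at hmono
  rw [setIntegral_const, integral_add (integrable_finsetSum _ fun j _ => hint j)
    (integrableOn_const hfin), setIntegral_const, integral_finsetSum _ fun j _ => hint j,
    hVr, smul_eq_mul, smul_eq_mul] at hmono
  have hsum : ∑ j ∈ Finset.range k, ∫ v in ball (0 : E n) r,
      (k.choose (j + 1) : ℝ) * ‖g (y + (j + 1) • v)‖ ≤ 2 ^ k * I := by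
    calc _ ≤ ∑ j ∈ Finset.range k, (k.choose (j + 1) : ℝ) * I := by
          refine Finset.sum_le_sum fun j hj => ?_
          rw [integral_const_mul]
          exact mul_le_mul_of_nonneg_left (setIntegral_ball_comp_add_smul_le hg.norm
            (fun _ => norm_nonneg _) y hr1 (by omega) (by simpa using hj)) (Nat.cast_nonneg _)
      _ = (∑ j ∈ Finset.range k, (k.choose (j + 1) : ℝ)) * I := by rw [Finset.sum_mul]
      _ ≤ 2 ^ k * I := by
          refine mul_le_mul_of_nonneg_right ?_ hI0
          have := Nat.sum_range_choose k
          rw [Finset.sum_range_succ'] at this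
          have h : ∑ j ∈ Finset.range k, k.choose (j + 1) ≤ 2 ^ k := by omega
          exact_mod_cast h
  have hrn : 0 < r ^ n := pow_pos hr n
  have h7 : r ^ n * V * ‖g y‖ ≤ 2 ^ k * I + r ^ n * V * (D * r ^ k) := hmono.trans (by gcongr)
  have h8 : 2 ^ k * V⁻¹ * (r ^ n)⁻¹ * I + D * r ^ k =
      (2 ^ k * I + r ^ n * V * (D * r ^ k)) / (r ^ n * V) := by
    field_simp
  rw [h8, le_div_iff₀ (by positivity)]
  linarith

/-- Where a function with bounded `k`-th differences is large, it has large local `L^q` norm. -/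
lemma exists_lintegral_ball_ge (k : ℕ) (hk : 1 ≤ k) (q : ℝ) (hq : 1 ≤ q) (D : ℝ) (hD : 0 < D) :
    ∃ c : ℝ, 0 < c ∧ ∀ g : E n → ℂ, Continuous g →
      (∀ y v, ‖(fwdDiff v)^[k] g y‖ ≤ D * ‖v‖ ^ k) → ∀ α : ℝ, 0 < α → α ≤ D → ∀ y, α < ‖g y‖ →
        ENNReal.ofReal (c * α ^ ((1 + n / k : ℝ) * q)) ≤ ∫⁻ x in ball y k, ‖g x‖ₑ ^ q := by
  obtain ⟨C, hC, H⟩ := norm_le_average_add (n := n) k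
  have hk0 : (0 : ℝ) < k := by exact_mod_cast hk
  set W := (volume : Measure (E n)) (ball 0 k) with hW
  have hW0 : W ≠ 0 := (measure_ball_pos _ _ hk0).ne'
  have hWt : W ≠ ∞ := measure_ball_lt_top.ne
  have hWr : 0 < W.toReal := ENNReal.toReal_pos hW0 hWt
  set c₀ := (2 * C)⁻¹ * (2 * D)⁻¹ ^ (n / k : ℝ) with hc₀
  have hc₀0 : 0 < c₀ := by positivity
  refine ⟨c₀ ^ q * (W.toReal ^ (q - 1))⁻¹, by positivity, fun g hg hv α hα hαD y hy => ?_⟩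
  -- This radius makes the difference error D r^k equal to α/2, while the volume factor r^n costs
  -- only α^(n/k).
  set r := (α / (2 * D)) ^ (1 / k : ℝ) with hr
  have hx0 : 0 < α / (2 * D) := by positivity
  have hx1 : α / (2 * D) ≤ 1 := by rw [div_le_one (by positivity)]; linarith
  have hr0 : 0 < r := Real.rpow_pos_of_pos hx0 _
  have hr1 : r ≤ 1 := Real.rpow_le_one hx0.le hx1 (by positivity)
  have hrk : r ^ k = α / (2 * D) := by
    rw [hr, ← Real.rpow_natCast, ← Real.rpow_mul hx0.le, one_div_mul_cancel hk0.ne', Real.rpow_one]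
  have hrn : r ^ n = (α / (2 * D)) ^ (n / k : ℝ) := by
    rw [hr, ← Real.rpow_natCast, ← Real.rpow_mul hx0.le]; congr 1; field_simp
  have h1 := H g hg D y hD.le (hv y) r hr0 hr1
  set I := ∫ x in ball y k, ‖g x‖ with hI
  have hI0 : 0 ≤ I := integral_nonneg fun _ => norm_nonneg _
  have h2 : D * r ^ k = α / 2 := by rw [hrk]; field_simp
  have h3 : c₀ * α ^ (1 + n / k : ℝ) ≤ I := by
    have h4 : α / 2 ≤ C * (r ^ n)⁻¹ * I := by linarith
    have h5 : α * r ^ n ≤ 2 * C * I := by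
      have h6 := mul_le_mul_of_nonneg_right h4 (pow_pos hr0 n).le
      have : C * (r ^ n)⁻¹ * I * r ^ n = C * I := by field_simp
      nlinarith
    have h6 : c₀ * α ^ (1 + n / k : ℝ) = (2 * C)⁻¹ * (α * r ^ n) := by
      rw [hc₀, hrn, div_eq_mul_inv α, Real.mul_rpow hα.le (by positivity), Real.rpow_add hα,
        Real.rpow_one]
      ring
    rw [h6, inv_mul_le_iff₀ (by positivity)]
    exact h5
  have hgi : IntegrableOn g (ball y k) :=
    (hg.continuousOn.integrableOn_compact (isCompact_closedBall y (k : ℝ))).mono_set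
      ball_subset_closedBall
  have h7 : ENNReal.ofReal I = eLpNorm g 1 (volume.restrict (ball y k)) := by
    rw [eLpNorm_one_eq_lintegral_enorm, hI, ofReal_integral_norm_eq_lintegral_enorm hgi]
  have hq0 : 0 < q := by linarith
  have h8 := eLpNorm_le_eLpNorm_mul_rpow_measure_univ (p := 1) (q := ENNReal.ofReal q)
    (μ := volume.restrict (ball y k)) (by simpa using hq) hg.aestronglyMeasurable
  rw [← h7, Measure.restrict_apply_univ, ENNReal.toReal_one, ENNReal.toReal_ofReal hq0.le,
    Measure.addHaar_ball_center, ← hW, eLpNorm_eq_lintegral_rpow_enorm_toReal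
    (by simpa using hq0) ENNReal.ofReal_ne_top, ENNReal.toReal_ofReal hq0.le] at h8
  have h9 : ENNReal.ofReal I ^ q ≤ (∫⁻ x in ball y k, ‖g x‖ₑ ^ q) * W ^ (q - 1) := by
    refine (ENNReal.rpow_le_rpow h8 hq0.le).trans (le_of_eq ?_)
    rw [ENNReal.mul_rpow_of_nonneg _ _ hq0.le, ← ENNReal.rpow_mul, ← ENNReal.rpow_mul,
      one_div_mul_cancel hq0.ne', ENNReal.rpow_one]
    congr 2
    field_simp
  have h10 : ENNReal.ofReal (c₀ ^ q * (W.toReal ^ (q - 1))⁻¹ * α ^ ((1 + n / k : ℝ) * q)) =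
      ENNReal.ofReal (c₀ * α ^ (1 + n / k : ℝ)) ^ q * (W ^ (q - 1))⁻¹ := by
    rw [ENNReal.ofReal_rpow_of_nonneg (by positivity) hq0.le, Real.mul_rpow hc₀0.le (by positivity),
      ← Real.rpow_mul hα.le, ← ENNReal.ofReal_toReal hWt,
      ENNReal.ofReal_rpow_of_nonneg ENNReal.toReal_nonneg (by linarith),
      ← ENNReal.ofReal_inv_of_pos (by positivity),
      ← ENNReal.ofReal_mul (by positivity)]
    congr 1
    rw [ENNReal.toReal_ofReal hWr.le]
    ring
  rw [h10, ← div_eq_mul_inv]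
  refine ENNReal.div_le_of_le_mul ?_
  exact (ENNReal.rpow_le_rpow (ENNReal.ofReal_le_ofReal h3) hq0.le).trans h9

end

/-! ### Sparse subsets by pigeonholing scales. -/

section

open scoped Classical in
/-- The number of points of `X` at distance at most `r` from `x`. -/
noncomputable def countWithin {α : Type*} [PseudoMetricSpace α] (X : Finset α) (r : ℝ) (x : α) :
    ℕ := (X.filter fun y => dist x y ≤ r).card

variable {α : Type*} [PseudoMetricSpace α]

-- A separated subset of largest cardinality covers. The alternative x = y matters only for negative
-- r, where dist x x ≤ r fails.
open scoped Classical in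
lemma exists_maximal_separated (Y : Finset α) (r : ℝ) : ∃ X' ⊆ Y,
    (∀ x ∈ X', ∀ y ∈ X', x ≠ y → r < dist x y) ∧
      ∀ y ∈ Y, ∃ x ∈ X', x = y ∨ dist x y ≤ r := by
  obtain ⟨X', hX', hmax⟩ := Finset.exists_max_image
    (Y.powerset.filter fun X' => ∀ x ∈ X', ∀ y ∈ X', x ≠ y → r < dist x y) Finset.card
    ⟨∅, by simp⟩
  rw [Finset.mem_filter, Finset.mem_powerset] at hX'
  refine ⟨X', hX'.1, hX'.2, fun y hy => ?_⟩
  by_contra! h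
  have hyX : y ∉ X' := fun hyX => (h y hyX).1 rfl
  have := hmax (insert y X') (by
    rw [Finset.mem_filter, Finset.mem_powerset]
    refine ⟨Finset.insert_subset hy hX'.1, ?_⟩
    intro u hu v hv huv
    rw [Finset.mem_insert] at hu hv
    rcases hu with rfl | hu <;> rcases hv with rfl | hv
    · exact absurd rfl huv
    · rw [dist_comm]; exact (h v hv).2
    · exact (h u hu).2
    · exact hX'.2 u hu v hv huv)
  rw [Finset.card_insert_of_notMem hyX] at this
  omega

open scoped Classical in
/-- A finite set contains a separated subset whose neighbourhoods at a smaller scale carry a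
substantial proportion of the set. -/
lemma exists_sparse_subset (X : Finset α) (hX : X.Nonempty) (K : ℕ) (hK : 1 ≤ K) (r : ℕ → ℝ)
    (hr : ∀ j, 0 ≤ r j) : ∃ j < K, ∃ X' ⊆ X,
      (∀ x ∈ X', ∀ y ∈ X', x ≠ y → r (j + 1) < dist x y) ∧
      (X.card : ℝ) ≤ K * (X.card : ℝ) ^ (1 / K : ℝ) * ∑ x ∈ X', (countWithin X (r j) x : ℝ) := by
  set N : ℝ := (X.card : ℝ) with hN
  have hK0 : (0 : ℝ) < K := by exact_mod_cast hK
  have hN0 : 0 < N := by rw [hN]; exact_mod_cast hX.card_pos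
  set s := N ^ (1 / K : ℝ) with hs
  have hs0 : 0 < s := Real.rpow_pos_of_pos hN0 _
  let Y : ℕ → Finset α := fun j =>
    X.filter fun x => (countWithin X (r (j + 1)) x : ℝ) ≤ s * countWithin X (r j) x
  -- If the count about x grew by a factor above s = N^(1/K) at each of the K scales, then, starting
  -- from at least 1 (the point x itself), it would end above N.
  have hpig : ∀ x ∈ X, ∃ j ∈ Finset.range K, x ∈ Y j := by
    intro x hx
    by_contra! h
    have h' : ∀ j < K, s * countWithin X (r j) x < countWithin X (r (j + 1)) x := fun j hj => by
      have := h j (by simpa using hj)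
      simp only [Y, Finset.mem_filter, hx, true_and, not_le] at this
      exact this
    have h0 : ∀ j ≤ K, s ^ j ≤ countWithin X (r j) x := by
      intro j
      induction j with
      | zero =>
        intro _
        rw [pow_zero, Nat.one_le_cast]
        exact Finset.card_pos.2 ⟨x, by simp [hx, hr 0]⟩
      | succ j ih =>
        intro hj
        rw [pow_succ']
        exact (mul_le_mul_of_nonneg_left (ih (by omega)) hs0.le).trans (h' j (by omega)).le
    obtain ⟨k, rfl⟩ : ∃ k, K = k + 1 := ⟨K - 1, by omega⟩
    have h1 := mul_le_mul_of_nonneg_left (h0 k (by omega)) hs0.le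
    have h2 := h' k (by omega)
    have h3 : s * s ^ k = N := by
      rw [← pow_succ', hs, ← Real.rpow_natCast, ← Real.rpow_mul hN0.le,
        one_div_mul_cancel hK0.ne', Real.rpow_one]
    have h4 : (countWithin X (r (k + 1)) x : ℝ) ≤ N := by
      rw [hN]; exact_mod_cast Finset.card_filter_le _ _
    linarith
  have hcard : X.card ≤ ∑ j ∈ Finset.range K, (Y j).card := by
    refine le_trans (Finset.card_le_card ?_) Finset.card_biUnion_le
    intro x hx
    obtain ⟨j, hj, hxj⟩ := hpig x hx
    exact Finset.mem_biUnion.2 ⟨j, hj, hxj⟩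
  -- One scale is good for at least a fraction 1/K of the points.
  obtain ⟨j, hj, hYj⟩ : ∃ j ∈ Finset.range K, X.card ≤ K * (Y j).card := by
    by_contra! h
    have h1 : ∑ j ∈ Finset.range K, K * (Y j).card < ∑ j ∈ Finset.range K, X.card :=
      Finset.sum_lt_sum_of_nonempty (by simp; omega) h
    rw [← Finset.mul_sum, Finset.sum_const, Finset.card_range, smul_eq_mul] at h1
    exact absurd (Nat.lt_of_mul_lt_mul_left h1) (not_lt.2 hcard)
  -- Maximality at the larger radius lets the r (j + 1)-balls about X' cover Y j. Membership in Y j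
  -- then allows shrinking to radius r j at the cost of a factor s.
  obtain ⟨X', hX', hsep, hcov⟩ := exists_maximal_separated (Y j) (r (j + 1))
  refine ⟨j, by simpa using hj, X', hX'.trans (Finset.filter_subset _ _), hsep, ?_⟩
  have h1 : (Y j).card ≤ ∑ x ∈ X', countWithin X (r (j + 1)) x := by
    refine le_trans (Finset.card_le_card ?_) Finset.card_biUnion_le
    intro y hy
    obtain ⟨x, hx, hxy⟩ := hcov y hy
    refine Finset.mem_biUnion.2 ⟨x, hx, ?_⟩
    rw [Finset.mem_filter]
    refine ⟨(Finset.filter_subset _ _) hy, ?_⟩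
    rcases hxy with rfl | hxy
    · rw [dist_self]; exact hr _
    · exact hxy
  have h2 : ∑ x ∈ X', (countWithin X (r (j + 1)) x : ℝ) ≤
      s * ∑ x ∈ X', (countWithin X (r j) x : ℝ) := by
    rw [Finset.mul_sum]
    exact Finset.sum_le_sum fun x hx => (Finset.mem_filter.1 (hX' hx)).2
  calc N ≤ K * (Y j).card := by rw [hN]; exact_mod_cast hYj
    _ ≤ K * ∑ x ∈ X', (countWithin X (r (j + 1)) x : ℝ) :=
        mul_le_mul_of_nonneg_left (by exact_mod_cast h1) hK0.le
    _ ≤ K * (s * ∑ x ∈ X', (countWithin X (r j) x : ℝ)) := mul_le_mul_of_nonneg_left h2 hK0.le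
    _ = _ := by ring

/-- Rapidly increasing radii: `r₀ = 0`, `r_{j+1} = ((r_j + ρ) N)^Cbar`. -/
noncomputable def radii (Cbar ρ N : ℝ) : ℕ → ℝ
  | 0 => 0
  | j + 1 => ((radii Cbar ρ N j + ρ) * N) ^ Cbar

lemma radii_nonneg {Cbar ρ N : ℝ} (hρ : 1 ≤ ρ) (hN : 1 ≤ N) (j : ℕ) : 0 ≤ radii Cbar ρ N j := by
  induction j with
  | zero => exact le_rfl
  | succ j ih => exact Real.rpow_nonneg (by positivity) _

/-- Each step raises to a fixed power, so after boundedly many steps the radius is still a fixed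
power of ρN. This is what turns a loss R^ε into a small power of N. -/
lemma exists_radii_le {Cbar : ℝ} (hC : 1 ≤ Cbar) (K : ℕ) : ∃ b : ℝ, 1 ≤ b ∧
    ∀ ρ N : ℝ, 1 ≤ ρ → 1 ≤ N → ∀ j ≤ K, radii Cbar ρ N j + ρ ≤ (2 * ρ * N) ^ b := by
  induction K with
  | zero =>
    refine ⟨1, le_rfl, fun ρ N hρ hN j hj => ?_⟩
    obtain rfl : j = 0 := by omega
    simp only [radii, Real.rpow_one]
    nlinarith
  | succ K ih =>
    obtain ⟨b, hb, H⟩ := ih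
    refine ⟨(b + 1) * Cbar + 1, by nlinarith, fun ρ N hρ hN j hj => ?_⟩
    have hY : 2 ≤ 2 * ρ * N := by nlinarith
    have hY0 : 0 < 2 * ρ * N := by linarith
    rcases Nat.lt_or_ge j (K + 1) with h | h
    · exact (H ρ N hρ hN j (by omega)).trans
        (Real.rpow_le_rpow_of_exponent_le (by linarith) (by nlinarith))
    · obtain rfl : j = K + 1 := by omega
      have h1 := H ρ N hρ hN K le_rfl
      have h0 := radii_nonneg (Cbar := Cbar) hρ hN K
      have h2 : radii Cbar ρ N (K + 1) ≤ (2 * ρ * N) ^ ((b + 1) * Cbar) := by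
        rw [Real.rpow_mul hY0.le, Real.rpow_add hY0, Real.rpow_one]
        refine Real.rpow_le_rpow (by positivity) ?_ (by linarith)
        exact mul_le_mul h1 (by nlinarith) (by linarith) (by positivity)
      have h3 : ρ ≤ (2 * ρ * N) ^ ((b + 1) * Cbar) := by
        refine le_trans ?_ (Real.self_le_rpow_of_one_le (by linarith) (by nlinarith))
        nlinarith
      rw [Real.rpow_add hY0, Real.rpow_one]
      have h4 : 0 ≤ (2 * ρ * N) ^ ((b + 1) * Cbar) := by positivity
      nlinarith

end

/-! ### Counting separated points, and from weak type to strong type. -/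

section

variable {n : ℕ}

/-- If `‖g‖^q` has mass at least `m` on every `ρ`-ball about the points of a `2ρ`-separated set
`X`, and is controlled on sparse unions of balls, then `X` is not large. -/
lemma card_le_of_sparse_bound {Cbar : ℝ} (hC : 1 ≤ Cbar) {η : ℝ} (hη : 0 < η) (hη1 : η < 1) :
    ∃ ε : ℝ, 0 < ε ∧ ∀ ρ A : ℝ, 1 ≤ ρ → 0 ≤ A → ∃ C : ℝ, 0 ≤ C ∧ ∀ (G : E n → ℝ≥0∞),
      (∀ R : ℝ, 1 ≤ R → ∀ (N : ℕ) (x : Fin N → E n), IsSparse Cbar R x →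
        ∫⁻ y in ⋃ j, ball (x j) R, G y ≤ ENNReal.ofReal (A * R ^ ε)) →
      ∀ m : ℝ, 0 < m → ∀ X : Finset (E n),
        (∀ x ∈ X, ∀ y ∈ X, x ≠ y → 2 * ρ ≤ dist x y) →
        (∀ x ∈ X, ENNReal.ofReal m ≤ ∫⁻ y in ball x ρ, G y) →
          (X.card : ℝ) ≤ (C / m) ^ (1 / (1 - η)) := by
  -- The total loss N^η is split in two halves: this K makes the pigeonholing loss N^(1/K) at most
  -- N^(η/2), and ε = η/(2b) below makes R^ε at most (2ρN)^(η/2).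
  obtain ⟨K, hKη⟩ := exists_nat_gt (2 / η)
  have hK : 1 ≤ K := by
    have h : (0 : ℝ) < K := (by positivity : 0 < 2 / η).trans hKη
    exact_mod_cast h
  have hK0 : (0 : ℝ) < K := by exact_mod_cast hK
  obtain ⟨b, hb, hrad⟩ := exists_radii_le hC K
  refine ⟨η / (2 * b), by positivity, fun ρ A hρ hA => ⟨K * A * (2 * ρ) ^ (η / 2), by positivity,
    fun G hG m hm X hsep hmass => ?_⟩⟩
  rcases X.eq_empty_or_nonempty with rfl | hX
  · rw [Finset.card_empty, Nat.cast_zero]; positivity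
  set N : ℝ := (X.card : ℝ) with hN
  have hN1 : 1 ≤ N := by rw [hN]; exact_mod_cast hX.card_pos
  have hN0 : 0 < N := by linarith
  obtain ⟨j, hj, X', hX', hX'sep, hcount⟩ :=
    exists_sparse_subset X hX K hK (radii Cbar ρ N) (radii_nonneg hρ hN1)
  -- With this R the next radius is exactly (R N)^Cbar, so X' is sparse at scale R, and the R-balls
  -- about X' contain the ρ-balls about every point counted within the j-th radius.
  set R := radii Cbar ρ N j + ρ with hR
  have hr0 := radii_nonneg (Cbar := Cbar) hρ hN1 j
  have hR1 : 1 ≤ R := by linarith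
  let x : Fin X'.card → E n := fun i => (X'.equivFin.symm i : E n)
  have hx : ∀ i, x i ∈ X' := fun i => (X'.equivFin.symm i).2
  have hxinj : ∀ i i', i ≠ i' → x i ≠ x i' := fun i i' h h' =>
    h (X'.equivFin.symm.injective (Subtype.ext h'))
  have hcardN : (X'.card : ℝ) ≤ N := by rw [hN]; exact_mod_cast Finset.card_le_card hX'
  have hbase : (R * X'.card) ^ Cbar ≤ (R * N) ^ Cbar := by
    refine Real.rpow_le_rpow (by positivity) ?_ (by linarith)
    exact mul_le_mul_of_nonneg_left hcardN (by linarith)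
  have hspx : ∀ u ∈ X', ∀ v ∈ X', u ≠ v → (R * N) ^ Cbar < dist u v := hX'sep
  have hsparse : IsSparse Cbar R x := fun i i' hii =>
    hbase.trans (hspx _ (hx i) _ (hx i') (hxinj i i' hii)).le
  -- Two distinct centres force N ≥ 2, so that (R N)^Cbar ≥ R N ≥ 2R. The clusters are therefore
  -- disjoint and the counts add up to the cardinality of Z.
  have hdisj : ∀ u ∈ X', ∀ v ∈ X', u ≠ v → 2 * R ≤ dist u v := by
    intro u hu v hv huv
    have h2 : (2 : ℝ) ≤ N := by
      refine le_trans ?_ hcardN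
      exact_mod_cast Finset.one_lt_card.2 ⟨u, hu, v, hv, huv⟩
    refine le_trans ?_ (hspx u hu v hv huv).le
    refine le_trans ?_ (Real.self_le_rpow_of_one_le (by nlinarith) hC)
    nlinarith
  classical
  let Z : Finset (E n) := X'.biUnion fun u => X.filter fun y => dist u y ≤ radii Cbar ρ N j
  have hZX : Z ⊆ X := Finset.biUnion_subset.2 fun u _ => Finset.filter_subset _ _
  have hZcard : (Z.card : ℝ) = ∑ u ∈ X', (countWithin X (radii Cbar ρ N j) u : ℝ) := by
    rw [Finset.card_biUnion]
    · push_cast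
      refine Finset.sum_congr rfl fun u _ => ?_
      unfold countWithin
      congr!
    · intro u hu v hv huv
      refine Finset.disjoint_left.2 fun y hy hy' => ?_
      rw [Finset.mem_filter] at hy hy'
      have h1 := hdisj u hu v hv huv
      have h2 := dist_triangle_right u v y
      linarith [hy.2, hy'.2]
  have hsub : (⋃ y ∈ Z, ball y ρ) ⊆ ⋃ i, ball (x i) R := by
    intro w hw
    simp only [mem_iUnion] at hw ⊢
    obtain ⟨y, hy, hwy⟩ := hw
    obtain ⟨u, hu, hyu⟩ := Finset.mem_biUnion.1 hy
    rw [Finset.mem_filter] at hyu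
    refine ⟨X'.equivFin ⟨u, hu⟩, ?_⟩
    have : x (X'.equivFin ⟨u, hu⟩) = u := by simp [x]
    rw [this, mem_ball]
    rw [mem_ball] at hwy
    have := dist_triangle_right w u y
    linarith [hyu.2]
  have hdis2 : (Z : Set (E n)).PairwiseDisjoint fun y => ball y ρ := by
    intro u hu v hv huv
    refine ball_disjoint_ball ?_
    have := hsep u (hZX hu) v (hZX hv) huv
    linarith
  have hint : ENNReal.ofReal (Z.card * m) ≤ ENNReal.ofReal (A * R ^ (η / (2 * b))) := by
    calc ENNReal.ofReal (Z.card * m) = ∑ y ∈ Z, ENNReal.ofReal m := by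
          rw [Finset.sum_const, nsmul_eq_mul, ENNReal.ofReal_mul (Nat.cast_nonneg _),
            ENNReal.ofReal_natCast]
      _ ≤ ∑ y ∈ Z, ∫⁻ w in ball y ρ, G w := Finset.sum_le_sum fun y hy => hmass y (hZX hy)
      _ = ∫⁻ w in ⋃ y ∈ Z, ball y ρ, G w :=
          (lintegral_biUnion_finset hdis2 (fun _ _ => measurableSet_ball) _).symm
      _ ≤ _ := lintegral_mono_set hsub
      _ ≤ _ := hG R hR1 _ x hsparse
  rw [ENNReal.ofReal_le_ofReal_iff (by positivity)] at hint
  have hRb : R ^ (η / (2 * b)) ≤ (2 * ρ * N) ^ (η / 2) := by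
    refine (Real.rpow_le_rpow (by linarith) (hrad ρ N hρ hN1 j hj.le) (by positivity)).trans ?_
    rw [← Real.rpow_mul (by positivity)]
    refine le_of_eq ?_
    congr 1
    field_simp
  have hNK : N ^ (1 / K : ℝ) ≤ N ^ (η / 2) := by
    refine Real.rpow_le_rpow_of_exponent_le hN1 ?_
    rw [div_le_div_iff₀ hK0 two_pos]
    rw [div_lt_iff₀ hη] at hKη
    linarith
  rw [← hZcard] at hcount
  have hmain : N ^ (1 - η) ≤ K * A * (2 * ρ) ^ (η / 2) / m := by
    rw [le_div_iff₀ hm]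
    have h1 : N * m ≤ K * N ^ (η / 2) * (A * (2 * ρ * N) ^ (η / 2)) := by
      calc N * m ≤ K * N ^ (1 / K : ℝ) * Z.card * m := mul_le_mul_of_nonneg_right hcount hm.le
        _ = K * N ^ (1 / K : ℝ) * (Z.card * m) := by ring
        _ ≤ K * N ^ (η / 2) * (A * (2 * ρ * N) ^ (η / 2)) := by
            refine mul_le_mul (mul_le_mul_of_nonneg_left hNK hK0.le)
              (hint.trans (mul_le_mul_of_nonneg_left hRb hA)) (by positivity) (by positivity)
    rw [Real.mul_rpow (by positivity) hN0.le] at h1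
    have h2 : N ^ (η / 2) * N ^ (η / 2) = N ^ η := by
      rw [← Real.rpow_add hN0]; congr 1; ring
    have h3 : N ^ (1 - η) * N ^ η = N := by
      rw [← Real.rpow_add hN0]; simp
    have h4 : 0 < N ^ η := Real.rpow_pos_of_pos hN0 _
    refine le_of_mul_le_mul_right ?_ h4
    calc N ^ (1 - η) * m * N ^ η = (N ^ (1 - η) * N ^ η) * m := by ring
      _ = N * m := by rw [h3]
      _ ≤ _ := h1
      _ = K * A * (2 * ρ) ^ (η / 2) * (N ^ (η / 2) * N ^ (η / 2)) := by ring
      _ = _ := by rw [h2]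
  have h5 : N = (N ^ (1 - η)) ^ (1 / (1 - η)) := by
    rw [← Real.rpow_mul hN0.le, mul_one_div_cancel (by linarith), Real.rpow_one]
  rw [h5]
  exact Real.rpow_le_rpow (by positivity) hmain (one_div_nonneg.2 (by linarith))

/-- A uniform bound for the cardinality of `r`-separated subsets of `S` bounds the measure of
`S`. -/
lemma volume_le_of_card_le {S : Set (E n)} {r M : ℝ} (hr : 0 < r)
    (h : ∀ X : Finset (E n), (X : Set (E n)) ⊆ S →
      (∀ x ∈ X, ∀ y ∈ X, x ≠ y → r ≤ dist x y) → (X.card : ℝ) ≤ M) :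
    volume S ≤ ENNReal.ofReal M * volume (ball (0 : E n) r) := by
  classical
  let P : Finset (E n) → Prop := fun X =>
    (X : Set (E n)) ⊆ S ∧ ∀ x ∈ X, ∀ y ∈ X, x ≠ y → r ≤ dist x y
  -- Bounded cardinalities provide a separated subset of S with the most points, and by maximality
  -- its r-balls cover S.
  have hbdd : BddAbove (Finset.card '' {X | P X}) := by
    refine ⟨⌊M⌋₊, ?_⟩
    rintro _ ⟨X, hX, rfl⟩
    exact Nat.le_floor (h X hX.1 hX.2)
  obtain ⟨X, hX, hXm⟩ := Nat.sSup_mem (s := Finset.card '' {X | P X})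
    ⟨_, ∅, ⟨by simp, by simp⟩, rfl⟩ hbdd
  have hmax : ∀ Y, P Y → Y.card ≤ X.card := fun Y hY => hXm ▸ le_csSup hbdd ⟨Y, hY, rfl⟩
  have hcov : S ⊆ ⋃ x ∈ X, ball x r := by
    intro y hy
    by_contra hcon
    simp only [mem_iUnion, mem_ball, not_exists, not_lt] at hcon
    have hyX : y ∉ X := fun hyX => absurd (hcon y hyX) (by rw [dist_self]; linarith)
    have := hmax (insert y X) ⟨by
      rw [Finset.coe_insert]; exact insert_subset hy hX.1, by
      intro u hu v hv huv
      rw [Finset.mem_insert] at hu hv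
      rcases hu with rfl | hu <;> rcases hv with rfl | hv
      · exact absurd rfl huv
      · exact hcon v hv
      · rw [dist_comm]; exact hcon u hu
      · exact hX.2 u hu v hv huv⟩
    rw [Finset.card_insert_of_notMem hyX] at this
    omega
  calc volume S ≤ ∑ x ∈ X, volume (ball x r) :=
        (measure_mono hcov).trans (measure_biUnion_finset_le _ _)
    _ = X.card * volume (ball (0 : E n) r) := by
        simp only [Measure.addHaar_ball_center, Finset.sum_const, nsmul_eq_mul]
    _ ≤ _ := by
        gcongr
        rw [← ENNReal.ofReal_natCast]
        exact ENNReal.ofReal_le_ofReal (h X hX.1 hX.2)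

/-- A weak-type bound of exponent `σ < p` for a bounded function gives an `L^p` bound. -/
lemma exists_lintegral_le_of_weak_type {σ p D M : ℝ} (hσp : σ < p) (hp : 0 < p)
    (hM : 0 ≤ M) : ∃ C : ℝ≥0, ∀ g : E n → ℂ, Continuous g → (∀ x, ‖g x‖ ≤ D) →
      (∀ α : ℝ, 0 < α → α ≤ D → volume {x | α < ‖g x‖} ≤ ENNReal.ofReal (M * α ^ (-σ))) →
        ∫⁻ x, ‖g x‖ₑ ^ p ≤ C := by
  -- Since σ < p, the exponent p - 1 - σ exceeds -1 and the layer-cake integral converges at 0;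
  -- above D the level sets are empty.
  have hfin : ∫⁻ t in Ioc 0 D, ENNReal.ofReal (M * t ^ (p - 1 - σ)) ≠ ∞ := by
    rcases le_or_gt D 0 with hD | hD
    · simp [Ioc_eq_empty_of_le hD]
    have hI : IntervalIntegrable (fun t : ℝ => M * t ^ (p - 1 - σ)) volume 0 D :=
      (intervalIntegral.intervalIntegrable_rpow' (by linarith)).const_mul M
    rw [intervalIntegrable_iff_integrableOn_Ioc_of_le hD.le] at hI
    exact hI.lintegral_lt_top.ne
  refine ⟨(ENNReal.ofReal p * ∫⁻ t in Ioc 0 D, ENNReal.ofReal (M * t ^ (p - 1 - σ))).toNNReal,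
    fun g hg hgD hw => ?_⟩
  rw [ENNReal.coe_toNNReal (ENNReal.mul_ne_top ENNReal.ofReal_ne_top hfin)]
  have h1 : ∀ x, ‖g x‖ₑ ^ p = ENNReal.ofReal (‖g x‖ ^ p) := fun x => by
    rw [← ofReal_norm, ENNReal.ofReal_rpow_of_nonneg (norm_nonneg _) hp.le]
  simp only [h1]
  rw [lintegral_rpow_eq_lintegral_meas_lt_mul volume
    (Filter.Eventually.of_forall fun x => norm_nonneg _) hg.norm.aemeasurable hp]
  refine mul_le_mul' le_rfl ?_
  rw [← inter_union_sdiff (Ioi (0 : ℝ)) (Iic D)]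
  refine (lintegral_union_le _ _ _).trans ?_
  have h2 : ∫⁻ t in Ioi (0 : ℝ) \ Iic D, volume {x | t < ‖g x‖} * ENNReal.ofReal (t ^ (p - 1)) =
      0 := by
    rw [setLIntegral_congr_fun (g := fun _ => 0) (measurableSet_Ioi.diff measurableSet_Iic)]
    · simp
    · intro t ht
      have : {x | t < ‖g x‖} = ∅ := by
        ext x
        simp only [mem_ofPred_eq, mem_empty_iff_false, iff_false, not_lt]
        exact (hgD x).trans (not_le.1 ht.2).le
      simp [this]
  rw [h2, add_zero, Ioi_inter_Iic]
  refine setLIntegral_mono' measurableSet_Ioc fun t ht => ?_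
  refine (mul_le_mul_left (hw t ht.1 ht.2) _).trans (le_of_eq ?_)
  rw [← ENNReal.ofReal_mul (by have := ht.1; positivity)]
  congr 1
  rw [mul_assoc, ← Real.rpow_add ht.1]
  congr 2
  ring

end

/-! ### From sparse bounds to global bounds. -/

section

variable {d : ℕ} {φ a : E (d + 1) → E d → ℝ}

instance isFiniteMeasure_restrict_unitBall (k : ℕ) :
    IsFiniteMeasure ((volume : Measure (E k)).restrict (B k)) :=
  ⟨by rw [Measure.restrict_apply_univ]; exact measure_ball_lt_top⟩

lemma exists_eLpNorm_le_of_exponent_le {p q : ℝ≥0∞} (hp : 1 ≤ p) (hpq : p ≤ q) : ∃ C : ℝ≥0,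
    ∀ f : E d → ℂ, MemLp f q (volume.restrict (B d)) →
      eLpNorm f p (volume.restrict (B d)) ≤ C * eLpNorm f q (volume.restrict (B d)) := by
  have h0 : 0 ≤ 1 / p.toReal - 1 / q.toReal := by
    rcases eq_or_ne q ∞ with rfl | hq
    · simp
    have h1 : p.toReal ≤ q.toReal := ENNReal.toReal_mono hq hpq
    have h2 : 0 < p.toReal := ENNReal.toReal_pos (by positivity) (ne_top_of_le_ne_top hq hpq)
    exact sub_nonneg.2 (one_div_le_one_div_of_le h2 h1)
  refine ⟨((volume.restrict (B d)) univ ^ (1 / p.toReal - 1 / q.toReal)).toNNReal,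
    fun f hf => ?_⟩
  rw [ENNReal.coe_toNNReal (ENNReal.rpow_ne_top_of_nonneg h0 (measure_ne_top _ _)), mul_comm]
  exact eLpNorm_le_eLpNorm_mul_rpow_measure_univ hpq hf.1

lemma exists_integral_norm_le {p : ℝ≥0∞} (hp : 1 ≤ p) : ∃ C : ℝ≥0,
    ∀ f : E d → ℂ, MemLp f p (volume.restrict (B d)) → IntegrableOn f (B d) ∧
      ENNReal.ofReal (∫ ω in B d, ‖f ω‖) ≤ C * eLpNorm f p (volume.restrict (B d)) := by
  obtain ⟨C, hC⟩ := exists_eLpNorm_le_of_exponent_le (d := d) le_rfl hp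
  refine ⟨C, fun f hf => ?_⟩
  have hi : IntegrableOn f (B d) := hf.integrable hp
  refine ⟨hi, ?_⟩
  rw [ofReal_integral_norm_eq_lintegral_enorm hi, ← eLpNorm_one_eq_lintegral_enorm]
  exact hC f hf

/-- The trivial `L^∞` estimate. -/
lemma exists_eLpNorm_top_T_le
    (hφ : ContDiffOn ℝ (⊤ : ℕ∞) (Function.uncurry φ) (B (d + 1) ×ˢ B d))
    (ha : IsAmplitude φ a) : ∃ C : ℝ≥0, ∀ lam : ℝ, 1 ≤ lam → ∀ f : E d → ℂ,
      MemLp f ∞ (volume.restrict (B d)) → ∀ μ : Measure (E (d + 1)),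
        eLpNorm (T φ a lam f) ∞ μ ≤ C * eLpNorm f ∞ (volume.restrict (B d)) := by
  obtain ⟨C, hC0, hC⟩ := norm_T_le hφ ha
  obtain ⟨C', hC'⟩ := exists_integral_norm_le (d := d) (p := ∞) le_top
  refine ⟨Real.toNNReal C * C', fun lam hlam f hf μ => ?_⟩
  obtain ⟨hi, hI⟩ := hC' f hf
  rw [eLpNorm_exponent_top]
  refine (eLpNormEssSup_le_of_ae_bound (C := C * ∫ ω in B d, ‖f ω‖)
    (Filter.Eventually.of_forall (hC lam hlam f hi))).trans ?_
  rw [ENNReal.ofReal_mul hC0, ENNReal.coe_mul, mul_assoc]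
  exact mul_le_mul' le_rfl hI

lemma T_eq_zero_of_ae {f : E d → ℂ} (hf : f =ᵐ[volume.restrict (B d)] 0) (lam : ℝ) :
    T φ a lam f = 0 := by
  ext x
  rw [T_eq]
  refine integral_eq_zero_of_ae ?_
  filter_upwards [hf] with ω hω
  simp [hω]

/-- By homogeneity, `T` only has to be estimated on normalised functions. -/
lemma eLpNorm_T_le_of_normalized {p q : ℝ≥0∞} (hq : q ≠ 0) {lam : ℝ} {μ : Measure (E (d + 1))}
    {C : ℝ≥0∞} (h : ∀ f : E d → ℂ, MemLp f q (volume.restrict (B d)) →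
      eLpNorm f q (volume.restrict (B d)) = 1 → eLpNorm (T φ a lam f) p μ ≤ C)
    {f : E d → ℂ} (hf : MemLp f q (volume.restrict (B d))) :
    eLpNorm (T φ a lam f) p μ ≤ C * eLpNorm f q (volume.restrict (B d)) := by
  rcases eq_or_ne (eLpNorm f q (volume.restrict (B d))) 0 with h0 | h0
  · rw [T_eq_zero_of_ae ((eLpNorm_eq_zero_iff hf.1 hq).1 h0)]
    simp
  set s := eLpNorm f q (volume.restrict (B d)) with hs
  have hst : s ≠ ∞ := hf.2.ne
  have hs0 : 0 < s.toReal := ENNReal.toReal_pos h0 hst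
  have henorm : ‖((s.toReal : ℝ) : ℂ)‖ₑ = s := by
    rw [← ofReal_norm, Complex.norm_real, Real.norm_of_nonneg hs0.le, ENNReal.ofReal_toReal hst]
  have hne : ((s.toReal : ℝ) : ℂ) ≠ 0 := by exact_mod_cast hs0.ne'
  set f₀ : E d → ℂ := ((s.toReal : ℝ) : ℂ)⁻¹ • f with hf₀
  have hf₀m : MemLp f₀ q (volume.restrict (B d)) := hf.const_smul _
  have h1 : eLpNorm f₀ q (volume.restrict (B d)) = 1 := by
    rw [hf₀, eLpNorm_const_smul, enorm_inv hne, henorm, ← hs, ENNReal.inv_mul_cancel h0 hst]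
  have h2 : T φ a lam f = ((s.toReal : ℝ) : ℂ) • T φ a lam f₀ := by
    ext x
    rw [Pi.smul_apply, smul_eq_mul, ← T_const_mul]
    congr 1
    ext ω
    simp [hf₀, hne]
  rw [h2, eLpNorm_const_smul, henorm, mul_comm]
  exact mul_le_mul' (h f₀ hf₀m h1) le_rfl

/-- Reduction to sparse collections. -/
theorem globalBound_of_sparseBounds (hφ : IsPhase φ) {Cbar : ℝ} (hC : 1 ≤ Cbar) {pbar : ℝ≥0∞}
    (hpbar : 2 ≤ pbar) (hS : SparseBounds φ Cbar pbar) (ha : IsAmplitude φ a) {p : ℝ≥0∞}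
    (hp : pbar < p) : GlobalBound φ a p := by
  rcases eq_or_ne p ∞ with rfl | hpt
  · obtain ⟨C, hC⟩ := exists_eLpNorm_top_T_le hφ.smooth ha
    exact ⟨C, fun lam hlam f hf => hC lam hlam f hf _⟩
  have hpbart : pbar ≠ ∞ := hp.ne_top
  set q := pbar.toReal with hq
  set r := p.toReal with hr
  have hq2 : 2 ≤ q := by
    simpa using ENNReal.toReal_mono hpbart hpbar
  have hqr : q < r := (ENNReal.toReal_lt_toReal hpbart hpt).2 hp
  have hq0 : 0 < q := by linarith
  have hr0 : 0 < r := by linarith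
  have hpbar0 : pbar ≠ 0 := by positivity
  have hp0 : p ≠ 0 := (hpbar0.bot_lt.trans hp).ne'
  have hpbar1 : 1 ≤ pbar := le_trans (by norm_num) hpbar
  -- the exponents
  set t := r / q with ht
  have ht1 : 1 < t := by rw [ht, one_lt_div hq0]; exact hqr
  -- Then t(1 - η) = (t + 1)/2, midway between 1 and t. With n/k < (t - 1)/2 this leaves room for
  -- τ/(1 - η) < r.
  set η := (t - 1) / (2 * t) with hη
  have hη0 : 0 < η := by rw [hη]; apply div_pos <;> linarith
  have hη1 : η < 1 := by rw [hη, div_lt_one (by linarith)]; linarith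
  obtain ⟨k, hk⟩ := exists_nat_gt (2 * ((d + 1 : ℕ) : ℝ) / (t - 1))
  have hk0 : (0 : ℝ) < k := lt_of_le_of_lt (div_nonneg (by positivity) (by linarith)) hk
  have hk1 : 1 ≤ k := by exact_mod_cast hk0
  have hkn : ((d + 1 : ℕ) : ℝ) / k < (t - 1) / 2 := by
    rw [div_lt_iff₀ (by linarith)] at hk
    rw [div_lt_div_iff₀ hk0 two_pos]
    linarith
  set τ := (1 + ((d + 1 : ℕ) : ℝ) / k) * q with hτ
  have hστ : τ * (1 / (1 - η)) < r := by
    rw [mul_one_div, div_lt_iff₀ (by linarith)]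
    have h1 : r = t * q := by rw [ht]; field_simp
    have h2 : t * (1 - η) = (t + 1) / 2 := by rw [hη]; field_simp; ring
    rw [h1, hτ]
    nlinarith
  -- the constants
  obtain ⟨ε, hε, Hcard⟩ := card_le_of_sparse_bound (n := d + 1) hC hη0 hη1
  -- The loss is ε/q because the estimate is raised to the power q.
  obtain ⟨CS, hCS⟩ := hS (ε / q) (by positivity) a ha
  obtain ⟨CN, hCN⟩ := Hcard k (CS ^ q) (by exact_mod_cast hk1) (by positivity)
  obtain ⟨F, hF⟩ := exists_integral_norm_le (d := d) hpbar1
  obtain ⟨D₁, hD₁0, hD₁⟩ := norm_fwdDiff_iter_T_le hφ.smooth ha k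
  obtain ⟨D₂, hD₂0, hD₂⟩ := norm_T_le hφ.smooth ha
  -- One constant bounds both the values and the k-th differences of T f; the summand 1 only ensures
  -- positivity.
  set D := D₁ * F + D₂ * F + 1 with hD
  have hD0 : 0 < D := by positivity
  obtain ⟨c, hc, hball⟩ := exists_lintegral_ball_ge (n := d + 1) k hk1 q (by linarith) D hD0
  set V := (volume (ball (0 : E (d + 1)) (2 * k))).toReal with hV
  obtain ⟨CW, hCW⟩ := exists_lintegral_le_of_weak_type (n := d + 1)
    (M := (CN / c) ^ (1 / (1 - η)) * V) (D := D) hστ hr0 (by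
      have := hCN.1
      positivity)
  obtain ⟨hCN0, hCN⟩ := hCN
  obtain ⟨C', hC'⟩ := exists_eLpNorm_le_of_exponent_le (d := d) hpbar1 hp.le
  refine ⟨CW ^ (1 / r) * C', fun lam hlam f hf => ?_⟩
  -- The normalisation is in L^pbar, where the sparse hypothesis lives; the L^p norm of f returns at
  -- the end by Hölder on the unit ball.
  have hfb : MemLp f pbar (volume.restrict (B d)) := hf.mono_exponent hp.le
  rw [ENNReal.coe_mul, mul_assoc]
  refine (eLpNorm_T_le_of_normalized (p := p) (μ := volume) (C := ((CW ^ (1 / r) : ℝ≥0) : ℝ≥0∞))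
    hpbar0 (fun f hf hf1 => ?_) hfb).trans (mul_le_mul' le_rfl (hC' f hf))
  obtain ⟨hfi, hfI⟩ := hF f hf
  have hfF : ∫ ω in B d, ‖f ω‖ ≤ F := by
    rw [hf1, mul_one] at hfI
    exact ENNReal.ofReal_le_ofReal_iff (NNReal.coe_nonneg F) |>.1 (by simpa using hfI)
  have hgc := continuous_T hφ.smooth ha hlam hfi
  rw [eLpNorm_eq_lintegral_rpow_enorm_toReal hp0 hpt, ← hr,
    ENNReal.coe_rpow_of_nonneg _ (by positivity)]
  refine ENNReal.rpow_le_rpow ?_ (by positivity)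
  refine hCW _ hgc (fun x => ?_) fun α hα hαD => ?_
  · have h1 := hD₂ lam hlam f hfi x
    have h2 := mul_le_mul_of_nonneg_left hfF hD₂0
    have h3 : 0 ≤ D₁ * F := by positivity
    linarith
  have hdiff : ∀ y v, ‖(fwdDiff v)^[k] (T φ a lam f) y‖ ≤ D * ‖v‖ ^ k := by
    intro y v
    have h1 := hD₁ lam hlam f hfi y v
    have h2 := mul_le_mul_of_nonneg_left hfF (by positivity : 0 ≤ D₁ * ‖v‖ ^ k)
    have h3 : 0 ≤ (D₂ * F + 1) * ‖v‖ ^ k := by positivity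
    have h4 : D * ‖v‖ ^ k = D₁ * ‖v‖ ^ k * F + (D₂ * F + 1) * ‖v‖ ^ k := by rw [hD]; ring
    linarith
  have hsp : ∀ R : ℝ, 1 ≤ R → ∀ (N : ℕ) (x : Fin N → E (d + 1)), IsSparse Cbar R x →
      ∫⁻ y in ⋃ j, ball (x j) R, ‖T φ a lam f y‖ₑ ^ q ≤
        ENNReal.ofReal ((CS : ℝ) ^ q * R ^ ε) := by
    intro R hR N x hx
    have h1 := hCS lam R hlam hR N x hx f hf
    rw [hf1, mul_one, eLpNorm_eq_lintegral_rpow_enorm_toReal hpbar0 hpbart, ← hq] at h1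
    have h2 := ENNReal.rpow_le_rpow h1 hq0.le
    rw [← ENNReal.rpow_mul, one_div_mul_cancel hq0.ne', ENNReal.rpow_one] at h2
    refine h2.trans (le_of_eq ?_)
    rw [← ENNReal.ofReal_coe_nnreal, ← ENNReal.ofReal_mul (NNReal.coe_nonneg _),
      ENNReal.ofReal_rpow_of_nonneg (by positivity) hq0.le,
      Real.mul_rpow (NNReal.coe_nonneg _) (by positivity), ← Real.rpow_mul (by linarith)]
    congr 3
    field_simp
  -- Large values carry mass on balls of radius k, so points are taken 2k-separated to make these
  -- balls disjoint.
  have hvol := volume_le_of_card_le (S := {x | α < ‖T φ a lam f x‖}) (r := 2 * (k : ℝ))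
    (M := (CN / (c * α ^ τ)) ^ (1 / (1 - η))) (by positivity) (fun X hX hsep =>
      hCN _ hsp (c * α ^ τ) (by positivity) X hsep fun x hx =>
        hball _ hgc hdiff α hα hαD x (hX hx))
  refine hvol.trans (le_of_eq ?_)
  rw [← ENNReal.ofReal_toReal (measure_ball_lt_top (μ := volume) (x := (0 : E (d + 1)))
    (r := 2 * (k : ℝ))).ne, ← hV, ← ENNReal.ofReal_mul (by positivity)]
  congr 1
  rw [← div_div, Real.div_rpow (by positivity) (by positivity), ← Real.rpow_mul hα.le,
    Real.rpow_neg hα.le]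
  ring

end

/-! ### What H1 and H2 say about directional derivatives of the phase. -/

section

lemma fderiv_fderiv_apply_comm {V : Type*} [NormedAddCommGroup V] [NormedSpace ℝ V] {g : V → ℝ}
    {O : Set V} (hO : IsOpen O) (hg : ContDiffOn ℝ (⊤ : ℕ∞) g O) {p : V} (hp : p ∈ O) (u v : V) :
    fderiv ℝ (fun q => fderiv ℝ g q u) p v = fderiv ℝ (fun q => fderiv ℝ g q v) p u := by
  have hgp : ContDiffAt ℝ (⊤ : ℕ∞) g p := hg.contDiffAt (hO.mem_nhds hp)
  have hd : DifferentiableAt ℝ (fderiv ℝ g) p :=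
    (hgp.fderiv_right (m := (⊤ : ℕ∞)) (by simp)).differentiableAt (by simp)
  have h : ∀ u v : V, fderiv ℝ (fun q => fderiv ℝ g q u) p v = fderiv ℝ (fderiv ℝ g) p v u := by
    intro u v
    rw [fderiv_clm_apply hd (differentiableAt_const u)]
    simp
  rw [h, h]
  exact (hgp.isSymmSndFDerivAt (by
    rw [minSmoothness_of_isRCLikeNormedField]
    exact WithTop.coe_le_coe.2 (le_top : (2 : ℕ∞) ≤ ⊤))).eq v u

variable {X Y : Type*} [NormedAddCommGroup X] [NormedSpace ℝ X] [NormedAddCommGroup Y]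
  [NormedSpace ℝ Y] {F : Type*} [NormedAddCommGroup F] [NormedSpace ℝ F]

lemma hasFDerivAt_slice_left {g : X × Y → F} {x : X} {y : Y} (hg : DifferentiableAt ℝ g (x, y)) :
    HasFDerivAt (fun x' => g (x', y))
      ((fderiv ℝ g (x, y)).comp (ContinuousLinearMap.inl ℝ X Y)) x :=
  hg.hasFDerivAt.comp x (hasFDerivAt_prodMk_left x y)

lemma hasFDerivAt_slice_right {g : X × Y → F} {x : X} {y : Y} (hg : DifferentiableAt ℝ g (x, y)) :
    HasFDerivAt (fun y' => g (x, y'))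
      ((fderiv ℝ g (x, y)).comp (ContinuousLinearMap.inr ℝ X Y)) y :=
  hg.hasFDerivAt.comp y (hasFDerivAt_prodMk_right x y)

end

section

variable {d : ℕ} {φ a : E (d + 1) → E d → ℝ}

/-- The `j`-th coordinate direction in `ω`-space. -/
noncomputable def omegaDir {d : ℕ} (j : Fin d) : E (d + 1) × E d := (0, EuclideanSpace.single j 1)

/-- `∂_{ω_j} φ` as a function on the product. -/
noncomputable def dOmega {d : ℕ} (φ : E (d + 1) → E d → ℝ) (j : Fin d) (p : E (d + 1) × E d) : ℝ :=
  fderiv ℝ (Function.uncurry φ) p (omegaDir j)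

/-- `∂_{ω_i} ∂_{ω_j} φ` as a function on the product. -/
noncomputable def dOmega₂ {d : ℕ} (φ : E (d + 1) → E d → ℝ) (i j : Fin d)
    (p : E (d + 1) × E d) : ℝ :=
  fderiv ℝ (dOmega φ j) p (omegaDir i)

lemma contDiffOn_dOmega (hφ : ContDiffOn ℝ (⊤ : ℕ∞) (Function.uncurry φ) (B (d + 1) ×ˢ B d))
    (j : Fin d) : ContDiffOn ℝ (⊤ : ℕ∞) (dOmega φ j) (B (d + 1) ×ˢ B d) :=
  contDiffOn_fderiv_apply (isOpen_domain d) hφ _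

lemma contDiffOn_dOmega₂ (hφ : ContDiffOn ℝ (⊤ : ℕ∞) (Function.uncurry φ) (B (d + 1) ×ˢ B d))
    (i j : Fin d) : ContDiffOn ℝ (⊤ : ℕ∞) (dOmega₂ φ i j) (B (d + 1) ×ˢ B d) :=
  contDiffOn_fderiv_apply (isOpen_domain d) (contDiffOn_dOmega hφ j) _

lemma differentiableAt_of_domain {g : E (d + 1) × E d → ℝ}
    (hg : ContDiffOn ℝ (⊤ : ℕ∞) g (B (d + 1) ×ˢ B d)) {p : E (d + 1) × E d}
    (hp : p ∈ B (d + 1) ×ˢ B d) : DifferentiableAt ℝ g p :=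
  (hg.contDiffAt ((isOpen_domain d).mem_nhds hp)).differentiableAt (by simp)

lemma fderiv_slice_right {g : E (d + 1) × E d → ℝ}
    (hg : ContDiffOn ℝ (⊤ : ℕ∞) g (B (d + 1) ×ˢ B d)) {x : E (d + 1)} {ω : E d}
    (hp : (x, ω) ∈ B (d + 1) ×ˢ B d) (v : E d) :
    fderiv ℝ (fun ω' => g (x, ω')) ω v = fderiv ℝ g (x, ω) (0, v) := by
  rw [(hasFDerivAt_slice_right (differentiableAt_of_domain hg hp)).fderiv]
  rfl

/-- Paired with a fixed direction, the gradient becomes a partial derivative of φ on the product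
space, where symmetry of second derivatives is available. -/
lemma inner_gradX (hφ : ContDiffOn ℝ (⊤ : ℕ∞) (Function.uncurry φ) (B (d + 1) ×ˢ B d))
    {x : E (d + 1)} {ω : E d} (hp : (x, ω) ∈ B (d + 1) ×ˢ B d) (θ : E (d + 1)) :
    ⟪gradX φ x ω, θ⟫ = fderiv ℝ (Function.uncurry φ) (x, ω) (θ, 0) := by
  have h := (hasFDerivAt_slice_left (differentiableAt_of_domain hφ hp)).fderiv
  change fderiv ℝ (fun y => φ y ω) x = _ at h
  rw [gradX, gradient, InnerProductSpace.toDual_symm_apply, h]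
  rfl

lemma differentiableAt_gradX
    (hφ : ContDiffOn ℝ (⊤ : ℕ∞) (Function.uncurry φ) (B (d + 1) ×ˢ B d))
    {x : E (d + 1)} {ω : E d} (hp : (x, ω) ∈ B (d + 1) ×ˢ B d) :
    DifferentiableAt ℝ (fun ω' => gradX φ x ω') ω := by
  rw [differentiableAt_euclidean]
  intro i
  have hev : (fun ω' => (gradX φ x ω').ofLp i) =ᶠ[nhds ω] fun ω' =>
      fderiv ℝ (Function.uncurry φ) (x, ω') (EuclideanSpace.single i 1, 0) := by
    filter_upwards [(isOpen_ball (x := (0 : E d)) (ε := 1)).mem_nhds hp.2] with ω' hω'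
    rw [← inner_gradX hφ (mk_mem_prod hp.1 hω'), EuclideanSpace.inner_single_right]
    simp
  refine (DifferentiableAt.congr_of_eventuallyEq ?_ hev)
  exact (hasFDerivAt_slice_right (differentiableAt_of_domain
    (contDiffOn_fderiv_apply (isOpen_domain d) hφ _) hp)).differentiableAt

lemma inner_dOmegaGradX (hφ : ContDiffOn ℝ (⊤ : ℕ∞) (Function.uncurry φ) (B (d + 1) ×ˢ B d))
    {x : E (d + 1)} {ω : E d} (hp : (x, ω) ∈ B (d + 1) ×ˢ B d) (j : Fin d) (θ : E (d + 1)) :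
    ⟪dOmegaGradX φ x ω j, θ⟫ = fderiv ℝ (dOmega φ j) (x, ω) (θ, 0) := by
  have h1 : fderiv ℝ (fun ω' => ⟪gradX φ x ω', θ⟫) ω (EuclideanSpace.single j 1) =
      ⟪dOmegaGradX φ x ω j, θ⟫ := by
    rw [fderiv_inner_apply (𝕜 := ℝ) (differentiableAt_gradX hφ hp) (differentiableAt_const θ)]
    simp [dOmegaGradX]
  have hev : (fun ω' => ⟪gradX φ x ω', θ⟫) =ᶠ[nhds ω] fun ω' =>
      fderiv ℝ (Function.uncurry φ) (x, ω') (θ, 0) := by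
    filter_upwards [(isOpen_ball (x := (0 : E d)) (ε := 1)).mem_nhds hp.2] with ω' hω'
    exact inner_gradX hφ (mk_mem_prod hp.1 hω') θ
  rw [← h1, hev.fderiv_eq, fderiv_slice_right (g := fun p =>
    fderiv ℝ (Function.uncurry φ) p (θ, 0)) (contDiffOn_fderiv_apply (isOpen_domain d) hφ _) hp,
    fderiv_fderiv_apply_comm (isOpen_domain d) hφ hp]
  rfl

/-- With G frozen, the x-derivative commutes past both ω-derivatives. The resulting expression is
linear in the direction, so G can be compared with an arbitrary θ. -/
lemma curvatureMatrix_apply (hφ : ContDiffOn ℝ (⊤ : ℕ∞) (Function.uncurry φ) (B (d + 1) ×ˢ B d))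
    {x : E (d + 1)} {ω : E d} (hp : (x, ω) ∈ B (d + 1) ×ˢ B d) (i j : Fin d) :
    curvatureMatrix φ x ω i j = fderiv ℝ (dOmega₂ φ i j) (x, ω) (gauss φ x ω, 0) := by
  set G := gauss φ x ω
  set g : E (d + 1) × E d → ℝ := fun p => fderiv ℝ (Function.uncurry φ) p (G, 0) with hg
  have hgs : ContDiffOn ℝ (⊤ : ℕ∞) g (B (d + 1) ×ˢ B d) :=
    contDiffOn_fderiv_apply (isOpen_domain d) hφ _
  have hnhd : B d ∈ nhds ω := (isOpen_ball (x := (0 : E d)) (ε := 1)).mem_nhds hp.2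
  set h : E d → ℝ := fun ω' => ⟪gradX φ x ω', G⟫ with hh
  have hev : ∀ ω' ∈ B d, h =ᶠ[nhds ω'] fun ω'' => g (x, ω'') := by
    intro ω' hω'
    filter_upwards [(isOpen_ball (x := (0 : E d)) (ε := 1)).mem_nhds hω'] with ω'' hω''
    exact inner_gradX hφ (mk_mem_prod hp.1 hω'') G
  have hcd : ContDiffAt ℝ (⊤ : ℕ∞) h ω := by
    refine ContDiffAt.congr_of_eventuallyEq ?_ (hev ω hp.2)
    exact (hgs.contDiffAt ((isOpen_domain d).mem_nhds hp)).comp ω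
      (contDiffAt_const.prodMk contDiffAt_id)
  have hd : DifferentiableAt ℝ (fderiv ℝ h) ω :=
    (hcd.fderiv_right (m := (⊤ : ℕ∞)) (by simp)).differentiableAt (by simp)
  have h1 : curvatureMatrix φ x ω i j =
      fderiv ℝ (fun ω' => fderiv ℝ h ω' (EuclideanSpace.single j 1)) ω
        (EuclideanSpace.single i 1) := by
    rw [fderiv_clm_apply hd (differentiableAt_const _)]
    simp [curvatureMatrix, hessian, hh, G]
  have hev2 : (fun ω' => fderiv ℝ h ω' (EuclideanSpace.single j 1)) =ᶠ[nhds ω]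
      fun ω' => fderiv ℝ g (x, ω') (omegaDir j) := by
    filter_upwards [hnhd] with ω' hω'
    rw [(hev ω' hω').fderiv_eq, fderiv_slice_right hgs (mk_mem_prod hp.1 hω')]
    rfl
  rw [h1, hev2.fderiv_eq, fderiv_slice_right (g := fun p => fderiv ℝ g p (omegaDir j))
    (contDiffOn_fderiv_apply (isOpen_domain d) hgs _) hp]
  have hev3 : (fun p => fderiv ℝ g p (omegaDir j)) =ᶠ[nhds (x, ω)]
      fun p => fderiv ℝ (dOmega φ j) p (G, 0) := by
    filter_upwards [(isOpen_domain d).mem_nhds hp] with q hq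
    exact fderiv_fderiv_apply_comm (isOpen_domain d) hφ hq _ _
  rw [hev3.fderiv_eq]
  exact fderiv_fderiv_apply_comm (isOpen_domain d) (contDiffOn_dOmega hφ j) hp _ _

/-- The pairing is the cofactor expansion of a determinant in which the row v j occurs twice. -/
lemma inner_wedge (v : Fin d → E (d + 1)) (j : Fin d) : ⟪v j, wedge v⟫ = 0 := by
  let A : Matrix (Fin (d + 1)) (Fin (d + 1)) ℝ :=
    Matrix.of (Fin.cons (fun i => v j i) fun k i => v k i)
  have h0 : A.det = 0 := by
    refine Matrix.det_zero_of_row_eq (i := 0) (j := j.succ) (Fin.succ_ne_zero j).symm ?_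
    ext i
    simp [A]
  rw [Matrix.det_succ_row_zero] at h0
  rw [PiLp.inner_apply, ← h0]
  refine Finset.sum_congr rfl fun i _ => ?_
  have : A.submatrix Fin.succ i.succAbove = Matrix.of fun j k => v j (i.succAbove k) := by
    ext k l
    simp [A]
  rw [this]
  simp [wedge, A]
  ring

/-- Under the rank and curvature conditions, for every direction `θ` some first or second
`ω`-derivative of `⟨∂_x φ, θ⟩` does not vanish. -/
lemma exists_deriv_ne_zero (hd : 1 ≤ d) (hφ : IsPhase φ) {x : E (d + 1)} {ω : E d}
    (hp : (x, ω) ∈ B (d + 1) ×ˢ B d) (hc : (curvatureMatrix φ x ω).det ≠ 0) {θ : E (d + 1)}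
    (hθ : θ ≠ 0) : (∃ j, fderiv ℝ (dOmega φ j) (x, ω) (θ, 0) ≠ 0) ∨
      ∃ i j, fderiv ℝ (dOmega₂ φ i j) (x, ω) (θ, 0) ≠ 0 := by
  by_contra! hcon
  obtain ⟨hcon1, hcon2⟩ := hcon
  have hne : Nonempty (Fin d) := ⟨⟨0, hd⟩⟩
  -- H2 is used only to know that the curvature matrix is not zero; this needs d ≥ 1, the empty
  -- determinant being 1.
  have hentry : ∃ i j, curvatureMatrix φ x ω i j ≠ 0 := by
    by_contra! h
    exact hc (by rw [show curvatureMatrix φ x ω = 0 from Matrix.ext h, Matrix.det_zero])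
  obtain ⟨i, j, hij⟩ := hentry
  rw [curvatureMatrix_apply hφ.smooth hp] at hij
  set G := gauss φ x ω with hG
  have hG0 : G ≠ 0 := by
    rintro h
    rw [h] at hij
    exact hij (by rw [Prod.mk_zero_zero, map_zero])
  have hker : ∀ w : E (d + 1), (∀ j, ⟪dOmegaGradX φ x ω j, w⟫ = 0) →
      w.ofLp ∈ LinearMap.ker (mixedHessian φ x ω).mulVecLin := by
    intro w hw
    rw [LinearMap.mem_ker, Matrix.mulVecLin_apply]
    ext j
    rw [Pi.zero_apply, ← hw j, PiLp.inner_apply]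
    simp [Matrix.mulVec, dotProduct, mixedHessian, mul_comm]
  have hθk := hker θ fun j => by rw [inner_dOmegaGradX hφ.smooth hp]; exact hcon1 j
  have hGk := hker G fun j => by
    rw [hG, gauss, inner_smul_right, gauss₀, inner_wedge, mul_zero]
  -- Rank d in dimension d + 1 leaves a one-dimensional kernel. It contains θ and G, so G is a
  -- multiple of θ, and the vanishing second derivatives along θ contradict `hij`.
  have hfin : Module.finrank ℝ (LinearMap.ker (mixedHessian φ x ω).mulVecLin) = 1 := by
    have h1 := LinearMap.finrank_range_add_finrank_ker (mixedHessian φ x ω).mulVecLin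
    have h2 : Module.finrank ℝ (LinearMap.range (mixedHessian φ x ω).mulVecLin) = d :=
      hφ.rank_eq x hp.1 ω hp.2
    rw [h2, Module.finrank_fin_fun] at h1
    omega
  have hθ0 : (⟨θ.ofLp, hθk⟩ : LinearMap.ker (mixedHessian φ x ω).mulVecLin) ≠ 0 := by
    intro h
    apply hθ
    have := congrArg Subtype.val h
    exact WithLp.ofLp_injective 2 this
  obtain ⟨t, ht⟩ := (finrank_eq_one_iff_of_nonzero' _ hθ0).1 hfin ⟨G.ofLp, hGk⟩
  have hGt : G = t • θ := WithLp.ofLp_injective 2 (congrArg Subtype.val ht).symm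
  apply hij
  have : ((G, 0) : E (d + 1) × E d) = t • (θ, 0) := by rw [hGt]; simp
  rw [this, map_smul, hcon2, smul_zero]

end

/-! ### One-dimensional oscillatory integrals. -/

section OneDimensional

/-- Integration by parts with the regularised multiplier `u / (u² + ρ)`, where `u` is the
derivative of the phase. -/
lemma norm_intervalIntegral_exp_le {h u w : ℝ → ℝ} {l r C Λ ρ : ℝ} (hlr : l ≤ r)
    (hlr1 : r - l ≤ 1) (hh : ∀ t ∈ Icc l r, HasDerivAt h (u t) t)
    (hu : ∀ t ∈ Icc l r, HasDerivAt u (w t) t) (hw : ContinuousOn w (Icc l r))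
    (hwC : ∀ t ∈ Icc l r, |w t| ≤ C) (hΛ : 0 < Λ) (hρ : 0 < ρ) (hρ1 : ρ ≤ 1) :
    ‖∫ t in l..r, Complex.exp (2 * Real.pi * Complex.I * ((Λ * h t : ℝ) : ℂ))‖ ≤
      (2 + C) / (ρ * Λ) + ∫ t in l..r, ρ / (u t ^ 2 + ρ) := by
  have hC : 0 ≤ C := (abs_nonneg _).trans (hwC l ⟨le_rfl, hlr⟩)
  have huIcc : uIcc l r = Icc l r := uIcc_of_le hlr
  have hcu : ContinuousOn u (Icc l r) := fun t ht => (hu t ht).continuousAt.continuousWithinAt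
  have hch : ContinuousOn h (Icc l r) := fun t ht => (hh t ht).continuousAt.continuousWithinAt
  have hden : ∀ t, 0 < u t ^ 2 + ρ := fun t => by positivity
  set e : ℝ → ℂ := fun t => Complex.exp (2 * Real.pi * Complex.I * ((Λ * h t : ℝ) : ℂ)) with he
  have hen : ∀ t, ‖e t‖ = 1 := fun t => norm_exp_phase _
  -- The splitting is 1 = u v + ρ/(u² + ρ). The part with u v is integrated by parts; the remainder
  -- measures how often u is small. No monotonicity of u is required.
  set v : ℝ → ℝ := fun t => u t / (u t ^ 2 + ρ) with hv
  set v' : ℝ → ℝ := fun t => (w t * (u t ^ 2 + ρ) - u t * (2 * u t * w t)) / (u t ^ 2 + ρ) ^ 2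
    with hv'
  set κ : ℂ := 2 * Real.pi * Complex.I * Λ with hκ
  have hκn : ‖κ‖ = 2 * Real.pi * Λ := by
    rw [hκ]
    simp [abs_of_pos Real.pi_pos, abs_of_pos hΛ]
  have hκ0 : κ ≠ 0 := by
    rw [← norm_pos_iff, hκn]; positivity
  have hce : ContinuousOn e (Icc l r) := by
    refine ContinuousOn.cexp (continuousOn_const.mul ?_)
    exact Complex.continuous_ofReal.comp_continuousOn (continuousOn_const.mul hch)
  have hcv : ContinuousOn v (Icc l r) :=
    hcu.div ((hcu.pow 2).add continuousOn_const) fun t _ => (hden t).ne'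
  have hcv' : ContinuousOn v' (Icc l r) := by
    refine ContinuousOn.div ?_ (((hcu.pow 2).add continuousOn_const).pow 2)
      fun t _ => (pow_pos (hden t) 2).ne'
    exact (hw.mul ((hcu.pow 2).add continuousOn_const)).sub
      (hcu.mul ((continuousOn_const.mul hcu).mul hw))
  have hev : ∀ t ∈ Icc l r, HasDerivAt (fun t => e t * (v t : ℂ))
      (κ * (e t * ((u t * v t : ℝ) : ℂ)) + e t * (v' t : ℂ)) t := by
    intro t ht
    have h1 : HasDerivAt e (e t * (2 * Real.pi * Complex.I * ((Λ * u t : ℝ) : ℂ))) t :=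
      ((((hh t ht).const_mul Λ).ofReal_comp).const_mul _).cexp
    have h2 : HasDerivAt v (v' t) t := by
      refine HasDerivAt.congr_deriv ((hu t ht).div (((hu t ht).pow 2).add_const ρ) (hden t).ne') ?_
      simp [hv']
    refine HasDerivAt.congr_deriv (h1.mul h2.ofReal_comp) ?_
    rw [hκ]
    push_cast
    ring
  have hI1 : IntervalIntegrable (fun t => e t * ((u t * v t : ℝ) : ℂ)) volume l r := by
    refine ContinuousOn.intervalIntegrable ?_
    rw [huIcc]
    exact hce.mul (Complex.continuous_ofReal.comp_continuousOn (hcu.mul hcv))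
  have hI2 : IntervalIntegrable (fun t => e t * (v' t : ℂ)) volume l r := by
    refine ContinuousOn.intervalIntegrable ?_
    rw [huIcc]
    exact hce.mul (Complex.continuous_ofReal.comp_continuousOn hcv')
  have hI3c : ContinuousOn (fun t => ρ / (u t ^ 2 + ρ)) (Icc l r) :=
    continuousOn_const.div ((hcu.pow 2).add continuousOn_const) fun t _ => (hden t).ne'
  have hI3 : IntervalIntegrable (fun t => ρ / (u t ^ 2 + ρ)) volume l r := by
    refine ContinuousOn.intervalIntegrable ?_
    rwa [huIcc]
  have hI4 : IntervalIntegrable (fun t => e t * ((ρ / (u t ^ 2 + ρ) : ℝ) : ℂ)) volume l r := by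
    refine ContinuousOn.intervalIntegrable ?_
    rw [huIcc]
    exact hce.mul (Complex.continuous_ofReal.comp_continuousOn hI3c)
  have hftc := intervalIntegral.integral_eq_sub_of_hasDerivAt (a := l) (b := r)
    (f := fun t => e t * (v t : ℂ)) (by rwa [huIcc]) ((hI1.const_mul κ).add hI2)
  rw [intervalIntegral.integral_add (hI1.const_mul κ) hI2,
    intervalIntegral.integral_const_mul] at hftc
  -- A crude bound using ρ ≤ 1; the true order is ρ^(-1/2).
  have hvb : ∀ t, |v t| ≤ 1 / ρ := by
    intro t
    rw [hv, abs_div, abs_of_pos (hden t), div_le_div_iff₀ (hden t) hρ]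
    have h1 : |u t| ^ 2 = u t ^ 2 := sq_abs _
    nlinarith [sq_nonneg (|u t| - 1), abs_nonneg (u t), mul_le_of_le_one_right (abs_nonneg (u t)) hρ1]
  have hv'b : ∀ t ∈ Icc l r, |v' t| ≤ C / ρ := by
    intro t ht
    rw [hv', abs_div, abs_of_pos (pow_pos (hden t) 2), div_le_div_iff₀ (pow_pos (hden t) 2) hρ]
    have h1 : w t * (u t ^ 2 + ρ) - u t * (2 * u t * w t) = w t * (ρ - u t ^ 2) := by ring
    rw [h1, abs_mul]
    have h2 : |ρ - u t ^ 2| ≤ u t ^ 2 + ρ := abs_le.2 ⟨by nlinarith [sq_nonneg (u t)], by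
      nlinarith [sq_nonneg (u t)]⟩
    calc |w t| * |ρ - u t ^ 2| * ρ ≤ C * (u t ^ 2 + ρ) * (u t ^ 2 + ρ) := by
          refine mul_le_mul (mul_le_mul (hwC t ht) h2 (abs_nonneg _) hC) ?_ hρ.le (by positivity)
          nlinarith [sq_nonneg (u t)]
      _ = C * (u t ^ 2 + ρ) ^ 2 := by ring
  have hbd : ∀ t, ‖e t * (v t : ℂ)‖ ≤ 1 / ρ := fun t => by
    rw [norm_mul, hen, one_mul, Complex.norm_real]; exact hvb t
  have hmain : ‖∫ t in l..r, e t * ((u t * v t : ℝ) : ℂ)‖ ≤ (2 + C) / (ρ * Λ) := by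
    have h1 : ‖∫ t in l..r, e t * (v' t : ℂ)‖ ≤ C / ρ := by
      have := intervalIntegral.norm_integral_le_of_norm_le_const (a := l) (b := r)
        (f := fun t => e t * (v' t : ℂ)) (C := C / ρ) (fun t ht => by
          rw [uIoc_of_le hlr] at ht
          rw [norm_mul, hen, one_mul, Complex.norm_real]
          exact hv'b t (Ioc_subset_Icc_self ht))
      refine this.trans (mul_le_of_le_one_right (by positivity) ?_)
      rw [abs_of_nonneg (by linarith)]; exact hlr1
    have h2 : κ * ∫ t in l..r, e t * ((u t * v t : ℝ) : ℂ) =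
        e r * v r - e l * v l - ∫ t in l..r, e t * (v' t : ℂ) := by
      rw [← hftc]; ring
    have h3 := congrArg norm h2
    rw [norm_mul, hκn] at h3
    have h4 := norm_sub_le (e r * v r - e l * v l) (∫ t in l..r, e t * (v' t : ℂ))
    have h5 := norm_sub_le (e r * (v r : ℂ)) (e l * v l)
    have h6 := hbd l
    have h7 := hbd r
    have h8 : 2 * Real.pi * Λ * ‖∫ t in l..r, e t * ((u t * v t : ℝ) : ℂ)‖ ≤ (2 + C) / ρ := by
      rw [h3]
      have : (2 + C) / ρ = 1 / ρ + 1 / ρ + C / ρ := by ring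
      linarith
    have h9 : Λ ≤ 2 * Real.pi * Λ := by nlinarith [Real.pi_gt_three]
    have h10 := mul_le_mul_of_nonneg_right h9
      (norm_nonneg (∫ t in l..r, e t * ((u t * v t : ℝ) : ℂ)))
    rw [← div_div, le_div_iff₀ hΛ]
    linarith
  have hsplit : ∫ t in l..r, e t = (∫ t in l..r, e t * ((u t * v t : ℝ) : ℂ)) +
      ∫ t in l..r, e t * ((ρ / (u t ^ 2 + ρ) : ℝ) : ℂ) := by
    rw [← intervalIntegral.integral_add hI1 hI4]
    congr 1
    ext t
    rw [← mul_add, ← Complex.ofReal_add]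
    have : u t * v t + ρ / (u t ^ 2 + ρ) = 1 := by
      rw [hv]
      have := (hden t).ne'
      field_simp
    rw [this, Complex.ofReal_one, mul_one]
  rw [hsplit]
  refine (norm_add_le _ _).trans (add_le_add hmain ?_)
  refine intervalIntegral.norm_integral_le_of_norm_le hlr
    (Filter.Eventually.of_forall fun t _ => ?_) hI3
  rw [norm_mul, hen, one_mul, Complex.norm_real, Real.norm_of_nonneg (by have := hden t; positivity)]

/-- A function with large derivative is rarely small. -/
lemma intervalIntegral_div_sq_add_le {u w : ℝ → ℝ} {l r c σ ρ : ℝ} (hlr : l ≤ r)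
    (hu : ∀ t ∈ Icc l r, HasDerivAt u (w t) t) (hw : ContinuousOn w (Icc l r)) (hc : 0 < c)
    (hσ : |σ| = 1) (hwc : ∀ t ∈ Icc l r, c ≤ σ * w t) (hρ : 0 < ρ) :
    ∫ t in l..r, ρ / (u t ^ 2 + ρ) ≤ Real.pi * √ρ / c := by
  have huIcc : uIcc l r = Icc l r := uIcc_of_le hlr
  have hcu : ContinuousOn u (Icc l r) := fun t ht => (hu t ht).continuousAt.continuousWithinAt
  have hden : ∀ t, 0 < u t ^ 2 + ρ := fun t => by positivity
  have hs : 0 < √ρ := Real.sqrt_pos.2 hρ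
  have hs2 : √ρ ^ 2 = ρ := Real.sq_sqrt hρ.le
  -- Since σ w / c ≥ 1, the integrand is at most the derivative of this arctangent, whose increment
  -- is at most π√ρ/c.
  have hder : ∀ t ∈ uIcc l r, HasDerivAt (fun t => √ρ / c * (σ * Real.arctan (u t / √ρ)))
      (σ * w t / c * (ρ / (u t ^ 2 + ρ))) t := by
    intro t ht
    rw [huIcc] at ht
    refine HasDerivAt.congr_deriv
      (((((hu t ht).div_const √ρ).arctan).const_mul σ).const_mul (√ρ / c)) ?_
    have h1 : 1 + (u t / √ρ) ^ 2 = (u t ^ 2 + ρ) / ρ := by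
      rw [div_pow, hs2]; field_simp; ring
    rw [h1]
    have := (hden t).ne'
    field_simp
  have hint : ContinuousOn (fun t => σ * w t / c * (ρ / (u t ^ 2 + ρ))) (Icc l r) :=
    ((continuousOn_const.mul hw).div_const c).mul
      (continuousOn_const.div ((hcu.pow 2).add continuousOn_const) fun t _ => (hden t).ne')
  have hint2 : ContinuousOn (fun t => ρ / (u t ^ 2 + ρ)) (Icc l r) :=
    continuousOn_const.div ((hcu.pow 2).add continuousOn_const) fun t _ => (hden t).ne'
  rw [← huIcc] at hint hint2
  have hftc := intervalIntegral.integral_eq_sub_of_hasDerivAt hder hint.intervalIntegrable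
  calc ∫ t in l..r, ρ / (u t ^ 2 + ρ) ≤ ∫ t in l..r, σ * w t / c * (ρ / (u t ^ 2 + ρ)) := by
        refine intervalIntegral.integral_mono_on hlr hint2.intervalIntegrable
          hint.intervalIntegrable fun t ht => ?_
        refine le_mul_of_one_le_left (by have := hden t; positivity) ?_
        rw [one_le_div hc]
        exact hwc t ht
    _ = √ρ / c * (σ * Real.arctan (u r / √ρ)) - √ρ / c * (σ * Real.arctan (u l / √ρ)) := hftc
    _ = √ρ / c * (σ * (Real.arctan (u r / √ρ) - Real.arctan (u l / √ρ))) := by ring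
    _ ≤ √ρ / c * Real.pi := by
        refine mul_le_mul_of_nonneg_left ((le_abs_self _).trans ?_) (by positivity)
        rw [abs_mul, hσ, one_mul, abs_le]
        have h1 := Real.arctan_lt_pi_div_two (u r / √ρ)
        have h2 := Real.arctan_lt_pi_div_two (u l / √ρ)
        have h3 := Real.neg_pi_div_two_lt_arctan (u r / √ρ)
        have h4 := Real.neg_pi_div_two_lt_arctan (u l / √ρ)
        constructor <;> linarith
    _ = Real.pi * √ρ / c := by ring

end OneDimensional

/-! ### Oscillatory integrals over cubes. -/

section Cubes

/-- The half-open cube with corner `z` and side `s`. -/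
def cube {d : ℕ} (s : ℝ) (z : Fin d → ℝ) : Set (E d) := {ω | ∀ i, ω i ∈ Ico (z i) (z i + s)}

/-- The closed cube with corner `z` and side `s`. -/
def closedCube {d : ℕ} (s : ℝ) (z : Fin d → ℝ) : Set (E d) := {ω | ∀ i, ω i ∈ Icc (z i) (z i + s)}

lemma cube_subset_closedCube {d : ℕ} (s : ℝ) (z : Fin d → ℝ) : cube s z ⊆ closedCube s z :=
  fun _ h i => Ico_subset_Icc_self (h i)

lemma cube_eq_preimage {d : ℕ} (s : ℝ) (z : Fin d → ℝ) :
    cube s z = (WithLp.ofLp : E d → Fin d → ℝ) ⁻¹' (univ.pi fun i => Ico (z i) (z i + s)) := by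
  ext ω
  simp [cube]

lemma measurableSet_cube {d : ℕ} (s : ℝ) (z : Fin d → ℝ) : MeasurableSet (cube s z) := by
  rw [cube_eq_preimage]
  exact (PiLp.volume_preserving_ofLp (Fin d)).measurable
    (MeasurableSet.univ_pi fun i => measurableSet_Ico)

lemma isCompact_closedCube {d : ℕ} (s : ℝ) (z : Fin d → ℝ) : IsCompact (closedCube s z) := by
  have h : closedCube s z = (EuclideanSpace.equiv (Fin d) ℝ).toHomeomorph ⁻¹'
      (univ.pi fun i => Icc (z i) (z i + s)) := by
    ext ω
    rw [mem_preimage, mem_univ_pi]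
    rfl
  rw [h, Homeomorph.isCompact_preimage]
  exact isCompact_univ_pi fun i => isCompact_Icc

lemma volume_cube {d : ℕ} {s : ℝ} (hs : 0 ≤ s) (z : Fin d → ℝ) :
    volume (cube s z) = ENNReal.ofReal (s ^ d) := by
  rw [cube_eq_preimage, (PiLp.volume_preserving_ofLp (Fin d)).measure_preimage
    (MeasurableSet.univ_pi fun i => measurableSet_Ico).nullMeasurableSet, Real.volume_pi_Ico]
  simp [ENNReal.ofReal_pow hs]

lemma volume_real_cube {d : ℕ} {s : ℝ} (hs : 0 ≤ s) (z : Fin d → ℝ) :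
    volume.real (cube s z) = s ^ d := by
  rw [measureReal_def, volume_cube hs, ENNReal.toReal_ofReal (by positivity)]

/-- Inequalities between integrals over a cube may be checked on the lines parallel to an axis. -/
lemma norm_setIntegral_cube_le {d : ℕ} {F : Type} [NormedAddCommGroup F] [NormedSpace ℝ F]
    {s : ℝ} (hs : 0 ≤ s) (z : Fin d → ℝ) (j : Fin d) {f : E d → F} {g : E d → ℝ}
    (hf : IntegrableOn f (cube s z)) (hg : IntegrableOn g (cube s z))
    (h : ∀ ω : E d, (∀ t ∈ Icc (z j) (z j + s),
        ω + t • EuclideanSpace.single j (1 : ℝ) ∈ closedCube s z) →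
      ‖∫ t in z j..z j + s, f (ω + t • EuclideanSpace.single j (1 : ℝ))‖ ≤
        ∫ t in z j..z j + s, g (ω + t • EuclideanSpace.single j (1 : ℝ))) :
    ‖∫ ω in cube s z, f ω‖ ≤ ∫ ω in cube s z, g ω := by
  obtain ⟨m, rfl⟩ : ∃ m, d = m + 1 := ⟨d - 1, by have := j.2; omega⟩
  let e := (MeasurableEquiv.piFinSuccAbove (fun _ : Fin (m + 1) => ℝ) j).symm.trans
    (MeasurableEquiv.toLp 2 (Fin (m + 1) → ℝ))
  have he : MeasurePreserving e :=
    (PiLp.volume_preserving_toLp (Fin (m + 1))).comp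
      (volume_preserving_piFinSuccAbove (fun _ : Fin (m + 1) => ℝ) j).symm
  have hval : ∀ t y, e (t, y) = WithLp.toLp 2 (j.insertNth t y : Fin (m + 1) → ℝ) :=
    fun t y => rfl
  let S : Set (Fin m → ℝ) := univ.pi fun i => Ico (z (j.succAbove i)) (z (j.succAbove i) + s)
  have hpre : e ⁻¹' cube s z = Ico (z j) (z j + s) ×ˢ S := by
    ext ⟨t, y⟩
    rw [mem_preimage, hval]
    simp only [cube, mem_ofPred_eq, mem_prod, S, mem_univ_pi]
    rw [Fin.forall_iff_succAbove j]
    simp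
  -- Lines are based at the point with j-th coordinate 0, so the parameter t is that coordinate and
  -- runs from z j to z j + s.
  have hline : ∀ t y, e (t, y) = e (0, y) + t • EuclideanSpace.single j (1 : ℝ) := by
    intro t y
    rw [hval, hval]
    ext i
    rcases Fin.eq_self_or_eq_succAbove j i with rfl | ⟨i, rfl⟩
    · simp
    · simp
  have htrans : ∀ {G : Type} [NormedAddCommGroup G] [NormedSpace ℝ G] (k : E (m + 1) → G),
      IntegrableOn k (cube s z) →
      Integrable (k ∘ e) ((volume.restrict (Ico (z j) (z j + s))).prod (volume.restrict S)) ∧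
      ∫ ω in cube s z, k ω = ∫ y in S, ∫ t in Ico (z j) (z j + s), k (e (t, y)) := by
    intro G _ _ k hk
    have hr : (volume.restrict (Ico (z j) (z j + s))).prod (volume.restrict S) =
        (volume : Measure (ℝ × (Fin m → ℝ))).restrict (e ⁻¹' cube s z) := by
      rw [hpre, Measure.volume_eq_prod, Measure.prod_restrict]
    have h1 : Integrable (k ∘ e)
        ((volume.restrict (Ico (z j) (z j + s))).prod (volume.restrict S)) := by
      rw [hr]
      exact (he.integrableOn_comp_preimage e.measurableEmbedding).2 hk
    refine ⟨h1, ?_⟩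
    rw [← he.setIntegral_preimage_emb e.measurableEmbedding, ← hr]
    exact integral_prod_symm _ h1
  obtain ⟨-, hf2⟩ := htrans f hf
  obtain ⟨hg1, hg2⟩ := htrans g hg
  rw [hf2, hg2]
  refine norm_integral_le_of_norm_le hg1.integral_prod_right ?_
  refine (ae_restrict_mem (MeasurableSet.univ_pi fun i => measurableSet_Ico)).mono fun y hy => ?_
  have := h (e (0, y)) fun t ht => by
    rw [← hline, hval]
    simp only [closedCube, mem_ofPred_eq]
    rw [Fin.forall_iff_succAbove j]
    refine ⟨by simpa using ht, fun i => ?_⟩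
    simpa using Ico_subset_Icc_self (hy i (mem_univ i))
  rw [intervalIntegral.integral_of_le (by linarith), intervalIntegral.integral_of_le (by linarith),
    ← integral_Ico_eq_integral_Ioc, ← integral_Ico_eq_integral_Ioc] at this
  simp only [← hline] at this
  exact this

/-- Decay of oscillatory integrals over cubes on which a first derivative of the phase, or a
second derivative of the phase, is bounded away from zero. -/
lemma norm_setIntegral_cube_exp_le {d : ℕ} {s : ℝ} (hs : 0 < s) (hs1 : s ≤ 1) (z : Fin d → ℝ)
    {h u w : E d → ℝ} {j : Fin d} {c C Λ : ℝ} (hc : 0 < c) (hC : 0 ≤ C) (hΛ : 1 ≤ Λ)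
    (hhc : ContinuousOn h (closedCube s z)) (huc : ContinuousOn u (closedCube s z))
    (hwc : ContinuousOn w (closedCube s z))
    (hh : ∀ (ω : E d) (t : ℝ), ω + t • EuclideanSpace.single j (1 : ℝ) ∈ closedCube s z →
      HasDerivAt (fun t => h (ω + t • EuclideanSpace.single j (1 : ℝ)))
        (u (ω + t • EuclideanSpace.single j (1 : ℝ))) t)
    (hu : ∀ (ω : E d) (t : ℝ), ω + t • EuclideanSpace.single j (1 : ℝ) ∈ closedCube s z →
      HasDerivAt (fun t => u (ω + t • EuclideanSpace.single j (1 : ℝ)))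
        (w (ω + t • EuclideanSpace.single j (1 : ℝ))) t)
    (hwC : ∀ ω ∈ closedCube s z, |w ω| ≤ C)
    (halt : (∀ ω ∈ closedCube s z, c ≤ |u ω|) ∨ ∃ (i : Fin d) (σ : ℝ) (w' : E d → ℝ), |σ| = 1 ∧
      ContinuousOn w' (closedCube s z) ∧
      (∀ (ω : E d) (t : ℝ), ω + t • EuclideanSpace.single i (1 : ℝ) ∈ closedCube s z →
        HasDerivAt (fun t => u (ω + t • EuclideanSpace.single i (1 : ℝ)))
          (w' (ω + t • EuclideanSpace.single i (1 : ℝ))) t) ∧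
      ∀ ω ∈ closedCube s z, c ≤ σ * w' ω) :
    ‖∫ ω in cube s z, Complex.exp (2 * Real.pi * Complex.I * ((Λ * h ω : ℝ) : ℂ))‖ ≤
      (2 + C + 1 / c ^ 2 + Real.pi / c) * Λ ^ (-(1 / 3) : ℝ) := by
  have hΛ0 : 0 < Λ := by linarith
  -- This ρ balances the boundary terms 1/(ρΛ) against √ρ: both equal Λ^(-1/3).
  set ρ := Λ ^ (-(2 / 3) : ℝ) with hρdef
  set δ := Λ ^ (-(1 / 3) : ℝ) with hδdef
  have hρ : 0 < ρ := Real.rpow_pos_of_pos hΛ0 _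
  have hδ : 0 < δ := Real.rpow_pos_of_pos hΛ0 _
  have hδρ : ρ = δ ^ 2 := by
    rw [hρdef, hδdef, ← Real.rpow_natCast, ← Real.rpow_mul hΛ0.le]; norm_num
  have hδ1 : δ ≤ 1 := Real.rpow_le_one_of_one_le_of_nonpos hΛ (by norm_num)
  have hρ1 : ρ ≤ 1 := Real.rpow_le_one_of_one_le_of_nonpos hΛ (by norm_num)
  have hsqrt : √ρ = δ := by rw [hδρ, Real.sqrt_sq hδ.le]
  have hρΛ : 1 / (ρ * Λ) = δ := by
    rw [hρdef, hδdef, ← Real.rpow_add_one hΛ0.ne', one_div, ← Real.rpow_neg hΛ0.le]; norm_num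
  have hd : 0 < d := by have := j.2; omega
  have hsd : s ^ d / s ≤ 1 := by
    rw [div_le_one hs]
    exact pow_le_of_le_one hs.le hs1 hd.ne'
  have hsd1 : s ^ d ≤ 1 := pow_le_one₀ hs.le hs1
  have hden : ∀ ω, 0 < u ω ^ 2 + ρ := fun ω => by positivity
  have hmfin : volume (cube s z) ≠ ∞ := by rw [volume_cube hs.le]; exact ENNReal.ofReal_ne_top
  have hci : ∀ c : ℝ, Integrable (fun _ => c) (volume.restrict (cube s z)) := fun c =>
    integrableOn_const hmfin
  have hint : ∀ {F : Type} [NormedAddCommGroup F] (k : E d → F),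
      ContinuousOn k (closedCube s z) → IntegrableOn k (cube s z) := fun k hk =>
    (hk.integrableOn_compact (isCompact_closedCube s z)).mono_set (cube_subset_closedCube s z)
  have hkc : ContinuousOn (fun ω => ρ / (u ω ^ 2 + ρ)) (closedCube s z) :=
    continuousOn_const.div ((huc.pow 2).add continuousOn_const) fun ω _ => (hden ω).ne'
  have hki := hint _ hkc
  have hei : IntegrableOn (fun ω => Complex.exp (2 * Real.pi * Complex.I * ((Λ * h ω : ℝ) : ℂ)))
      (cube s z) := hint _ (ContinuousOn.cexp (continuousOn_const.mul
        (Complex.continuous_ofReal.comp_continuousOn (continuousOn_const.mul hhc))))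
  have hlinec : ∀ (i : Fin d) (k : E d → ℝ) (ω : E d), ContinuousOn k (closedCube s z) →
      (∀ t ∈ Icc (z i) (z i + s), ω + t • EuclideanSpace.single i (1 : ℝ) ∈ closedCube s z) →
      ContinuousOn (fun t : ℝ => k (ω + t • EuclideanSpace.single i (1 : ℝ)))
        (Icc (z i) (z i + s)) := fun i k ω hk hω =>
    hk.comp (by fun_prop) hω
  -- Dividing the constant by s writes it as an integral over the line, as the comparison on lines
  -- requires.
  have hstep1 : ‖∫ ω in cube s z, Complex.exp (2 * Real.pi * Complex.I * ((Λ * h ω : ℝ) : ℂ))‖ ≤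
      ∫ ω in cube s z, ((2 + C) / (ρ * Λ) / s + ρ / (u ω ^ 2 + ρ)) := by
    refine norm_setIntegral_cube_le hs.le z j hei ((hci _).add hki) ?_
    intro ω hω
    have h1 := norm_intervalIntegral_exp_le (h := fun t => h (ω + t • EuclideanSpace.single j 1))
      (l := z j) (r := z j + s) (Λ := Λ) (ρ := ρ) (by linarith) (by linarith)
      (fun t ht => hh ω t (hω t ht)) (fun t ht => hu ω t (hω t ht)) (hlinec j w ω hwc hω)
      (fun t ht => hwC _ (hω t ht)) hΛ0 hρ hρ1
    refine h1.trans (le_of_eq ?_)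
    rw [intervalIntegral.integral_add intervalIntegrable_const]
    · rw [intervalIntegral.integral_const, smul_eq_mul, add_sub_cancel_left, mul_div_cancel₀ _ hs.ne']
    · refine ContinuousOn.intervalIntegrable ?_
      rw [uIcc_of_le (by linarith)]
      exact hlinec j _ ω hkc hω
  rw [integral_add (hci _) hki, setIntegral_const, volume_real_cube hs.le,
    smul_eq_mul] at hstep1
  have hfirst : s ^ d * ((2 + C) / (ρ * Λ) / s) ≤ (2 + C) * δ := by
    have : s ^ d * ((2 + C) / (ρ * Λ) / s) = (s ^ d / s) * ((2 + C) * (1 / (ρ * Λ))) := by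
      field_simp
    rw [this, hρΛ]
    exact mul_le_of_le_one_left (by positivity) hsd
  -- Either u = ∂_j h is never small, or it is rarely small along a direction i, which may differ
  -- from the direction j of the integration by parts.
  have hsecond : ∫ ω in cube s z, ρ / (u ω ^ 2 + ρ) ≤ (1 / c ^ 2 + Real.pi / c) * δ := by
    have hp1 : 0 ≤ 1 / c ^ 2 * δ := by positivity
    have hp2 : 0 ≤ Real.pi / c * δ := by positivity
    rcases halt with hA | ⟨i, σ, w', hσ, hw'c, hw', hw'l⟩
    · have h1 : ∫ ω in cube s z, ρ / (u ω ^ 2 + ρ) ≤ ∫ ω in cube s z, 1 / c ^ 2 * δ := by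
        refine setIntegral_mono_on hki (integrableOn_const hmfin) (measurableSet_cube s z) ?_
        intro ω hω
        have h2 : c ^ 2 ≤ u ω ^ 2 := by
          rw [← sq_abs (u ω)]
          exact pow_le_pow_left₀ hc.le (hA ω (cube_subset_closedCube s z hω)) 2
        calc ρ / (u ω ^ 2 + ρ) ≤ ρ / c ^ 2 :=
              div_le_div_of_nonneg_left hρ.le (by positivity) (by linarith)
          _ ≤ δ / c ^ 2 := by
              refine div_le_div_of_nonneg_right ?_ (by positivity)
              rw [hδρ]; nlinarith
          _ = 1 / c ^ 2 * δ := by ring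
      rw [setIntegral_const, volume_real_cube hs.le, smul_eq_mul] at h1
      have h2 := mul_le_of_le_one_left hp1 hsd1
      linarith
    · have h1 : ‖∫ ω in cube s z, ρ / (u ω ^ 2 + ρ)‖ ≤
          ∫ ω in cube s z, Real.pi * √ρ / c / s := by
        refine norm_setIntegral_cube_le hs.le z i hki (integrableOn_const hmfin) ?_
        intro ω hω
        have h2 := intervalIntegral_div_sq_add_le (ρ := ρ) (l := z i) (r := z i + s) (by linarith)
          (fun t ht => hw' ω t (hω t ht)) (hlinec i w' ω hw'c hω) hc hσ
          (fun t ht => hw'l _ (hω t ht)) hρ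
        rw [intervalIntegral.integral_const, smul_eq_mul, add_sub_cancel_left,
          mul_div_cancel₀ _ hs.ne', Real.norm_of_nonneg]
        · exact h2
        · refine intervalIntegral.integral_nonneg (by linarith) fun t _ => ?_
          have := hden (ω + t • EuclideanSpace.single i 1)
          positivity
      rw [setIntegral_const, volume_real_cube hs.le, smul_eq_mul, hsqrt] at h1
      have h3 : s ^ d * (Real.pi * δ / c / s) = (s ^ d / s) * (Real.pi / c * δ) := by
        field_simp
      rw [h3] at h1
      have h4 := mul_le_of_le_one_left hp2 hsd
      have h5 := Real.le_norm_self (∫ ω in cube s z, ρ / (u ω ^ 2 + ρ))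
      linarith
  linarith

end Cubes

/-! ### Uniform decay for differences of the phase. -/

section

variable {d : ℕ} {φ a : E (d + 1) → E d → ℝ}

lemma dist_le_of_mem_closedCube {s : ℝ} {z : Fin d → ℝ} {ω ω' : E d}
    (hω : ω ∈ closedCube s z) (hω' : ω' ∈ closedCube s z) : dist ω ω' ≤ d * s := by
  have h1 : ω - ω' = ∑ i, (ω i - ω' i) • (EuclideanSpace.single i (1 : ℝ) : E d) := by
    ext j
    simp [Finset.sum_apply, Pi.single_apply]
  rw [dist_eq_norm, h1]
  refine (norm_sum_le _ _).trans ?_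
  calc ∑ i, ‖(ω i - ω' i) • (EuclideanSpace.single i (1 : ℝ) : E d)‖ ≤ ∑ _i : Fin d, s := by
        refine Finset.sum_le_sum fun i _ => ?_
        rw [norm_smul, PiLp.norm_single, norm_one, mul_one, Real.norm_eq_abs, abs_le]
        have h2 := hω i
        have h3 := hω' i
        constructor <;> linarith [h2.1, h2.2, h3.1, h3.2]
    _ = d * s := by simp

lemma convex_closedCube (s : ℝ) (z : Fin d → ℝ) : Convex ℝ (closedCube s z) := by
  intro ω hω ω' hω' t t' ht ht' htt i
  exact convex_Icc (z i) (z i + s) (hω i) (hω' i) ht ht' htt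

lemma hasDerivAt_line {g : E (d + 1) × E d → ℝ}
    (hg : ContDiffOn ℝ (⊤ : ℕ∞) g (B (d + 1) ×ˢ B d)) {ξ : E (d + 1)} {ω : E d} {t : ℝ}
    {j : Fin d}
    (hp : (ξ, ω + t • EuclideanSpace.single j (1 : ℝ)) ∈ B (d + 1) ×ˢ B d) :
    HasDerivAt (fun t : ℝ => g (ξ, ω + t • EuclideanSpace.single j (1 : ℝ)))
      (fderiv ℝ g (ξ, ω + t • EuclideanSpace.single j (1 : ℝ)) (omegaDir j)) t := by
  have h1 : HasDerivAt (fun t : ℝ => ω + t • (EuclideanSpace.single j (1 : ℝ) : E d))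
      (EuclideanSpace.single j (1 : ℝ)) t := by
    simpa using ((hasDerivAt_id t).smul_const (EuclideanSpace.single j (1 : ℝ) : E d)).const_add ω
  exact (differentiableAt_of_domain hg hp).hasFDerivAt.comp_hasDerivAt t
    ((hasDerivAt_const t ξ).prodMk h1)

/-- An equality, not just a bound, so that difference quotients inherit lower bounds and signs from
the derivatives; the point ζ may depend on ω. -/
lemma exists_segment_slope {g : E (d + 1) × E d → ℝ}
    (hg : ContDiffOn ℝ (⊤ : ℕ∞) g (B (d + 1) ×ˢ B d)) {ξ ξ' : E (d + 1)} {ω : E d}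
    (hp : (ξ, ω) ∈ B (d + 1) ×ˢ B d) (hp' : (ξ', ω) ∈ B (d + 1) ×ˢ B d) :
    ∃ ζ ∈ segment ℝ ξ' ξ,
      g (ξ, ω) - g (ξ', ω) = fderiv ℝ g (ζ, ω) (ξ - ξ', 0) := by
  obtain ⟨ζ, hζ, h⟩ := domain_mvt (f := fun x => g (x, ω)) (s := B (d + 1)) (x := ξ') (y := ξ)
    (fun x hx => (hasFDerivAt_slice_left (differentiableAt_of_domain hg
      (mk_mem_prod hx hp.2))).hasFDerivWithinAt) (convex_ball _ _) hp'.1 hp.1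
  exact ⟨ζ, hζ, h⟩

/-- The mixed derivatives `∂_θ ∂_{ω_j} φ` and `∂_θ ∂_{ω_i} ∂_{ω_j} φ`. -/
noncomputable def mixedDeriv {d : ℕ} (φ : E (d + 1) → E d → ℝ) :
    Fin d ⊕ Fin d × Fin d → (E (d + 1) × E d) × E (d + 1) → ℝ
  | .inl j, q => fderiv ℝ (dOmega φ j) q.1 (q.2, 0)
  | .inr (i, j), q => fderiv ℝ (dOmega₂ φ i j) q.1 (q.2, 0)

lemma continuousOn_mixedDeriv
    (hφ : ContDiffOn ℝ (⊤ : ℕ∞) (Function.uncurry φ) (B (d + 1) ×ˢ B d))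
    (ι : Fin d ⊕ Fin d × Fin d) :
    ContinuousOn (mixedDeriv φ ι) ((B (d + 1) ×ˢ B d) ×ˢ univ) := by
  have key : ∀ g : E (d + 1) × E d → ℝ, ContDiffOn ℝ (⊤ : ℕ∞) g (B (d + 1) ×ˢ B d) →
      ContinuousOn (fun q : (E (d + 1) × E d) × E (d + 1) => fderiv ℝ g q.1 (q.2, 0))
        ((B (d + 1) ×ˢ B d) ×ˢ univ) := by
    intro g hg
    refine ContinuousOn.clm_apply ?_ (by fun_prop)
    exact (hg.continuousOn_fderiv_of_isOpen (isOpen_domain d) (by simp)).comp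
      continuousOn_fst fun q hq => hq.1
  rcases ι with j | ⟨i, j⟩
  · exact key _ (contDiffOn_dOmega hφ j)
  · exact key _ (contDiffOn_dOmega₂ hφ i j)

/-- Near the support of the amplitude, some mixed derivative is uniformly bounded away from zero,
with a constant sign on small balls. -/
lemma exists_mixedDeriv_ge (hd : 1 ≤ d) (hφ : IsPhase φ) (ha : IsAmplitude φ a) :
    ∃ c > 0, ∃ δ > 0, ∀ p ∈ tsupport (Function.uncurry a), ∀ θ ∈ sphere (0 : E (d + 1)) 1,
      ∃ (ι : Fin d ⊕ Fin d × Fin d) (σ : ℝ), |σ| = 1 ∧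
        ∀ q ∈ ball (p, θ) δ, c ≤ σ * mixedDeriv φ ι q := by
  set K : Set ((E (d + 1) × E d) × E (d + 1)) :=
    tsupport (Function.uncurry a) ×ˢ sphere (0 : E (d + 1)) 1 with hK
  have hKc : IsCompact K := IsCompact.prod ha.compact (isCompact_sphere _ _)
  have hKO : K ⊆ (B (d + 1) ×ˢ B d) ×ˢ univ := fun q hq => ⟨ha.support hq.1, mem_univ _⟩
  have hcont := fun ι => continuousOn_mixedDeriv hφ.smooth ι
  -- The sum of all |mixed derivatives| is continuous and positive on a compact set, hence bounded
  -- below, and some one of the m terms must exceed c₁/(2m).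
  obtain ⟨c₁, hc₁, hmin⟩ := hKc.exists_forall_le' (f := fun q => ∑ ι, |mixedDeriv φ ι q|) (a := 0)
    (continuousOn_finsetSum _ fun ι _ => ((hcont ι).mono hKO).abs) (by
      rintro ⟨⟨x, ω⟩, θ⟩ ⟨hp, hθ⟩
      have hθ0 : θ ≠ 0 := by
        rintro rfl
        simp at hθ
      have hnn : ∀ ι ∈ (Finset.univ : Finset (Fin d ⊕ Fin d × Fin d)),
          0 ≤ |mixedDeriv φ ι ((x, ω), θ)| := fun _ _ => abs_nonneg _
      rcases exists_deriv_ne_zero hd hφ (ha.support hp) (ha.curvature x ω hp) hθ0 with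
        ⟨j, hj⟩ | ⟨i, j, hij⟩
      · exact Finset.sum_pos' hnn ⟨.inl j, Finset.mem_univ _, abs_pos.2 hj⟩
      · exact Finset.sum_pos' hnn ⟨.inr (i, j), Finset.mem_univ _, abs_pos.2 hij⟩)
  set m : ℝ := (Fintype.card (Fin d ⊕ Fin d × Fin d) : ℝ) with hm
  have hm0 : 0 < m := by
    have : 0 < Fintype.card (Fin d ⊕ Fin d × Fin d) := Fintype.card_pos_iff.2 ⟨.inl ⟨0, hd⟩⟩
    rw [hm]; exact_mod_cast this
  set c := c₁ / (2 * m) with hc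
  have hc0 : 0 < c := by positivity
  let sg : Bool → ℝ := fun b => if b then 1 else -1
  have hsg : ∀ b, |sg b| = 1 := fun b => by cases b <;> simp [sg]
  let U : (Fin d ⊕ Fin d × Fin d) × Bool → Set ((E (d + 1) × E d) × E (d + 1)) := fun i =>
    ((B (d + 1) ×ˢ B d) ×ˢ univ) ∩ (fun q => sg i.2 * mixedDeriv φ i.1 q) ⁻¹' Ioi c
  -- A Lebesgue number for the cover by the sets where a given mixed derivative exceeds c with a
  -- given sign: index and sign can be kept fixed on δ-balls.
  obtain ⟨δ, hδ, H⟩ := lebesgue_number_lemma_of_metric (c := U) hKc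
    (fun i => (continuousOn_const.mul (hcont i.1)).isOpen_inter_preimage
      ((isOpen_domain d).prod isOpen_univ) isOpen_Ioi) (by
      intro q hq
      obtain ⟨ι, hι⟩ : ∃ ι, c < |mixedDeriv φ ι q| := by
        by_contra! h
        have h1 := hmin q hq
        have h2 : ∑ ι, |mixedDeriv φ ι q| ≤ m * c := by
          refine (Finset.sum_le_sum fun ι _ => h ι).trans (le_of_eq ?_)
          rw [Finset.sum_const, nsmul_eq_mul, Finset.card_univ]
        have h3 : m * c = c₁ / 2 := by rw [hc]; field_simp
        linarith
      rcases lt_abs.1 hι with h | h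
      · exact mem_iUnion.2 ⟨(ι, true), hKO hq, by simpa [sg] using h⟩
      · exact mem_iUnion.2 ⟨(ι, false), hKO hq, by simpa [sg] using h⟩)
  refine ⟨c, hc0, δ, hδ, fun p hp θ hθ => ?_⟩
  obtain ⟨⟨ι, b⟩, hi⟩ := H (p, θ) ⟨hp, hθ⟩
  exact ⟨ι, sg b, hsg b, fun q hq => (le_of_lt (hi hq).2)⟩

/-- Uniform decay of the oscillatory integrals attached to differences of the phase at nearby
points. -/
lemma exists_decay (hd : 1 ≤ d) (hφ : IsPhase φ) (ha : IsAmplitude φ a) :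
    ∃ η > 0, ∃ C ≥ 0, ∀ (s : ℝ) (z : Fin d → ℝ), 0 < s → s ≤ η →
      ∀ p ∈ tsupport (Function.uncurry a), p.2 ∈ closedCube s z →
        ∀ ξ ξ' : E (d + 1), dist ξ p.1 ≤ η → dist ξ' p.1 ≤ η → ξ ≠ ξ' → ∀ Λ : ℝ, 1 ≤ Λ →
          ‖∫ ω in cube s z, Complex.exp (2 * Real.pi * Complex.I *
            ((Λ * ((φ ξ ω - φ ξ' ω) / ‖ξ - ξ'‖) : ℝ) : ℂ))‖ ≤ C * Λ ^ (-(1 / 3) : ℝ) := by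
  obtain ⟨c, hc, δ, hδ, hD⟩ := exists_mixedDeriv_ge hd hφ ha
  obtain ⟨η₁, hη₁, hV⟩ := ha.compact.isCompact.exists_cthickening_subset_open (isOpen_domain d)
    ha.support
  set V := cthickening η₁ (tsupport (Function.uncurry a)) with hVdef
  have hVc : IsCompact V := ha.compact.isCompact.cthickening
  have hVK : V ×ˢ sphere (0 : E (d + 1)) 1 ⊆ (B (d + 1) ×ˢ B d) ×ˢ univ :=
    fun q hq => ⟨hV hq.1, mem_univ _⟩
  have hbdd : ∀ ι, ∃ C, ∀ q ∈ V ×ˢ sphere (0 : E (d + 1)) 1, ‖mixedDeriv φ ι q‖ ≤ C := fun ι =>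
    (hVc.prod (isCompact_sphere _ _)).exists_bound_of_continuousOn
      ((continuousOn_mixedDeriv hφ.smooth ι).mono hVK)
  choose Cι hCι using hbdd
  set C : ℝ := ∑ ι, |Cι ι| with hCdef
  have hC0 : 0 ≤ C := Finset.sum_nonneg fun _ _ => abs_nonneg _
  have hCb : ∀ ι, ∀ q ∈ V ×ˢ sphere (0 : E (d + 1)) 1, |mixedDeriv φ ι q| ≤ C := fun ι q hq =>
    ((hCι ι q hq).trans (le_abs_self _)).trans
      (Finset.single_le_sum (f := fun ι => |Cι ι|) (fun _ _ => abs_nonneg _) (Finset.mem_univ ι))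
  -- Division by d compensates for the diameter bound d s of a cube, so that all points used stay in
  -- V and within δ of p.
  set η := min (min η₁ (δ / 2)) 1 / d with hηdef
  have hd1 : (1 : ℝ) ≤ d := by exact_mod_cast hd
  have hd0 : (0 : ℝ) < d := by linarith
  have hη0 : 0 < η := by rw [hηdef]; positivity
  have hdη : d * η = min (min η₁ (δ / 2)) 1 := by rw [hηdef]; field_simp
  have hdη₁ : d * η ≤ η₁ := hdη.trans_le ((min_le_left _ _).trans (min_le_left _ _))
  have hdηδ : d * η < δ :=
    (hdη.trans_le ((min_le_left _ _).trans (min_le_right _ _))).trans_lt (by linarith)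
  have hη1 : η ≤ 1 := by
    have : d * η ≤ 1 := hdη.trans_le (min_le_right _ _)
    nlinarith
  refine ⟨η, hη0, 2 + C + 1 / c ^ 2 + Real.pi / c, by positivity, ?_⟩
  intro s z hs hsη p hp hpz ξ ξ' hξ hξ' hne Λ hΛ
  set r := ‖ξ - ξ'‖ with hr
  have hr0 : 0 < r := norm_pos_iff.2 (sub_ne_zero.2 hne)
  set θ : E (d + 1) := r⁻¹ • (ξ - ξ') with hθ
  have hθs : θ ∈ sphere (0 : E (d + 1)) 1 := by
    rw [mem_sphere_zero_iff_norm, hθ, norm_smul, norm_inv, Real.norm_of_nonneg hr0.le, ← hr,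
      inv_mul_cancel₀ hr0.ne']
  have hclose : ∀ ζ : E (d + 1), dist ζ p.1 ≤ η → ∀ ω ∈ closedCube s z,
      dist (ζ, ω) p ≤ d * η := by
    intro ζ hζ ω hω
    rw [Prod.dist_eq]
    refine max_le (hζ.trans (by nlinarith)) ((dist_le_of_mem_closedCube hω hpz).trans ?_)
    exact mul_le_mul_of_nonneg_left hsη hd0.le
  have hmemV : ∀ ζ : E (d + 1), dist ζ p.1 ≤ η → ∀ ω ∈ closedCube s z, (ζ, ω) ∈ V :=
    fun ζ hζ ω hω => mem_cthickening_of_dist_le _ p _ _ hp ((hclose ζ hζ ω hω).trans hdη₁)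
  have hmemO := fun ζ hζ ω hω => hV (hmemV ζ hζ ω hω)
  have hseg : ∀ ζ ∈ segment ℝ ξ' ξ, dist ζ p.1 ≤ η := fun ζ hζ =>
    (convex_closedBall p.1 η).segment_subset hξ' hξ hζ
  -- Each difference quotient is a θ-derivative at a point whose x-component is within η of p.1, so
  -- upper and lower bounds valid near p carry over.
  have hslope : ∀ g : E (d + 1) × E d → ℝ, ContDiffOn ℝ (⊤ : ℕ∞) g (B (d + 1) ×ˢ B d) →
      ∀ ω ∈ closedCube s z, ∃ ζ, dist ζ p.1 ≤ η ∧
        (g (ξ, ω) - g (ξ', ω)) / r = fderiv ℝ g (ζ, ω) (θ, 0) := by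
    intro g hg ω hω
    obtain ⟨ζ, hζ, h⟩ := exists_segment_slope hg (hmemO ξ hξ ω hω) (hmemO ξ' hξ' ω hω)
    refine ⟨ζ, hseg ζ hζ, ?_⟩
    have : ((θ, 0) : E (d + 1) × E d) = r⁻¹ • (ξ - ξ', 0) := by simp [hθ]
    rw [h, this, map_smul, smul_eq_mul, div_eq_inv_mul]
  have hcontdiff : ∀ g : E (d + 1) × E d → ℝ, ContDiffOn ℝ (⊤ : ℕ∞) g (B (d + 1) ×ˢ B d) →
      ContinuousOn (fun ω => (g (ξ, ω) - g (ξ', ω)) / r) (closedCube s z) := by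
    intro g hg
    refine ContinuousOn.div_const (ContinuousOn.sub ?_ ?_) r
    · exact hg.continuousOn.comp (by fun_prop) fun ω hω => hmemO ξ hξ ω hω
    · exact hg.continuousOn.comp (by fun_prop) fun ω hω => hmemO ξ' hξ' ω hω
  have hlines : ∀ (g : E (d + 1) × E d → ℝ) (i : Fin d),
      ContDiffOn ℝ (⊤ : ℕ∞) g (B (d + 1) ×ˢ B d) → ∀ (ω : E d) (t : ℝ),
      ω + t • EuclideanSpace.single i (1 : ℝ) ∈ closedCube s z →
      HasDerivAt (fun t : ℝ => (g (ξ, ω + t • EuclideanSpace.single i (1 : ℝ)) -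
        g (ξ', ω + t • EuclideanSpace.single i (1 : ℝ))) / r)
        ((fderiv ℝ g (ξ, ω + t • EuclideanSpace.single i (1 : ℝ)) (omegaDir i) -
        fderiv ℝ g (ξ', ω + t • EuclideanSpace.single i (1 : ℝ)) (omegaDir i)) / r) t :=
    fun g i hg ω t ht => ((hasDerivAt_line hg (hmemO ξ hξ _ ht)).sub
      (hasDerivAt_line hg (hmemO ξ' hξ' _ ht))).div_const r
  have hs1 : s ≤ 1 := hsη.trans hη1
  obtain ⟨ι, σ, hσ, hball⟩ := hD p hp θ hθs
  have hlow : ∀ ζ : E (d + 1), dist ζ p.1 ≤ η → ∀ ω ∈ closedCube s z,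
      c ≤ σ * mixedDeriv φ ι ((ζ, ω), θ) := by
    intro ζ hζ ω hω
    refine hball _ ?_
    rw [mem_ball, Prod.dist_eq, dist_self]
    exact max_lt ((hclose ζ hζ ω hω).trans_lt hdηδ) hδ
  have main : ∀ j : Fin d, ((∀ ω ∈ closedCube s z,
        c ≤ |(dOmega φ j (ξ, ω) - dOmega φ j (ξ', ω)) / r|) ∨
      ∃ i : Fin d, ∀ ω ∈ closedCube s z,
        c ≤ σ * ((dOmega₂ φ i j (ξ, ω) - dOmega₂ φ i j (ξ', ω)) / r)) →
      ‖∫ ω in cube s z, Complex.exp (2 * Real.pi * Complex.I *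
        ((Λ * ((φ ξ ω - φ ξ' ω) / r) : ℝ) : ℂ))‖ ≤
        (2 + C + 1 / c ^ 2 + Real.pi / c) * Λ ^ (-(1 / 3) : ℝ) := by
    intro j hj
    refine norm_setIntegral_cube_exp_le hs hs1 z (j := j) hc hC0 hΛ
      (hcontdiff _ hφ.smooth) (hcontdiff _ (contDiffOn_dOmega hφ.smooth j))
      (hcontdiff _ (contDiffOn_dOmega₂ hφ.smooth j j))
      (hlines _ j hφ.smooth) (hlines _ j (contDiffOn_dOmega hφ.smooth j)) ?_ ?_
    · intro ω hω
      obtain ⟨ζ, hζ, h⟩ := hslope _ (contDiffOn_dOmega₂ hφ.smooth j j) ω hω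
      rw [h]
      exact hCb (.inr (j, j)) ((ζ, ω), θ) ⟨hmemV ζ hζ ω hω, hθs⟩
    · rcases hj with h | ⟨i, h⟩
      · exact Or.inl h
      · exact Or.inr ⟨i, σ, _, hσ, hcontdiff _ (contDiffOn_dOmega₂ hφ.smooth i j),
          hlines _ i (contDiffOn_dOmega hφ.smooth j), h⟩
  rcases ι with j | ⟨i, j⟩
  · refine main j (Or.inl fun ω hω => ?_)
    obtain ⟨ζ, hζ, h⟩ := hslope _ (contDiffOn_dOmega hφ.smooth j) ω hω
    rw [h]
    refine (hlow ζ hζ ω hω).trans ((le_abs_self _).trans ?_)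
    rw [abs_mul, hσ, one_mul]
    exact le_rfl
  · refine main j (Or.inr ⟨i, fun ω hω => ?_⟩)
    obtain ⟨ζ, hζ, h⟩ := hslope _ (contDiffOn_dOmega₂ hφ.smooth i j) ω hω
    rw [h]
    exact hlow ζ hζ ω hω

end

/-! ### Almost orthogonality in L² and L^q. -/

section

/-- Bessel's inequality for almost orthogonal vectors. -/
lemma sum_norm_inner_sq_le {H ι : Type*} [NormedAddCommGroup H] [InnerProductSpace ℂ H]
    (s : Finset ι) (v : ι → H) {A : ℝ} (hA : 0 ≤ A)
    (h : ∀ j ∈ s, ∑ k ∈ s, ‖inner ℂ (v j) (v k)‖ ≤ A) (f : H) :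
    ∑ j ∈ s, ‖inner ℂ (v j) f‖ ^ 2 ≤ A * ‖f‖ ^ 2 := by
  set c : ι → ℂ := fun j => inner ℂ (v j) f with hc
  set S := ∑ j ∈ s, ‖c j‖ ^ 2 with hS
  have hS0 : 0 ≤ S := Finset.sum_nonneg fun _ _ => by positivity
  -- Duality: pairing w with f returns S, and a Schur test on the Gram matrix gives ‖w‖² ≤ A S.
  set w : H := ∑ j ∈ s, c j • v j with hw
  have h1 : inner ℂ w f = ((S : ℝ) : ℂ) := by
    rw [hw, sum_inner, hS, Complex.ofReal_sum]
    refine Finset.sum_congr rfl fun j _ => ?_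
    rw [inner_smul_left, show inner ℂ (v j) f = c j from rfl, Complex.conj_mul']
    push_cast
    rfl
  have h2 : S ≤ ‖w‖ * ‖f‖ := by
    have := norm_inner_le_norm (𝕜 := ℂ) w f
    rwa [h1, Complex.norm_real, Real.norm_of_nonneg hS0] at this
  have h3 : ‖w‖ ^ 2 ≤ A * S := by
    have hn : ‖w‖ ^ 2 = ‖inner ℂ w w‖ := by
      rw [inner_self_eq_norm_sq_to_K]
      simp
    rw [hn]
    have hexp : inner ℂ w w = ∑ j ∈ s, ∑ k ∈ s,
        (starRingEnd ℂ) (c j) * (c k * inner ℂ (v j) (v k)) := by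
      conv_lhs => rw [hw, sum_inner]
      refine Finset.sum_congr rfl fun j _ => ?_
      rw [inner_smul_left, inner_sum, Finset.mul_sum]
      refine Finset.sum_congr rfl fun k _ => ?_
      rw [inner_smul_right]
    rw [hexp]
    have hb : ∀ j k, ‖(starRingEnd ℂ) (c j) * (c k * inner ℂ (v j) (v k))‖ ≤
        (‖c j‖ ^ 2 * ‖inner ℂ (v j) (v k)‖ + ‖c k‖ ^ 2 * ‖inner ℂ (v k) (v j)‖) / 2 := by
      intro j k
      rw [norm_mul, norm_mul, RCLike.norm_conj, norm_inner_symm (v k) (v j)]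
      nlinarith [mul_nonneg (sq_nonneg (‖c j‖ - ‖c k‖)) (norm_nonneg (inner ℂ (v j) (v k)))]
    calc _ ≤ ∑ j ∈ s, ∑ k ∈ s,
          (‖c j‖ ^ 2 * ‖inner ℂ (v j) (v k)‖ + ‖c k‖ ^ 2 * ‖inner ℂ (v k) (v j)‖) / 2 :=
          (norm_sum_le _ _).trans (Finset.sum_le_sum fun j _ =>
            (norm_sum_le _ _).trans (Finset.sum_le_sum fun k _ => hb j k))
      _ = ∑ j ∈ s, ‖c j‖ ^ 2 * ∑ k ∈ s, ‖inner ℂ (v j) (v k)‖ := by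
          simp only [← Finset.sum_div, Finset.sum_add_distrib]
          rw [Finset.sum_comm (f := fun j k => ‖c k‖ ^ 2 * ‖inner ℂ (v k) (v j)‖)]
          simp only [Finset.mul_sum]
          ring
      _ ≤ ∑ j ∈ s, ‖c j‖ ^ 2 * A :=
          Finset.sum_le_sum fun j hj => mul_le_mul_of_nonneg_left (h j hj) (by positivity)
      _ = A * S := by rw [← Finset.sum_mul, mul_comm]
  rcases eq_or_lt_of_le hS0 with h0 | h0
  · rw [← h0]; positivity
  have h4 : S * S ≤ (A * ‖f‖ ^ 2) * S := by
    calc S * S ≤ (‖w‖ * ‖f‖) * (‖w‖ * ‖f‖) := mul_le_mul h2 h2 hS0 (by positivity)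
      _ = ‖w‖ ^ 2 * ‖f‖ ^ 2 := by ring
      _ ≤ A * S * ‖f‖ ^ 2 := mul_le_mul_of_nonneg_right h3 (by positivity)
      _ = _ := by ring
  exact le_of_mul_le_mul_right h4 h0

variable {X : Type*} [MeasurableSpace X] {ι : Type*}

/-- Bessel's inequality for the conjugates of the u j: the diagonal Gram entries are the total mass
and the others are at most δ. -/
lemma sum_norm_integral_mul_sq_le {μ : Measure X} [IsFiniteMeasure μ] (s : Finset ι)
    (u : ι → X → ℂ) (hum : ∀ j ∈ s, AEStronglyMeasurable (u j) μ)
    (hu1 : ∀ j ω, ‖u j ω‖ = 1) {δ : ℝ} (hδ : 0 ≤ δ)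
    (hδb : ∀ j ∈ s, ∀ k ∈ s, j ≠ k → ‖∫ ω, u j ω * (starRingEnd ℂ) (u k ω) ∂μ‖ ≤ δ)
    {f : X → ℂ} (hf : MemLp f 2 μ) :
    ∑ j ∈ s, ‖∫ ω, u j ω * f ω ∂μ‖ ^ 2 ≤
      (μ.real univ + s.card * δ) * ∫ ω, ‖f ω‖ ^ 2 ∂μ := by
  classical
  have hmem : ∀ j ∈ s, MemLp (fun ω => (starRingEnd ℂ) (u j ω)) 2 μ := fun j hj =>
    MemLp.of_bound (Complex.continuous_conj.comp_aestronglyMeasurable (hum j hj)) 1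
      (Filter.Eventually.of_forall fun ω => by rw [RCLike.norm_conj, hu1])
  let v : ι → Lp ℂ 2 μ := fun j => if h : j ∈ s then (hmem j h).toLp _ else 0
  have hv : ∀ j ∈ s, v j =ᵐ[μ] fun ω => (starRingEnd ℂ) (u j ω) := fun j hj => by
    simp only [v, hj, dif_pos]
    exact MemLp.coeFn_toLp _
  have hfe := hf.coeFn_toLp
  have hinner : ∀ j ∈ s, inner ℂ (v j) (hf.toLp f) = ∫ ω, u j ω * f ω ∂μ := by
    intro j hj
    rw [L2.inner_def]
    refine integral_congr_ae ?_
    filter_upwards [hv j hj, hfe] with ω h1 h2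
    rw [h1, h2, RCLike.inner_apply, Complex.conj_conj, mul_comm]
  have hgram : ∀ j ∈ s, ∀ k ∈ s, inner ℂ (v j) (v k) =
      ∫ ω, u j ω * (starRingEnd ℂ) (u k ω) ∂μ := by
    intro j hj k hk
    rw [L2.inner_def]
    refine integral_congr_ae ?_
    filter_upwards [hv j hj, hv k hk] with ω h1 h2
    rw [h1, h2, RCLike.inner_apply, Complex.conj_conj, mul_comm]
  have hnorm : ‖hf.toLp f‖ ^ 2 = ∫ ω, ‖f ω‖ ^ 2 ∂μ := by
    have h1 : inner ℂ (hf.toLp f) (hf.toLp f) = ((∫ ω, ‖f ω‖ ^ 2 ∂μ : ℝ) : ℂ) := by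
      rw [L2.inner_def, ← integral_complex_ofReal]
      refine integral_congr_ae ?_
      filter_upwards [hfe] with ω h2
      rw [h2, inner_self_eq_norm_sq_to_K]
      push_cast
      rfl
    rw [inner_self_eq_norm_sq_to_K] at h1
    refine Complex.ofReal_injective (Eq.trans ?_ h1)
    push_cast
    rfl
  have hb := sum_norm_inner_sq_le s v (A := μ.real univ + s.card * δ) (by positivity) (by
    intro j hj
    rw [← Finset.add_sum_erase s _ hj]
    refine add_le_add ?_ ?_
    · rw [hgram j hj j hj]
      have : ∀ ω, u j ω * (starRingEnd ℂ) (u j ω) = 1 := fun ω => by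
        rw [Complex.mul_conj', hu1]; simp
      simp [this, abs_of_nonneg]
    · calc _ ≤ ∑ k ∈ s.erase j, δ := by
            refine Finset.sum_le_sum fun k hk => ?_
            have hk' := Finset.mem_erase.1 hk
            rw [hgram j hj k hk'.2]
            exact hδb j hj k hk'.2 hk'.1.symm
        _ ≤ s.card * δ := by
            rw [Finset.sum_const, nsmul_eq_mul]
            gcongr
            exact Finset.erase_subset _ _) (hf.toLp f)
  rw [hnorm] at hb
  refine le_trans (le_of_eq ?_) hb
  refine Finset.sum_congr rfl fun j hj => ?_
  rw [hinner j hj]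

/-- Jensen's inequality for x ↦ x^r. -/
lemma rpow_average_le {μ : Measure X} [IsFiniteMeasure μ] (hμ : 0 < μ.real univ) {g : X → ℝ}
    (hg : ∀ ω, 0 ≤ g ω) {r : ℝ} (hr : 1 ≤ r) (hgi : Integrable g μ)
    (hgr : Integrable (fun ω => g ω ^ r) μ) :
    ((μ.real univ)⁻¹ * ∫ ω, g ω ∂μ) ^ r ≤ (μ.real univ)⁻¹ * ∫ ω, g ω ^ r ∂μ := by
  have : NeZero μ := ⟨by rintro rfl; simp at hμ⟩
  have h := (convexOn_rpow hr).map_average_le (μ := μ) (f := g)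
    (Real.continuous_rpow_const (by linarith)).continuousOn isClosed_Ici
    (Filter.Eventually.of_forall hg) hgi hgr
  rw [average_eq, average_eq] at h
  simpa [smul_eq_mul] using h

/-- The `L^q` consequence of almost orthogonality on a set of finite measure: no interpolation is
required because the averages are trivially bounded. -/
lemma sum_average_rpow_le {μ : Measure X} [IsFiniteMeasure μ] (hμ : 0 < μ.real univ)
    (s : Finset ι) (u : ι → X → ℂ) (hum : ∀ j ∈ s, AEStronglyMeasurable (u j) μ)
    (hu1 : ∀ j ω, ‖u j ω‖ = 1) {δ : ℝ} (hδ : 0 ≤ δ)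
    (hδb : ∀ j ∈ s, ∀ k ∈ s, j ≠ k → ‖∫ ω, u j ω * (starRingEnd ℂ) (u k ω) ∂μ‖ ≤ δ)
    {q : ℝ} (hq : 2 ≤ q) {f : X → ℂ} (hf : MemLp f (ENNReal.ofReal q) μ) :
    ∑ j ∈ s, μ.real univ * ‖((μ.real univ : ℝ) : ℂ)⁻¹ * ∫ ω, u j ω * f ω ∂μ‖ ^ q ≤
      (1 + s.card * δ / μ.real univ) * ∫ ω, ‖f ω‖ ^ q ∂μ := by
  have hq0 : 0 < q := by linarith
  set V := μ.real univ with hV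
  have hf2 : MemLp f 2 μ := hf.mono_exponent (by
    rw [show (2 : ℝ≥0∞) = ENNReal.ofReal 2 by simp]
    exact ENNReal.ofReal_le_ofReal hq)
  have hf1 : Integrable f μ := hf2.integrable (by norm_num)
  have hfq : Integrable (fun ω => ‖f ω‖ ^ q) μ := by
    have := hf.integrable_norm_rpow (by simpa using hq0) ENNReal.ofReal_ne_top
    rwa [ENNReal.toReal_ofReal hq0.le] at this
  set m₁ := ∫ ω, ‖f ω‖ ∂μ with hm₁
  set m₂ := ∫ ω, ‖f ω‖ ^ 2 ∂μ with hm₂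
  set mq := ∫ ω, ‖f ω‖ ^ q ∂μ with hmq
  have hm₁0 : 0 ≤ m₁ := integral_nonneg fun _ => norm_nonneg _
  have hm₂0 : 0 ≤ m₂ := integral_nonneg fun _ => by positivity
  have hmq0 : 0 ≤ mq := integral_nonneg fun _ => by positivity
  set Y := V⁻¹ * mq with hY
  have hY0 : 0 ≤ Y := by positivity
  have h1 : (V⁻¹ * m₁) ^ q ≤ Y :=
    rpow_average_le hμ (fun _ => norm_nonneg _) (by linarith) hf1.norm hfq
  have h2 : (V⁻¹ * m₂) ^ (q / 2) ≤ Y := by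
    have he : ∀ ω, (‖f ω‖ ^ 2) ^ (q / 2) = ‖f ω‖ ^ q := fun ω => by
      rw [← Real.rpow_natCast, ← Real.rpow_mul (norm_nonneg _)]
      congr 1
      push_cast
      ring
    have := rpow_average_le hμ (g := fun ω => ‖f ω‖ ^ 2) (fun _ => by positivity)
      (r := q / 2) (by linarith) (hf2.integrable_norm_pow (by norm_num)) (by simpa only [he] using hfq)
    simpa only [he] using this
  set b : ι → ℝ := fun j => V⁻¹ * ‖∫ ω, u j ω * f ω ∂μ‖ with hb
  have hb0 : ∀ j, 0 ≤ b j := fun j => by positivity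
  have hbn : ∀ j, ‖((V : ℝ) : ℂ)⁻¹ * ∫ ω, u j ω * f ω ∂μ‖ = b j := fun j => by
    rw [norm_mul, norm_inv, Complex.norm_real, Real.norm_of_nonneg hμ.le]
  have hb1 : ∀ j, b j ≤ V⁻¹ * m₁ := fun j => by
    refine mul_le_mul_of_nonneg_left ?_ (by positivity)
    refine norm_integral_le_of_norm_le hf1.norm (Filter.Eventually.of_forall fun ω => ?_)
    rw [norm_mul, hu1, one_mul]
  have hbess := sum_norm_integral_mul_sq_le s u hum hu1 hδ hδb hf2
  rw [← hV, ← hm₂] at hbess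
  have hsq : ∑ j ∈ s, b j ^ 2 ≤ V⁻¹ * (V + s.card * δ) * (V⁻¹ * m₂) := by
    have : ∑ j ∈ s, b j ^ 2 = V⁻¹ ^ 2 * ∑ j ∈ s, ‖∫ ω, u j ω * f ω ∂μ‖ ^ 2 := by
      rw [Finset.mul_sum]
      exact Finset.sum_congr rfl fun j _ => mul_pow _ _ _
    rw [this]
    calc _ ≤ V⁻¹ ^ 2 * ((V + s.card * δ) * m₂) := mul_le_mul_of_nonneg_left hbess (by positivity)
      _ = _ := by ring
  have hY1 : (V⁻¹ * m₁) ^ (q - 2) ≤ Y ^ ((q - 2) / q) := by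
    calc (V⁻¹ * m₁) ^ (q - 2) = ((V⁻¹ * m₁) ^ q) ^ ((q - 2) / q) := by
          rw [← Real.rpow_mul (by positivity)]; congr 1; field_simp
      _ ≤ _ := Real.rpow_le_rpow (by positivity) h1 (div_nonneg (by linarith) hq0.le)
  have hY2 : V⁻¹ * m₂ ≤ Y ^ (2 / q) := by
    calc V⁻¹ * m₂ = ((V⁻¹ * m₂) ^ (q / 2)) ^ (2 / q) := by
          rw [← Real.rpow_mul (by positivity), show q / 2 * (2 / q) = 1 by field_simp,
            Real.rpow_one]
      _ ≤ _ := Real.rpow_le_rpow (by positivity) h2 (by positivity)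
  have hYY : Y ^ ((q - 2) / q) * Y ^ (2 / q) = Y := by
    rw [← Real.rpow_add_of_nonneg hY0 (div_nonneg (by linarith) hq0.le) (by positivity),
      show (q - 2) / q + 2 / q = 1 by field_simp; ring, Real.rpow_one]
  -- All but two of the q powers are spent on the trivial bound for an average, leaving squares for
  -- Bessel. Jensen compares both moments of f with Y, the mean of |f|^q.
  have hterm : ∀ j, b j ^ q ≤ Y ^ ((q - 2) / q) * b j ^ 2 := by
    intro j
    have h3 : b j ^ q = b j ^ (q - 2) * b j ^ 2 := by
      rw [← Real.rpow_natCast (b j) 2, ← Real.rpow_add_of_nonneg (hb0 j) (by linarith) (by norm_num)]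
      congr 1
      push_cast
      ring
    rw [h3]
    refine mul_le_mul_of_nonneg_right (le_trans ?_ hY1) (by positivity)
    exact Real.rpow_le_rpow (hb0 j) (hb1 j) (by linarith)
  simp only [hbn]
  calc ∑ j ∈ s, V * b j ^ q ≤ ∑ j ∈ s, V * (Y ^ ((q - 2) / q) * b j ^ 2) :=
        Finset.sum_le_sum fun j _ => mul_le_mul_of_nonneg_left (hterm j) hμ.le
    _ = V * Y ^ ((q - 2) / q) * ∑ j ∈ s, b j ^ 2 := by
        rw [Finset.mul_sum]; exact Finset.sum_congr rfl fun j _ => by ring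
    _ ≤ V * Y ^ ((q - 2) / q) * (V⁻¹ * (V + s.card * δ) * Y ^ (2 / q)) := by
        refine mul_le_mul_of_nonneg_left (hsq.trans ?_) (by positivity)
        exact mul_le_mul_of_nonneg_left hY2 (by positivity)
    _ = V * (V⁻¹ * (V + s.card * δ)) * (Y ^ ((q - 2) / q) * Y ^ (2 / q)) := by ring
    _ = V * (V⁻¹ * (V + s.card * δ)) * (V⁻¹ * mq) := by rw [hYY]
    _ = (1 + s.card * δ / V) * mq := by field_simp

end

/-! ### Grid cubes. -/

section Grid

variable {d : ℕ}

/-- The index of the grid cube of side `s` containing `ω`. -/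
noncomputable def gridIndex (s : ℝ) (ω : E d) : Fin d → ℤ := fun i => ⌊ω i / s⌋

/-- The grid cube of side `s` with index `m`. -/
def gridCube (s : ℝ) (m : Fin d → ℤ) : Set (E d) := cube s fun i => s * m i

lemma mem_gridCube {s : ℝ} (hs : 0 < s) {m : Fin d → ℤ} {ω : E d} :
    ω ∈ gridCube s m ↔ gridIndex s ω = m := by
  rw [funext_iff]
  refine forall_congr' fun i => ?_
  rw [gridIndex, Int.floor_eq_iff, le_div_iff₀ hs, div_lt_iff₀ hs, mem_Ico]
  constructor <;> rintro ⟨h1, h2⟩ <;> constructor <;> linarith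

lemma measurableSet_gridCube (s : ℝ) (m : Fin d → ℤ) : MeasurableSet (gridCube s m) :=
  measurableSet_cube _ _

lemma pairwiseDisjoint_gridCube {s : ℝ} (hs : 0 < s) (M : Set (Fin d → ℤ)) :
    M.PairwiseDisjoint (gridCube s) := by
  intro m _ m' _ hmm
  refine Set.disjoint_left.2 fun ω h h' => hmm ?_
  rw [← (mem_gridCube hs).1 h, (mem_gridCube hs).1 h']

lemma measurable_gridIndex (s : ℝ) : Measurable (gridIndex s : E d → Fin d → ℤ) := by
  refine measurable_pi_iff.2 fun i => Int.measurable_floor.comp ?_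
  exact Measurable.div_const (by fun_prop) s

lemma exists_finset_gridIndex {s : ℝ} (hs : 0 < s) :
    ∃ M : Finset (Fin d → ℤ), ∀ ω ∈ B d, gridIndex s ω ∈ M := by
  refine ⟨Fintype.piFinset fun _ => Finset.Icc ⌊-(1 / s)⌋ ⌊1 / s⌋, fun ω hω => ?_⟩
  rw [Fintype.mem_piFinset]
  intro i
  have h1 : |ω i| ≤ 1 := by
    have := PiLp.norm_apply_le ω i
    rw [mem_ball_zero_iff] at hω
    rw [← Real.norm_eq_abs]
    linarith
  rw [abs_le] at h1
  rw [Finset.mem_Icc]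
  constructor
  · refine Int.floor_le_floor ?_
    rw [← neg_div]
    exact div_le_div_of_nonneg_right h1.1 hs.le
  · exact Int.floor_le_floor (div_le_div_of_nonneg_right h1.2 hs.le)

/-- Only cubes meeting the support of k are needed, so no cube has to be cut by the boundary of the
ball. -/
lemma setIntegral_eq_sum_gridCube {s : ℝ} (hs : 0 < s) {M : Finset (Fin d → ℤ)}
    {k : E d → ℂ} (hk : IntegrableOn k (B d)) (hsub : ∀ m ∈ M, gridCube s m ⊆ B d)
    (hsupp : ∀ ω ∈ B d, k ω ≠ 0 → gridIndex s ω ∈ M) :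
    ∫ ω in B d, k ω = ∑ m ∈ M, ∫ ω in gridCube s m, k ω := by
  rw [← integral_biUnion_finset M (fun m _ => measurableSet_gridCube s m)
    (pairwiseDisjoint_gridCube hs _) fun m hm => hk.mono_set (hsub m hm)]
  refine setIntegral_eq_of_subset_of_forall_sdiff_eq_zero measurableSet_ball
    (iUnion₂_subset hsub) fun ω hω => ?_
  by_contra h
  exact hω.2 (mem_biUnion (hsupp ω hω.1 h) ((mem_gridCube hs).2 rfl))

lemma sum_setIntegral_gridCube_le {s : ℝ} (hs : 0 < s) {M : Finset (Fin d → ℤ)}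
    {g : E d → ℝ} (hg : IntegrableOn g (B d)) (hg0 : ∀ ω, 0 ≤ g ω)
    (hsub : ∀ m ∈ M, gridCube s m ⊆ B d) :
    ∑ m ∈ M, ∫ ω in gridCube s m, g ω ≤ ∫ ω in B d, g ω := by
  rw [← integral_biUnion_finset M (fun m _ => measurableSet_gridCube s m)
    (pairwiseDisjoint_gridCube hs _) fun m hm => hg.mono_set (hsub m hm)]
  exact setIntegral_mono_set hg (Filter.Eventually.of_forall hg0)
    (LE.le.eventuallyLE (iUnion₂_subset hsub))

end Grid

/-! ### Projection onto modulated step functions. -/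

section Projection

variable {d : ℕ} {φ a : E (d + 1) → E d → ℝ}

/-- The factor `exp(2πi λ φ(ξ; ω))`. -/
noncomputable def ephase (φ : E (d + 1) → E d → ℝ) (lam : ℝ) (ξ : E (d + 1)) (ω : E d) : ℂ :=
  Complex.exp (2 * Real.pi * Complex.I * ((lam * φ ξ ω : ℝ) : ℂ))

lemma norm_ephase (lam : ℝ) (ξ : E (d + 1)) (ω : E d) : ‖ephase φ lam ξ ω‖ = 1 :=
  norm_exp_phase _

lemma ephase_mul_conj (lam : ℝ) (ξ ξ' : E (d + 1)) (ω : E d) :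
    ephase φ lam ξ ω * (starRingEnd ℂ) (ephase φ lam ξ' ω) =
      Complex.exp (2 * Real.pi * Complex.I * ((lam * (φ ξ ω - φ ξ' ω) : ℝ) : ℂ)) := by
  rw [ephase, ephase, ← Complex.exp_conj, ← Complex.exp_add]
  congr 1
  simp only [map_mul, Complex.conj_ofReal, Complex.conj_I, map_ofNat]
  push_cast
  ring

lemma continuousOn_ephase
    (hφ : ContDiffOn ℝ (⊤ : ℕ∞) (Function.uncurry φ) (B (d + 1) ×ˢ B d)) (lam : ℝ)
    {ξ : E (d + 1)} (hξ : ξ ∈ B (d + 1)) : ContinuousOn (ephase φ lam ξ) (B d) := by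
  refine ContinuousOn.cexp (continuousOn_const.mul
    (Complex.continuous_ofReal.comp_continuousOn (continuousOn_const.mul ?_)))
  exact hφ.continuousOn.comp (f := fun ω => (ξ, ω)) (by fun_prop) fun ω hω => mk_mem_prod hξ hω

/-- The average of `exp(2πi λ φ(ξ; ·)) f` over a grid cube. -/
noncomputable def cubeAverage (φ : E (d + 1) → E d → ℝ) (lam : ℝ) (ξ : E (d + 1)) (s : ℝ)
    (f : E d → ℂ) (m : Fin d → ℤ) : ℂ :=
  ((s ^ d : ℝ) : ℂ)⁻¹ * ∫ ω in gridCube s m, ephase φ lam ξ ω * f ω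

open scoped Classical in
/-- The projection of `f` to the functions which, after modulation by `exp(2πi λ φ(ξ; ·))`, are
constant on the grid cubes with index in `M`. -/
noncomputable def cubeProj (φ : E (d + 1) → E d → ℝ) (lam : ℝ) (ξ : E (d + 1)) (s : ℝ)
    (M : Finset (Fin d → ℤ)) (f : E d → ℂ) (ω : E d) : ℂ :=
  if gridIndex s ω ∈ M then
    (starRingEnd ℂ) (ephase φ lam ξ ω) * cubeAverage φ lam ξ s f (gridIndex s ω) else 0

lemma aestronglyMeasurable_cubeProj
    (hφ : ContDiffOn ℝ (⊤ : ℕ∞) (Function.uncurry φ) (B (d + 1) ×ˢ B d)) (lam : ℝ)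
    {ξ : E (d + 1)} {s : ℝ} {M : Finset (Fin d → ℤ)} (hξ : M.Nonempty → ξ ∈ B (d + 1))
    (f : E d → ℂ) :
    AEStronglyMeasurable (cubeProj φ lam ξ s M f) (volume.restrict (B d)) := by
  -- If M is empty, ξ may lie outside the unit ball, where nothing is known about φ.
  rcases M.eq_empty_or_nonempty with rfl | hM
  · have : cubeProj φ lam ξ s ∅ f = fun _ => 0 := by
      ext ω
      simp [cubeProj]
    rw [this]
    exact aestronglyMeasurable_const
  have h1 : cubeProj φ lam ξ s M f = (gridIndex s ⁻¹' (M : Set (Fin d → ℤ))).indicator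
      fun ω => (starRingEnd ℂ) (ephase φ lam ξ ω) *
        cubeAverage φ lam ξ s f (gridIndex s ω) := by
    ext ω
    by_cases h : gridIndex s ω ∈ M
    · rw [cubeProj, if_pos h, indicator_of_mem (by exact h)]
    · rw [cubeProj, if_neg h, indicator_of_notMem (by exact h)]
  rw [h1]
  refine AEStronglyMeasurable.indicator ?_
    (measurable_gridIndex s (Set.Finite.measurableSet M.finite_toSet))
  refine AEStronglyMeasurable.mul ?_ ?_
  · exact Complex.continuous_conj.comp_aestronglyMeasurable
      ((continuousOn_ephase hφ lam (hξ hM)).aestronglyMeasurable measurableSet_ball)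
  · exact (((measurable_of_countable (cubeAverage φ lam ξ s f)).comp (measurable_gridIndex s)).aestronglyMeasurable)

lemma volume_gridCube {s : ℝ} (hs : 0 ≤ s) (m : Fin d → ℤ) :
    volume (gridCube s m) = ENNReal.ofReal (s ^ d) := volume_cube hs _

/-- The modulus of the projection is constant on each grid cube, since the modulation is unimodular.
-/
lemma lintegral_cubeProj_le (lam : ℝ) (ξ : E (d + 1)) {s : ℝ} (hs : 0 < s)
    (M : Finset (Fin d → ℤ)) (f : E d → ℂ) {q : ℝ} (hq : 0 < q) :
    ∫⁻ ω in B d, ‖cubeProj φ lam ξ s M f ω‖ₑ ^ q ≤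
      ∑ m ∈ M, ENNReal.ofReal (s ^ d * ‖cubeAverage φ lam ξ s f m‖ ^ q) := by
  have hpt : ∀ ω, ‖cubeProj φ lam ξ s M f ω‖ₑ ^ q ≤
      ∑ m ∈ M, (gridCube s m).indicator (fun _ => ‖cubeAverage φ lam ξ s f m‖ₑ ^ q) ω := by
    intro ω
    by_cases h : gridIndex s ω ∈ M
    · refine le_trans (le_of_eq ?_) (Finset.single_le_sum (f := fun m =>
        (gridCube s m).indicator (fun _ => ‖cubeAverage φ lam ξ s f m‖ₑ ^ q) ω)
        (fun _ _ => zero_le) h)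
      have hmem : ω ∈ gridCube s (gridIndex s ω) := (mem_gridCube hs).2 rfl
      rw [indicator_of_mem hmem, cubeProj, if_pos h, enorm_mul]
      have : ‖(starRingEnd ℂ) (ephase φ lam ξ ω)‖ₑ = 1 := by
        rw [← ofReal_norm, RCLike.norm_conj, norm_ephase, ENNReal.ofReal_one]
      rw [this, one_mul]
    · rw [cubeProj, if_neg h, enorm_zero, ENNReal.zero_rpow_of_pos hq]
      exact zero_le
  calc _ ≤ ∫⁻ ω, ∑ m ∈ M,
        (gridCube s m).indicator (fun _ => ‖cubeAverage φ lam ξ s f m‖ₑ ^ q) ω :=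
        (setLIntegral_le_lintegral _ _).trans (lintegral_mono hpt)
    _ = ∑ m ∈ M, ENNReal.ofReal (s ^ d * ‖cubeAverage φ lam ξ s f m‖ ^ q) := by
        rw [lintegral_finsetSum _ fun m _ =>
          measurable_const.indicator (measurableSet_gridCube s m)]
        refine Finset.sum_congr rfl fun m _ => ?_
        rw [lintegral_indicator_const (measurableSet_gridCube s m), volume_gridCube hs.le,
          ENNReal.ofReal_mul (by positivity), ← ENNReal.ofReal_rpow_of_nonneg (norm_nonneg _) hq.le,
          ofReal_norm, mul_comm]

/-- Replacing `g` by its average against a nearly constant kernel. -/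
lemma norm_integral_mul_sub_average_le {X : Type*} [MeasurableSpace X] {μ : Measure X}
    [IsFiniteMeasure μ] (hμ : 0 < μ.real univ) {k g : X → ℂ} {k₀ : ℂ} {τ : ℝ} (hτ : 0 ≤ τ)
    (hk : Integrable k μ) (hg : Integrable g μ) (hkg : Integrable (fun ω => k ω * g ω) μ)
    (hkτ : ∀ᵐ ω ∂μ, ‖k ω - k₀‖ ≤ τ) :
    ‖(∫ ω, k ω * g ω ∂μ) - (∫ ω, k ω ∂μ) * (((μ.real univ : ℝ) : ℂ)⁻¹ * ∫ ω, g ω ∂μ)‖ ≤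
      2 * τ * ∫ ω, ‖g ω‖ ∂μ := by
  set V := μ.real univ with hV
  have hVne : ((V : ℝ) : ℂ) ≠ 0 := by exact_mod_cast hμ.ne'
  have h1 : ∫ ω, k ω * g ω ∂μ = (∫ ω, (k ω - k₀) * g ω ∂μ) + k₀ * ∫ ω, g ω ∂μ := by
    rw [← integral_const_mul, ← integral_add]
    · congr 1; ext ω; ring
    · refine (hkg.sub (hg.const_mul k₀)).congr (Filter.Eventually.of_forall fun ω => ?_)
      simp only [Pi.sub_apply]; ring
    · exact hg.const_mul k₀
  have h2 : ∫ ω, k ω ∂μ = (∫ ω, (k ω - k₀) ∂μ) + V * k₀ := by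
    rw [integral_sub hk (integrable_const _), integral_const, ← hV, Complex.real_smul]; ring
  -- The contributions of the constant k₀ cancel, leaving k - k₀ in both integrals.
  have h3 : (∫ ω, k ω * g ω ∂μ) - (∫ ω, k ω ∂μ) * (((V : ℝ) : ℂ)⁻¹ * ∫ ω, g ω ∂μ) =
      (∫ ω, (k ω - k₀) * g ω ∂μ) - ((V : ℝ) : ℂ)⁻¹ * (∫ ω, (k ω - k₀) ∂μ) * ∫ ω, g ω ∂μ := by
    rw [h1, h2]
    field_simp
    ring
  have h4 : ‖∫ ω, (k ω - k₀) * g ω ∂μ‖ ≤ τ * ∫ ω, ‖g ω‖ ∂μ := by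
    rw [← integral_const_mul]
    refine norm_integral_le_of_norm_le (hg.norm.const_mul τ) (hkτ.mono fun ω h => ?_)
    rw [norm_mul]
    exact mul_le_mul_of_nonneg_right h (norm_nonneg _)
  have h5 : ‖∫ ω, (k ω - k₀) ∂μ‖ ≤ τ * V := norm_integral_le_of_norm_le_const hkτ
  have h6 : ‖∫ ω, g ω ∂μ‖ ≤ ∫ ω, ‖g ω‖ ∂μ := norm_integral_le_integral_norm _
  have hVn : ‖((V : ℝ) : ℂ)⁻¹‖ = V⁻¹ := by
    rw [norm_inv, Complex.norm_real, Real.norm_of_nonneg hμ.le]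
  rw [h3]
  refine (norm_sub_le _ _).trans ?_
  have h7 : ‖((V : ℝ) : ℂ)⁻¹ * (∫ ω, (k ω - k₀) ∂μ) * ∫ ω, g ω ∂μ‖ ≤ τ * ∫ ω, ‖g ω‖ ∂μ := by
    rw [norm_mul, norm_mul, hVn]
    refine mul_le_mul ?_ h6 (norm_nonneg _) hτ
    rw [inv_mul_le_iff₀ hμ]
    linarith
  linarith

/-- `T f` is well approximated by `T` of the projected function near the corresponding point. -/
lemma norm_T_sub_T_cubeProj_le
    (hφ : ContDiffOn ℝ (⊤ : ℕ∞) (Function.uncurry φ) (B (d + 1) ×ˢ B d))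
    (ha : IsAmplitude φ a) {lam : ℝ} {ξ : E (d + 1)} {s : ℝ} (hs : 0 < s)
    {M : Finset (Fin d → ℤ)} (hξ : M.Nonempty → ξ ∈ B (d + 1)) {f : E d → ℂ}
    (hf : IntegrableOn f (B d)) (hP : IntegrableOn (cubeProj φ lam ξ s M f) (B d))
    (hsub : ∀ m ∈ M, gridCube s m ⊆ B d) {x : E (d + 1)}
    (hsupp : ∀ ω ∈ B d, a (lam⁻¹ • x) ω ≠ 0 → gridIndex s ω ∈ M) {τ : ℝ} (hτ : 0 ≤ τ)
    (hvar : ∀ m ∈ M, ∀ ω ∈ gridCube s m, ∀ ω' ∈ gridCube s m,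
      ‖osc φ lam (fun p => ((a p.1 p.2 : ℝ) : ℂ)) (lam⁻¹ • x, ω) *
          (starRingEnd ℂ) (ephase φ lam ξ ω) -
        osc φ lam (fun p => ((a p.1 p.2 : ℝ) : ℂ)) (lam⁻¹ • x, ω') *
          (starRingEnd ℂ) (ephase φ lam ξ ω')‖ ≤ τ) :
    ‖T φ a lam f x - T φ a lam (cubeProj φ lam ξ s M f) x‖ ≤ 2 * τ * ∫ ω in B d, ‖f ω‖ := by
  set b : E d → ℂ := fun ω => osc φ lam (fun p => ((a p.1 p.2 : ℝ) : ℂ)) (lam⁻¹ • x, ω) with hb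
  have hint : ∀ g : E d → ℂ, IntegrableOn g (B d) → IntegrableOn (fun ω => b ω * g ω) (B d) :=
    fun g hg => integrable_fwdDiff_iter_osc_mul hφ ha.isTest lam hg 0 0 x
  have hdecomp : ∀ g : E d → ℂ, IntegrableOn g (B d) →
      T φ a lam g x = ∑ m ∈ M, ∫ ω in gridCube s m, b ω * g ω := by
    intro g hg
    rw [T_eq]
    refine setIntegral_eq_sum_gridCube hs (hint g hg) hsub fun ω hω h => hsupp ω hω fun h0 => h ?_
    simp [osc, h0]
  rw [hdecomp f hf, hdecomp _ hP, ← Finset.sum_sub_distrib]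
  calc _ ≤ ∑ m ∈ M, 2 * τ * ∫ ω in gridCube s m, ‖f ω‖ := by
        refine (norm_sum_le _ _).trans (Finset.sum_le_sum fun m hm => ?_)
        have hξB := hξ ⟨m, hm⟩
        set e := ephase φ lam ξ with he
        have hce : AEStronglyMeasurable e (volume.restrict (B d)) :=
          (continuousOn_ephase hφ lam hξB).aestronglyMeasurable measurableSet_ball
        have hcec : AEStronglyMeasurable (fun ω => (starRingEnd ℂ) (e ω)) (volume.restrict (B d)) :=
          Complex.continuous_conj.comp_aestronglyMeasurable hce
        have hee : ∀ ω, (starRingEnd ℂ) (e ω) * e ω = 1 := fun ω => by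
          rw [Complex.conj_mul', he, norm_ephase]; simp
        have hef : IntegrableOn (fun ω => e ω * f ω) (B d) :=
          hf.bdd_mul (c := 1) hce (Filter.Eventually.of_forall fun ω => (norm_ephase _ _ _).le)
        have hcei : IntegrableOn (fun ω => (starRingEnd ℂ) (e ω)) (B d) :=
          (integrable_const (1 : ℝ)).mono' hcec (Filter.Eventually.of_forall fun ω => by
            rw [RCLike.norm_conj, he, norm_ephase])
        have hk := hint _ hcei
        have hfin : IsFiniteMeasure ((volume : Measure (E d)).restrict (gridCube s m)) :=
          ⟨by rw [Measure.restrict_apply_univ, volume_gridCube hs.le]; exact ENNReal.ofReal_lt_top⟩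
        have hvol : ((volume : Measure (E d)).restrict (gridCube s m)).real univ = s ^ d := by
          rw [measureReal_restrict_apply_univ]
          exact volume_real_cube hs.le _
        -- Inserting conj(e) e = 1 pairs the slowly varying kernel b conj(e) with e f, whose average
        -- is the one kept by the projection.
        have h1 : ∫ ω in gridCube s m, b ω * f ω =
            ∫ ω in gridCube s m, (b ω * (starRingEnd ℂ) (e ω)) * (e ω * f ω) := by
          congr 1
          ext ω
          rw [mul_assoc, ← mul_assoc ((starRingEnd ℂ) (e ω)), hee, one_mul]
        have h2 : ∫ ω in gridCube s m, b ω * cubeProj φ lam ξ s M f ω =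
            (∫ ω in gridCube s m, b ω * (starRingEnd ℂ) (e ω)) *
              (((s ^ d : ℝ) : ℂ)⁻¹ * ∫ ω in gridCube s m, e ω * f ω) := by
          rw [← integral_mul_const]
          refine setIntegral_congr_fun (measurableSet_gridCube s m) fun ω hω => ?_
          rw [mem_gridCube hs] at hω
          rw [cubeProj, hω, if_pos hm, cubeAverage, mul_assoc]
        have hcorner : (WithLp.toLp 2 fun i => s * (m i : ℝ) : E d) ∈ gridCube s m := by
          intro i
          exact ⟨le_rfl, by simp [hs]⟩
        have hkg : IntegrableOn (fun ω => (b ω * (starRingEnd ℂ) (e ω)) * (e ω * f ω))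
            (gridCube s m) := by
          refine IntegrableOn.congr_fun ((hint f hf).mono_set (hsub m hm)) (fun ω _ => ?_)
            (measurableSet_gridCube s m)
          rw [mul_assoc, ← mul_assoc ((starRingEnd ℂ) (e ω)), hee, one_mul]
        have h3 := norm_integral_mul_sub_average_le
          (μ := (volume : Measure (E d)).restrict (gridCube s m))
          (by rw [hvol]; positivity) hτ (hk.mono_set (hsub m hm)) (hef.mono_set (hsub m hm)) hkg
          ((ae_restrict_mem (measurableSet_gridCube s m)).mono fun ω hω =>
            hvar m hm ω hω _ hcorner)
        rw [hvol] at h3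
        rw [h1, h2]
        refine h3.trans (le_of_eq ?_)
        congr 2
        ext ω
        rw [norm_mul, he, norm_ephase, one_mul]
    _ = 2 * τ * ∑ m ∈ M, ∫ ω in gridCube s m, ‖f ω‖ := by rw [Finset.mul_sum]
    _ ≤ _ := mul_le_mul_of_nonneg_left
        (sum_setIntegral_gridCube_le hs hf.norm (fun _ => norm_nonneg _) hsub) (by positivity)

lemma norm_exp_phase_sub_le (t t' : ℝ) :
    ‖Complex.exp (2 * Real.pi * Complex.I * (t : ℂ)) -
      Complex.exp (2 * Real.pi * Complex.I * (t' : ℂ))‖ ≤ 2 * Real.pi * |t - t'| := by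
  have h1 : Complex.exp (2 * Real.pi * Complex.I * (t : ℂ)) =
      Complex.exp (2 * Real.pi * Complex.I * (t' : ℂ)) *
        Complex.exp (Complex.I * ((2 * Real.pi * (t - t') : ℝ) : ℂ)) := by
    rw [← Complex.exp_add]
    congr 1
    push_cast
    ring
  rw [h1, ← mul_sub_one, norm_mul, norm_exp_phase, one_mul]
  refine (Real.norm_exp_I_mul_ofReal_sub_one_le (x := 2 * Real.pi * (t - t'))).trans (le_of_eq ?_)
  rw [norm_mul, Real.norm_of_nonneg (by positivity), Real.norm_eq_abs]

/-- Near the support of `a`, the demodulated kernel varies slowly in `ω`. -/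
lemma exists_kernel_variation (hd : 1 ≤ d)
    (hφ : ContDiffOn ℝ (⊤ : ℕ∞) (Function.uncurry φ) (B (d + 1) ×ˢ B d))
    (ha : IsAmplitude φ a) : ∃ η > 0, ∃ C ≥ 0, ∀ (s : ℝ) (z : Fin d → ℝ), 0 < s → s ≤ η →
      ∀ p ∈ tsupport (Function.uncurry a), p.2 ∈ closedCube s z →
        (∀ ζ, dist ζ p.1 ≤ η → ∀ ω ∈ closedCube s z, (ζ, ω) ∈ B (d + 1) ×ˢ B d) ∧
        ∀ ξ ξ' : E (d + 1), dist ξ p.1 ≤ η → dist ξ' p.1 ≤ η → ∀ lam : ℝ, 0 ≤ lam →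
          ∀ ω ∈ closedCube s z, ∀ ω' ∈ closedCube s z,
            ‖osc φ lam (fun p => ((a p.1 p.2 : ℝ) : ℂ)) (ξ, ω) *
                (starRingEnd ℂ) (ephase φ lam ξ' ω) -
              osc φ lam (fun p => ((a p.1 p.2 : ℝ) : ℂ)) (ξ, ω') *
                (starRingEnd ℂ) (ephase φ lam ξ' ω')‖ ≤ C * (lam * dist ξ ξ' + 1) * s := by
  obtain ⟨η₁, hη₁, hV⟩ := ha.compact.isCompact.exists_cthickening_subset_open (isOpen_domain d)
    ha.support
  set V := cthickening η₁ (tsupport (Function.uncurry a)) with hVdef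
  have hVc : IsCompact V := ha.compact.isCompact.cthickening
  set D : E (d + 1) × E d → E (d + 1) × E d →L[ℝ] ℝ := fderiv ℝ (Function.uncurry φ) with hDdef
  have hDs : ContDiffOn ℝ (⊤ : ℕ∞) D (B (d + 1) ×ˢ B d) :=
    hφ.fderiv_of_isOpen (isOpen_domain d) (by simp)
  obtain ⟨C₂, hC₂⟩ := hVc.exists_bound_of_continuousOn
    ((hDs.continuousOn_fderiv_of_isOpen (isOpen_domain d) (by simp)).mono hV)
  obtain ⟨A, hA0, hA⟩ := ha.isTest.exists_bound
  obtain ⟨L, hL⟩ := ha.smooth.lipschitzWith_of_hasCompactSupport ha.compact (by simp)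
  have hd1 : (1 : ℝ) ≤ d := by exact_mod_cast hd
  have hd0 : (0 : ℝ) < d := by linarith
  set η := η₁ / d with hηdef
  have hη0 : 0 < η := by positivity
  have hdη : d * η = η₁ := by rw [hηdef]; field_simp
  have hηη₁ : η ≤ η₁ := by nlinarith
  refine ⟨η, hη0, 2 * Real.pi * |C₂| * d * A + L * d, by positivity, ?_⟩
  intro s z hs hsη p hp hpz
  have hmemV : ∀ ζ : E (d + 1), dist ζ p.1 ≤ η → ∀ ω ∈ closedCube s z, (ζ, ω) ∈ V := by
    intro ζ hζ ω hω
    refine mem_cthickening_of_dist_le _ p _ _ hp ?_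
    rw [Prod.dist_eq]
    refine max_le (hζ.trans hηη₁) ((dist_le_of_mem_closedCube hω hpz).trans ?_)
    rw [← hdη]
    exact mul_le_mul_of_nonneg_left hsη hd0.le
  have hmemO := fun ζ hζ ω hω => hV (hmemV ζ hζ ω hω)
  refine ⟨hmemO, fun ξ ξ' hξ hξ' lam hlam ω hω ω' hω' => ?_⟩
  have hDlip : ∀ ω ∈ closedCube s z, ‖D (ξ, ω) - D (ξ', ω)‖ ≤ |C₂| * ‖ξ - ξ'‖ := by
    intro ω hω
    refine Convex.norm_image_sub_le_of_norm_hasFDerivWithin_le (f := fun ζ => D (ζ, ω))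
      (s := closedBall p.1 η) (fun ζ hζ => (hasFDerivAt_slice_left
        ((hDs.contDiffAt ((isOpen_domain d).mem_nhds (hmemO ζ hζ ω hω))).differentiableAt
          (by simp))).hasFDerivWithinAt) (fun ζ hζ => ?_) (convex_closedBall _ _) hξ' hξ
    refine (ContinuousLinearMap.opNorm_comp_le _ _).trans ?_
    calc _ ≤ |C₂| * 1 := mul_le_mul ((hC₂ _ (hmemV ζ hζ ω hω)).trans (le_abs_self _))
          (ContinuousLinearMap.norm_inl_le_one ℝ _ _) (norm_nonneg _) (abs_nonneg _)
      _ = |C₂| := mul_one _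
  -- A mixed difference in x and ω is bounded by the product of the increments, so after
  -- multiplication by λ the phase varies by O(λ dist(ξ, ξ') s) rather than O(λ s).
  have hphi : |(φ ξ ω - φ ξ' ω) - (φ ξ ω' - φ ξ' ω')| ≤ |C₂| * dist ξ ξ' * (d * s) := by
    have h1 := Convex.norm_image_sub_le_of_norm_hasFDerivWithin_le
      (f := fun ω => φ ξ ω - φ ξ' ω) (s := closedCube s z) (C := |C₂| * ‖ξ - ξ'‖)
      (f' := fun ω => (D (ξ, ω)).comp (ContinuousLinearMap.inr ℝ _ _) -
        (D (ξ', ω)).comp (ContinuousLinearMap.inr ℝ _ _))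
      (fun ω hω => ((hasFDerivAt_slice_right (differentiableAt_of_domain hφ
        (hmemO ξ hξ ω hω))).sub (hasFDerivAt_slice_right (differentiableAt_of_domain hφ
        (hmemO ξ' hξ' ω hω)))).hasFDerivWithinAt) (fun ω hω => by
          rw [← ContinuousLinearMap.sub_comp]
          refine (ContinuousLinearMap.opNorm_comp_le _ _).trans ?_
          calc _ ≤ (|C₂| * ‖ξ - ξ'‖) * 1 := mul_le_mul (hDlip ω hω)
                (ContinuousLinearMap.norm_inr_le_one ℝ _ _) (norm_nonneg _) (by positivity)
            _ = _ := mul_one _) (convex_closedCube s z) hω' hω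
    rw [Real.norm_eq_abs] at h1
    rw [dist_eq_norm]
    refine h1.trans (mul_le_mul_of_nonneg_left ?_ (by positivity))
    rw [← dist_eq_norm]
    exact dist_le_of_mem_closedCube hω hω'
  have hk : ∀ ω, osc φ lam (fun p => ((a p.1 p.2 : ℝ) : ℂ)) (ξ, ω) *
      (starRingEnd ℂ) (ephase φ lam ξ' ω) =
      Complex.exp (2 * Real.pi * Complex.I * ((lam * (φ ξ ω - φ ξ' ω) : ℝ) : ℂ)) *
        ((a ξ ω : ℝ) : ℂ) := by
    intro ω
    rw [← ephase_mul_conj]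
    simp only [osc, ephase]
    ring
  rw [hk, hk]
  set e := Complex.exp (2 * Real.pi * Complex.I * ((lam * (φ ξ ω - φ ξ' ω) : ℝ) : ℂ)) with he
  set e' := Complex.exp (2 * Real.pi * Complex.I * ((lam * (φ ξ ω' - φ ξ' ω') : ℝ) : ℂ)) with he'
  have h1 : ‖e - e'‖ ≤ 2 * Real.pi * (lam * (|C₂| * dist ξ ξ' * (d * s))) := by
    refine (norm_exp_phase_sub_le _ _).trans (mul_le_mul_of_nonneg_left ?_ (by positivity))
    rw [← mul_sub, abs_mul, abs_of_nonneg hlam]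
    exact mul_le_mul_of_nonneg_left hphi hlam
  have h2 : ‖((a ξ ω' : ℝ) : ℂ)‖ ≤ A := hA (ξ, ω')
  have h3 : ‖((a ξ ω : ℝ) : ℂ) - ((a ξ ω' : ℝ) : ℂ)‖ ≤ L * (d * s) := by
    rw [← Complex.ofReal_sub, Complex.norm_real]
    have := hL.dist_le_mul (ξ, ω) (ξ, ω')
    rw [Prod.dist_eq, dist_self, max_eq_right dist_nonneg, dist_eq_norm] at this
    exact this.trans (mul_le_mul_of_nonneg_left (dist_le_of_mem_closedCube hω hω') L.2)
  have h4 : e * ((a ξ ω : ℝ) : ℂ) - e' * ((a ξ ω' : ℝ) : ℂ) =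
      e * (((a ξ ω : ℝ) : ℂ) - ((a ξ ω' : ℝ) : ℂ)) + (e - e') * ((a ξ ω' : ℝ) : ℂ) := by ring
  rw [h4]
  refine (norm_add_le _ _).trans ?_
  rw [norm_mul, norm_mul, he, norm_exp_phase, one_mul, ← he]
  have h5 : ‖e - e'‖ * ‖((a ξ ω' : ℝ) : ℂ)‖ ≤
      2 * Real.pi * (lam * (|C₂| * dist ξ ξ' * (d * s))) * A :=
    mul_le_mul h1 h2 (norm_nonneg _) (by positivity)
  refine (add_le_add h3 h5).trans ?_
  have h6 : 0 ≤ 2 * Real.pi * |C₂| * d * A * s := by positivity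
  have h7 : 0 ≤ L * d * (lam * dist ξ ξ') * s := by positivity
  linarith

end Projection

/-! ### Cube averages attached to separated centres. -/

section

variable {d : ℕ} {φ a : E (d + 1) → E d → ℝ}

lemma eLpNorm_rpow_eq_lintegral {X : Type*} [MeasurableSpace X] {μ : Measure X} {g : X → ℂ}
    {p : ℝ≥0∞} {q : ℝ} (hq : 0 < q) (hp : p = ENNReal.ofReal q) :
    eLpNorm g p μ ^ q = ∫⁻ x, ‖g x‖ₑ ^ q ∂μ := by
  subst hp
  rw [eLpNorm_eq_lintegral_rpow_enorm_toReal (by simpa using hq) ENNReal.ofReal_ne_top,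
    ENNReal.toReal_ofReal hq.le, ← ENNReal.rpow_mul, one_div_mul_cancel hq.ne', ENNReal.rpow_one]

lemma amplitude_eq_zero (ha : IsAmplitude φ a) {ξ : E (d + 1)} (hξ : ξ ∉ B (d + 1)) (ω : E d) :
    a ξ ω = 0 := by
  by_contra h
  exact hξ (ha.support (subset_tsupport _ (show (ξ, ω) ∈ Function.support (Function.uncurry a)
    from h))).1

lemma T_eq_zero (ha : IsAmplitude φ a) {lam : ℝ} {x : E (d + 1)} (hx : lam⁻¹ • x ∉ B (d + 1))
    (f : E d → ℂ) : T φ a lam f x = 0 := by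
  rw [T_eq]
  simp [osc, amplitude_eq_zero ha hx]

/-- The grid cubes which meet the `ω`-support of the kernel over the ball `B(x, R)`. -/
def IsActive (a : E (d + 1) → E d → ℝ) (lam R s : ℝ) (x : E (d + 1)) (m : Fin d → ℤ) : Prop :=
  ∃ p ∈ tsupport (Function.uncurry a), p.2 ∈ gridCube s m ∧ dist (lam • p.1) x < R

lemma IsActive.dist_le {lam R η : ℝ} (hlam : 0 < lam) (hR : R ≤ η / 2 * lam)
    {x : E (d + 1)} {p : E (d + 1) × E d} (hp : dist (lam • p.1) x < R) :
    dist (lam⁻¹ • x) p.1 ≤ η / 2 := by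
  have h1 : dist (lam⁻¹ • x) (lam⁻¹ • (lam • p.1)) = lam⁻¹ * dist x (lam • p.1) := by
    rw [dist_smul₀, Real.norm_of_nonneg (by positivity)]
  rw [inv_smul_smul₀ hlam.ne', dist_comm x] at h1
  rw [h1, inv_mul_le_iff₀ hlam]
  linarith

/-- The exponent d + 2 comes from N R^(d+1) · R ≤ (RN)^(d+2): N balls of volume about R^(d+1), with
errors of size about R s, contribute a bounded total. -/
lemma rpow_grid_bounds {R N η : ℝ} (hR : 1 ≤ R) (hN : 1 ≤ N) (hη : 0 < η) (hη1 : η ≤ 1) :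
    0 < η * (R * N) ^ (-(d + 2 : ℝ)) ∧ η * (R * N) ^ (-(d + 2 : ℝ)) ≤ η ∧
      N * R ^ (d + 1) * (R * (η * (R * N) ^ (-(d + 2 : ℝ)))) ≤ 1 ∧
      R * (η * (R * N) ^ (-(d + 2 : ℝ))) ≤ 1 := by
  have hY : 1 ≤ R * N := by nlinarith
  have hY0 : 0 < R * N := by linarith
  set y := (R * N) ^ (-(d + 2 : ℝ)) with hy
  have hy0 : 0 < y := Real.rpow_pos_of_pos hY0 _
  have hy1 : y ≤ 1 := Real.rpow_le_one_of_one_le_of_nonpos hY (by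
    have : (0 : ℝ) ≤ d := Nat.cast_nonneg d
    linarith)
  have h1 : (R * N) ^ (d + 2) * y = 1 := by
    rw [hy, Real.rpow_neg hY0.le, ← Real.rpow_natCast]
    push_cast
    exact mul_inv_cancel₀ (by positivity)
  have h2 : N * R ^ (d + 1) * R ≤ (R * N) ^ (d + 2) := by
    rw [mul_pow]
    have h3 : N ≤ N ^ (d + 2) := le_self_pow₀ hN (by omega)
    calc N * R ^ (d + 1) * R = R ^ (d + 2) * N := by ring
      _ ≤ R ^ (d + 2) * N ^ (d + 2) := by gcongr
  have h4 : R ≤ (R * N) ^ (d + 2) := by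
    calc R ≤ R * N := by nlinarith
      _ ≤ _ := le_self_pow₀ hY (by omega)
  refine ⟨by positivity, by nlinarith, ?_, ?_⟩
  · calc _ = N * R ^ (d + 1) * R * (η * y) := by ring
      _ ≤ (R * N) ^ (d + 2) * (1 * y) := by gcongr
      _ = 1 := by rw [one_mul, h1]
  · calc _ ≤ (R * N) ^ (d + 2) * (1 * y) := by gcongr
      _ = 1 := by rw [one_mul, h1]

/-- Here s^(-d) is η^(-d)(RN)^((d+2)d), and decay of order 1/3 turns sparseness into a gain
(RN)^(-Cbar/3). The threshold for Cbar pays for s^(-d), and its summand 1 pays for the factor N. -/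
lemma gram_constant_le {R N η C Cbar δ : ℝ} (hR : 1 ≤ R) (hN : 1 ≤ N) (hη : 0 < η) (hC : 0 ≤ C)
    (hCbar : 3 * ((d + 2) * d + 1) ≤ Cbar) (hδ : δ = C * ((R * N) ^ Cbar) ^ (-(1 / 3) : ℝ)) :
    N * δ / (η * (R * N) ^ (-(d + 2 : ℝ))) ^ d ≤ C / η ^ d := by
  have hY : 1 ≤ R * N := by nlinarith
  have hY0 : 0 < R * N := by linarith
  have h1 : ((R * N) ^ (-(d + 2 : ℝ))) ^ d = (R * N) ^ (-((d + 2 : ℝ) * d)) := by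
    rw [← Real.rpow_natCast, ← Real.rpow_mul hY0.le]
    congr 1
    ring
  have h2 : ((R * N) ^ Cbar) ^ (-(1 / 3) : ℝ) ≤ (R * N) ^ (-((d + 2 : ℝ) * d)) * (R * N)⁻¹ := by
    rw [← Real.rpow_mul hY0.le, ← Real.rpow_neg_one (R * N), ← Real.rpow_add hY0]
    exact Real.rpow_le_rpow_of_exponent_le hY (by linarith)
  have h3 : N * (R * N)⁻¹ ≤ 1 := by
    rw [← div_eq_mul_inv, div_le_one hY0]
    nlinarith
  have hz : 0 < (R * N) ^ (-((d + 2 : ℝ) * d)) := Real.rpow_pos_of_pos hY0 _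
  rw [mul_pow, h1, div_le_div_iff₀ (by positivity) (by positivity), hδ]
  calc N * (C * ((R * N) ^ Cbar) ^ (-(1 / 3) : ℝ)) * η ^ d
      ≤ N * (C * ((R * N) ^ (-((d + 2 : ℝ) * d)) * (R * N)⁻¹)) * η ^ d := by gcongr
    _ = C * (η ^ d * (R * N) ^ (-((d + 2 : ℝ) * d))) * (N * (R * N)⁻¹) := by ring
    _ ≤ C * (η ^ d * (R * N) ^ (-((d + 2 : ℝ) * d))) * 1 := by gcongr
    _ = _ := mul_one _

/-- The `L^q` almost orthogonality of the cube averages associated with separated points, over a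
single grid cube. -/
lemma exists_sum_cubeAverage_le (hd : 1 ≤ d) (hφ : IsPhase φ) (ha : IsAmplitude φ a) :
    ∃ η > 0, ∃ K ≥ 0, ∀ η' : ℝ, 0 < η' → η' ≤ η → ∀ Cbar : ℝ, 3 * ((d + 2) * d + 1) ≤ Cbar →
      ∀ lam R : ℝ, 1 ≤ R → R ≤ η' / 2 * lam → ∀ (N : ℕ) (x : Fin N → E (d + 1)), 0 < N →
        IsSparse Cbar R x → ∀ s : ℝ, s = η' * (R * N) ^ (-(d + 2 : ℝ)) →
          ∀ (m : Fin d → ℤ) (J : Finset (Fin N)),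
            (∀ j ∈ J, IsActive a lam R s (x j) m) →
            (∀ j ∈ J, ∀ k ∈ J, dist (lam⁻¹ • x j) (lam⁻¹ • x k) ≤ η' / 2) →
            ∀ q : ℝ, 2 ≤ q → ∀ f : E d → ℂ, MemLp f (ENNReal.ofReal q) (volume.restrict (B d)) →
              ∑ j ∈ J, ENNReal.ofReal (s ^ d * ‖cubeAverage φ lam (lam⁻¹ • x j) s f m‖ ^ q) ≤
                ENNReal.ofReal (1 + K / η' ^ d) *
                  ∫⁻ ω in gridCube s m, (B d).indicator (fun ω => ‖f ω‖ₑ ^ q) ω := by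
  obtain ⟨η₁, hη₁, C, hC, hdec⟩ := exists_decay hd hφ ha
  obtain ⟨η₂, hη₂, _, _, hker⟩ := exists_kernel_variation hd hφ.smooth ha
  refine ⟨min (min η₁ η₂) 1, by positivity, C, hC, ?_⟩
  intro η hη0 hη Cbar hCbar lam R hR hRlam N x hN hsp s hs m J hJ hJd q hq f hf
  have hηη₁ : η ≤ η₁ := hη.trans ((min_le_left _ _).trans (min_le_left _ _))
  have hηη₂ : η ≤ η₂ := hη.trans ((min_le_left _ _).trans (min_le_right _ _))
  have hη1 : η ≤ 1 := hη.trans (min_le_right _ _)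
  have hN1 : (1 : ℝ) ≤ N := by exact_mod_cast hN
  have hlam : 0 < lam := by
    by_contra! h
    nlinarith
  obtain ⟨hs0, hsη, -, -⟩ := rpow_grid_bounds (d := d) hR hN1 hη0 hη1
  rw [← hs] at hs0 hsη
  rcases J.eq_empty_or_nonempty with rfl | ⟨j₀, hj₀⟩
  · simp
  have hactive : ∀ j ∈ J, ∃ p ∈ tsupport (Function.uncurry a), p.2 ∈ closedCube s (fun i => s * m i)
      ∧ dist (lam⁻¹ • x j) p.1 ≤ η / 2 := by
    intro j hj
    obtain ⟨p, hp, hpm, hpd⟩ := hJ j hj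
    exact ⟨p, hp, cube_subset_closedCube _ _ hpm, IsActive.dist_le hlam hRlam hpd⟩
  have hdom : ∀ j ∈ J, ∀ ω ∈ gridCube s m, (lam⁻¹ • x j, ω) ∈ B (d + 1) ×ˢ B d := by
    intro j hj ω hω
    obtain ⟨p, hp, hpm, hpd⟩ := hactive j hj
    exact (hker s _ hs0 (hsη.trans hηη₂) p hp hpm).1 _ (by linarith) ω
      (cube_subset_closedCube _ _ hω)
  have hsub : gridCube s m ⊆ B d := fun ω hω => (hdom j₀ hj₀ ω hω).2
  have hξ : ∀ j ∈ J, lam⁻¹ • x j ∈ B (d + 1) := by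
    intro j hj
    obtain ⟨p, hp, hpm, hpd⟩ := hJ j hj
    exact (hdom j hj p.2 hpm).1
  have hfin : IsFiniteMeasure ((volume : Measure (E d)).restrict (gridCube s m)) :=
    ⟨by rw [Measure.restrict_apply_univ, volume_gridCube hs0.le]; exact ENNReal.ofReal_lt_top⟩
  have hvol : ((volume : Measure (E d)).restrict (gridCube s m)).real univ = s ^ d := by
    rw [measureReal_restrict_apply_univ]
    exact volume_real_cube hs0.le _
  have hY : 1 ≤ R * N := by nlinarith
  have hCbar1 : 1 ≤ Cbar := by
    have : (0 : ℝ) ≤ (d + 2) * d := by positivity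
    linarith
  have hYC : 1 ≤ (R * N) ^ Cbar := Real.one_le_rpow hY (by linarith)
  set δ := C * ((R * N) ^ Cbar) ^ (-(1 / 3) : ℝ) with hδ
  have hδ0 : 0 ≤ δ := by positivity
  have hfm : MemLp f (ENNReal.ofReal q) (volume.restrict (gridCube s m)) :=
    hf.mono_measure (Measure.restrict_mono hsub le_rfl)
  have hmain := sum_average_rpow_le (μ := (volume : Measure (E d)).restrict (gridCube s m))
    (by rw [hvol]; positivity) J (fun j => ephase φ lam (lam⁻¹ • x j))
    (fun j hj => ((continuousOn_ephase hφ.smooth lam (hξ j hj)).mono hsub).aestronglyMeasurable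
      (measurableSet_gridCube s m)) (fun j ω => norm_ephase _ _ _) hδ0 (by
      intro j hj k hk hjk
      obtain ⟨p, hp, hpm, hpd⟩ := hactive j hj
      have hsep := hsp j k hjk
      -- Dividing the phase difference by the rescaled distance Λ/λ turns the parameter λ into Λ,
      -- the distance that sparseness bounds below.
      set Λ := dist (x j) (x k) with hΛ
      have hΛ1 : 1 ≤ Λ := hYC.trans hsep
      have hdist : dist (lam⁻¹ • x j) (lam⁻¹ • x k) = lam⁻¹ * Λ := by
        rw [dist_smul₀, Real.norm_of_nonneg (by positivity)]
      have hne : lam⁻¹ • x j ≠ lam⁻¹ • x k := by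
        intro h
        rw [h, dist_self] at hdist
        have : 0 < lam⁻¹ * Λ := by positivity
        linarith
      have h1 := hdec s (fun i => s * m i) hs0 (hsη.trans hηη₁) p hp hpm (lam⁻¹ • x j)
        (lam⁻¹ • x k) (by linarith) (by
          have := dist_triangle (lam⁻¹ • x k) (lam⁻¹ • x j) p.1
          have h2 := hJd k hk j hj
          linarith) hne Λ hΛ1
      have h2 : ∀ ω, ephase φ lam (lam⁻¹ • x j) ω *
          (starRingEnd ℂ) (ephase φ lam (lam⁻¹ • x k) ω) =
          Complex.exp (2 * Real.pi * Complex.I * ((Λ * ((φ (lam⁻¹ • x j) ω -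
            φ (lam⁻¹ • x k) ω) / ‖lam⁻¹ • x j - lam⁻¹ • x k‖) : ℝ) : ℂ)) := by
        intro ω
        rw [ephase_mul_conj, ← dist_eq_norm, hdist]
        congr 3
        field_simp
      simp only [h2]
      refine h1.trans (mul_le_mul_of_nonneg_left ?_ hC)
      exact Real.rpow_le_rpow_of_nonpos (by positivity) hsep (by norm_num)) hq hfm
  rw [hvol] at hmain
  have hq0 : 0 < q := by linarith
  have hconst : 1 + J.card * δ / s ^ d ≤ 1 + C / η ^ d := by
    have h1 : (J.card : ℝ) ≤ N := by
      exact_mod_cast (Finset.card_le_univ J).trans_eq (Fintype.card_fin N)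
    have h2 := gram_constant_le (d := d) hR hN1 hη0 hC hCbar hδ
    rw [← hs] at h2
    have h3 : J.card * δ / s ^ d ≤ N * δ / s ^ d := by gcongr
    linarith
  have hint : ENNReal.ofReal (∫ ω in gridCube s m, ‖f ω‖ ^ q) =
      ∫⁻ ω in gridCube s m, (B d).indicator (fun ω => ‖f ω‖ₑ ^ q) ω := by
    rw [ofReal_integral_eq_lintegral_ofReal]
    · refine setLIntegral_congr_fun (measurableSet_gridCube s m) fun ω hω => ?_
      rw [indicator_of_mem (hsub hω), ← ofReal_norm,
        ENNReal.ofReal_rpow_of_nonneg (norm_nonneg _) hq0.le]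
    · have := hfm.integrable_norm_rpow (by simpa using hq0) ENNReal.ofReal_ne_top
      rwa [ENNReal.toReal_ofReal hq0.le] at this
    · exact Filter.Eventually.of_forall fun ω => by positivity
  rw [← hint, ← ENNReal.ofReal_mul (by positivity), ← ENNReal.ofReal_sum_of_nonneg
    fun j _ => by positivity]
  refine ENNReal.ofReal_le_ofReal ((le_of_eq ?_).trans (hmain.trans ?_))
  · rfl
  · exact mul_le_mul_of_nonneg_right hconst (integral_nonneg fun ω => by positivity)

end

/-! ### From local bounds to sparse bounds. -/

section

variable {d : ℕ} {φ a : E (d + 1) → E d → ℝ}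

/-- The estimate over the part of a sparse collection of balls whose rescaled centres lie close
together. -/
lemma exists_sum_lintegral_ball_le (hd : 1 ≤ d) (hφ : IsPhase φ) (ha : IsAmplitude φ a)
    {q : ℝ} (hq : 2 ≤ q) {ε : ℝ} (hε : 0 < ε) {CL : ℝ≥0}
    (hL : ∀ lam R : ℝ, 1 ≤ R → R ≤ lam → ∀ x₀ : E (d + 1), ∀ f : E d → ℂ,
      MemLp f (ENNReal.ofReal q) (volume.restrict (B d)) →
        eLpNorm (T φ a lam f) (ENNReal.ofReal q) (volume.restrict (ball x₀ R)) ≤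
          CL * ENNReal.ofReal (R ^ ε) *
            eLpNorm f (ENNReal.ofReal q) (volume.restrict (B d))) :
    ∃ η > 0, η ≤ 1 ∧ ∃ C : ℝ≥0, ∀ Cbar : ℝ, 3 * ((d + 2) * d + 1) ≤ Cbar →
      ∀ lam R : ℝ, 1 ≤ R → R ≤ η / 2 * lam → ∀ (N : ℕ) (x : Fin N → E (d + 1)),
        IsSparse Cbar R x → ∀ J : Finset (Fin N),
          (∀ j ∈ J, ∀ k ∈ J, dist (lam⁻¹ • x j) (lam⁻¹ • x k) ≤ η / 2) →
          ∀ f : E d → ℂ, MemLp f (ENNReal.ofReal q) (volume.restrict (B d)) →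
            ∑ j ∈ J, ∫⁻ y in ball (x j) R, ‖T φ a lam f y‖ₑ ^ q ≤
              C * ENNReal.ofReal (R ^ ε) ^ q * ∫⁻ ω in B d, ‖f ω‖ₑ ^ q := by
  classical
  have hq0 : 0 < q := by linarith
  have hp1 : 1 ≤ ENNReal.ofReal q := by simpa using (by linarith : (1 : ℝ) ≤ q)
  obtain ⟨η₁, hη₁, K, hK, hsum⟩ := exists_sum_cubeAverage_le hd hφ ha
  obtain ⟨η₂, hη₂, C₂, hC₂, hker⟩ := exists_kernel_variation hd hφ.smooth ha
  obtain ⟨F, hF⟩ := exists_integral_norm_le (d := d) hp1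
  set η := min (min η₁ η₂) 1 with hηdef
  have hη0 : 0 < η := by positivity
  have hηη₁ : η ≤ η₁ := (min_le_left _ _).trans (min_le_left _ _)
  have hηη₂ : η ≤ η₂ := (min_le_left _ _).trans (min_le_right _ _)
  have hη1 : η ≤ 1 := min_le_right _ _
  set W := (volume : Measure (E (d + 1))) (ball 0 1) with hW
  have hWt : W ≠ ∞ := measure_ball_lt_top.ne
  set K' : ℝ≥0 := Real.toNNReal (1 + K / η ^ d) with hK'
  set D : ℝ≥0 := Real.toNNReal (4 * C₂) with hD
  have hDr : (D : ℝ) = 4 * C₂ := Real.coe_toNNReal _ (by positivity)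
  refine ⟨η, hη0, hη1, (2 : ℝ≥0) ^ (q - 1) * (CL ^ q * K' + W.toNNReal * (D * F) ^ q), ?_⟩
  intro Cbar hCbar lam R hR hRlam N x hsp J hJd f hf
  rcases Nat.eq_zero_or_pos N with rfl | hN
  · rw [Finset.sum_eq_zero fun j _ => Fin.elim0 j]
    exact zero_le
  have hN1 : (1 : ℝ) ≤ N := by exact_mod_cast hN
  have hlam : 0 < lam := by
    by_contra! h
    nlinarith
  have hRlam1 : R ≤ lam := by nlinarith
  have hlam1 : 1 ≤ lam := hR.trans hRlam1
  have hR0 : 0 < R := by linarith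
  set s := η * (R * N) ^ (-(d + 2 : ℝ)) with hs
  obtain ⟨hs0, hsη, hgrid1, hgrid2⟩ := rpow_grid_bounds (d := d) hR hN1 hη0 hη1
  rw [← hs] at hs0 hsη hgrid1 hgrid2
  obtain ⟨hfi, hfI⟩ := hF f hf
  obtain ⟨M, hM⟩ := exists_finset_gridIndex (d := d) hs0
  set Q := ∫⁻ ω in B d, ‖f ω‖ₑ ^ q with hQ
  set I := ∫ ω in B d, ‖f ω‖ with hI
  have hI0 : 0 ≤ I := integral_nonneg fun _ => norm_nonneg _
  have hQn : eLpNorm f (ENNReal.ofReal q) (volume.restrict (B d)) ^ q = Q :=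
    eLpNorm_rpow_eq_lintegral hq0 rfl
  -- Active cubes carry all of T f over the ball; they lie inside B^d, and the existence of one
  -- places the rescaled centre in the domain of φ.
  let Mj : Fin N → Finset (Fin d → ℤ) := fun j => M.filter (IsActive a lam R s (x j))
  let ξ : Fin N → E (d + 1) := fun j => lam⁻¹ • x j
  let P : Fin N → E d → ℂ := fun j => cubeProj φ lam (ξ j) s (Mj j) f
  have hdom : ∀ j m, IsActive a lam R s (x j) m → gridCube s m ⊆ B d ∧ ξ j ∈ B (d + 1) := by
    rintro j m ⟨p, hp, hpm, hpd⟩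
    have h1 := (hker s _ hs0 (hsη.trans hηη₂) p hp (cube_subset_closedCube _ _ hpm)).1 (ξ j) (by
      have := IsActive.dist_le hlam hRlam hpd
      linarith)
    exact ⟨fun ω hω => (h1 ω (cube_subset_closedCube _ _ hω)).2,
      (h1 p.2 (cube_subset_closedCube _ _ hpm)).1⟩
  -- the sum of the projected functions
  have hPsum : ∑ j ∈ J, ∫⁻ ω in B d, ‖P j ω‖ₑ ^ q ≤ K' * Q := by
    calc ∑ j ∈ J, ∫⁻ ω in B d, ‖P j ω‖ₑ ^ q
        ≤ ∑ j ∈ J, ∑ m ∈ Mj j, ENNReal.ofReal (s ^ d * ‖cubeAverage φ lam (ξ j) s f m‖ ^ q) :=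
          Finset.sum_le_sum fun j _ => lintegral_cubeProj_le lam (ξ j) hs0 (Mj j) f hq0
      -- The sums are interchanged so that almost orthogonality is used one cube at a time, for the
      -- balls for which that cube is active.
      _ = ∑ m ∈ M, ∑ j ∈ J.filter (fun j => IsActive a lam R s (x j) m),
            ENNReal.ofReal (s ^ d * ‖cubeAverage φ lam (ξ j) s f m‖ ^ q) := by
          simp only [Mj, Finset.sum_filter]
          exact Finset.sum_comm
      _ ≤ ∑ m ∈ M, K' * ∫⁻ ω in gridCube s m, (B d).indicator (fun ω => ‖f ω‖ₑ ^ q) ω := by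
          refine Finset.sum_le_sum fun m _ => ?_
          exact hsum η hη0 hηη₁ Cbar hCbar lam R hR hRlam N x hN hsp s hs m _
            (fun j hj => (Finset.mem_filter.1 hj).2)
            (fun j hj k hk => hJd j (Finset.mem_filter.1 hj).1 k (Finset.mem_filter.1 hk).1)
            q hq f hf
      _ = K' * ∫⁻ ω in ⋃ m ∈ M, gridCube s m, (B d).indicator (fun ω => ‖f ω‖ₑ ^ q) ω := by
          rw [← Finset.mul_sum, lintegral_biUnion_finset (pairwiseDisjoint_gridCube hs0 _)
            fun m _ => measurableSet_gridCube s m]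
      _ ≤ K' * Q := by
          refine mul_le_mul' le_rfl ((setLIntegral_le_lintegral _ _).trans (le_of_eq ?_))
          rw [lintegral_indicator measurableSet_ball]
  -- the estimate on a single ball
  set e : ℝ≥0∞ := ENNReal.ofReal (4 * C₂ * (R * s) * I) with he
  have hball : ∀ j ∈ J, ∫⁻ y in ball (x j) R, ‖T φ a lam f y‖ₑ ^ q ≤
      (2 : ℝ≥0∞) ^ (q - 1) * ((CL * ENNReal.ofReal (R ^ ε)) ^ q * (∫⁻ ω in B d, ‖P j ω‖ₑ ^ q) +
        e ^ q * (ENNReal.ofReal (R ^ (d + 1)) * W)) := by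
    intro j hj
    have hξ : (Mj j).Nonempty → ξ j ∈ B (d + 1) := fun ⟨m, hm⟩ =>
      (hdom j m (Finset.mem_filter.1 hm).2).2
    have hPm : MemLp (P j) (ENNReal.ofReal q) (volume.restrict (B d)) := by
      refine ⟨aestronglyMeasurable_cubeProj hφ.smooth lam hξ f, ?_⟩
      rw [eLpNorm_eq_lintegral_rpow_enorm_toReal (by simpa using hq0) ENNReal.ofReal_ne_top,
        ENNReal.toReal_ofReal hq0.le]
      refine ENNReal.rpow_lt_top_of_nonneg (by positivity) (ne_top_of_le_ne_top ?_
        (lintegral_cubeProj_le lam (ξ j) hs0 (Mj j) f hq0))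
      exact ENNReal.sum_ne_top.2 fun _ _ => ENNReal.ofReal_ne_top
    have hPi : IntegrableOn (P j) (B d) := hPm.integrable hp1
    have hclose : ∀ y ∈ ball (x j) R, ‖T φ a lam f y - T φ a lam (P j) y‖ ≤
        4 * C₂ * (R * s) * I := by
      intro y hy
      rw [mem_ball] at hy
      -- On the ball, λ dist(y/λ, ξ j) + 1 ≤ R + 1 ≤ 2R, which explains τ; the approximation lemma
      -- doubles it, giving 4 C₂.
      refine (norm_T_sub_T_cubeProj_le hφ.smooth ha hs0 hξ hfi hPi
        (fun m hm => (hdom j m (Finset.mem_filter.1 hm).2).1) (x := y) ?_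
        (τ := C₂ * (2 * R) * s) (by positivity) ?_).trans (le_of_eq (by ring))
      · intro ω hω hne
        refine Finset.mem_filter.2 ⟨hM ω hω, (lam⁻¹ • y, ω), subset_tsupport _ hne,
          (mem_gridCube hs0).2 rfl, ?_⟩
        rwa [smul_inv_smul₀ hlam.ne']
      · intro m hm ω hω ω' hω'
        obtain ⟨p, hp, hpm, hpd⟩ := (Finset.mem_filter.1 hm).2
        have hd1 : dist (ξ j) p.1 ≤ η / 2 := IsActive.dist_le hlam hRlam hpd
        have hd2 : dist (lam⁻¹ • y) (ξ j) = lam⁻¹ * dist y (x j) := by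
          rw [dist_smul₀, Real.norm_of_nonneg (by positivity)]
        have hd3 : lam * dist (lam⁻¹ • y) (ξ j) ≤ R := by
          rw [hd2, mul_inv_cancel_left₀ hlam.ne']
          exact hy.le
        have hd4 : dist (lam⁻¹ • y) (ξ j) ≤ η / 2 := by
          rw [hd2, inv_mul_le_iff₀ hlam]
          linarith
        have hd5 := dist_triangle (lam⁻¹ • y) (ξ j) p.1
        refine ((hker s _ hs0 (hsη.trans hηη₂) p hp (cube_subset_closedCube _ _ hpm)).2
          (lam⁻¹ • y) (ξ j) (by linarith) (by linarith) lam hlam.le ω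
          (cube_subset_closedCube _ _ hω) ω' (cube_subset_closedCube _ _ hω')).trans ?_
        gcongr
        linarith
    have hTP : ∫⁻ y in ball (x j) R, ‖T φ a lam (P j) y‖ₑ ^ q ≤
        (CL * ENNReal.ofReal (R ^ ε)) ^ q * ∫⁻ ω in B d, ‖P j ω‖ₑ ^ q := by
      rw [← eLpNorm_rpow_eq_lintegral hq0 rfl, ← eLpNorm_rpow_eq_lintegral hq0 rfl,
        ← ENNReal.mul_rpow_of_nonneg _ _ hq0.le]
      exact ENNReal.rpow_le_rpow (hL lam R hR hRlam1 (x j) (P j) hPm) hq0.le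
    have hcont := continuous_T hφ.smooth ha hlam1 hPi
    calc ∫⁻ y in ball (x j) R, ‖T φ a lam f y‖ₑ ^ q
        ≤ ∫⁻ y in ball (x j) R, (2 : ℝ≥0∞) ^ (q - 1) * (‖T φ a lam (P j) y‖ₑ ^ q + e ^ q) := by
          refine setLIntegral_mono' measurableSet_ball fun y hy => ?_
          refine le_trans (ENNReal.rpow_le_rpow ?_ hq0.le)
            (ENNReal.rpow_add_le_mul_rpow_add_rpow _ _ (by linarith))
          have h1 : ‖T φ a lam f y - T φ a lam (P j) y‖ₑ ≤ e := by
            rw [← ofReal_norm]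
            exact ENNReal.ofReal_le_ofReal (hclose y hy)
          calc ‖T φ a lam f y‖ₑ =
                ‖T φ a lam (P j) y + (T φ a lam f y - T φ a lam (P j) y)‖ₑ := by
                rw [add_sub_cancel]
            _ ≤ _ := (enorm_add_le _ _).trans (add_le_add le_rfl h1)
      _ = (2 : ℝ≥0∞) ^ (q - 1) * ((∫⁻ y in ball (x j) R, ‖T φ a lam (P j) y‖ₑ ^ q) +
            e ^ q * (ENNReal.ofReal (R ^ (d + 1)) * W)) := by
          rw [lintegral_const_mul' _ _ (ENNReal.rpow_ne_top_of_nonneg (by linarith) (by simp)),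
            lintegral_add_right _ measurable_const, setLIntegral_const,
            Measure.addHaar_ball_of_pos _ _ hR0, finrank_euclideanSpace_fin]
      _ ≤ _ := by gcongr
  -- the total error
  have herr : N * (e ^ q * (ENNReal.ofReal (R ^ (d + 1)) * W)) ≤ W * ((D * F : ℝ≥0∞) ^ q * Q) := by
    have h1 : e ≤ ENNReal.ofReal (R * s) *
        (D * (F * eLpNorm f (ENNReal.ofReal q) (volume.restrict (B d)))) := by
      have : 4 * C₂ * (R * s) * I = (R * s) * (D * I) := by rw [hDr]; ring
      rw [he, this, ENNReal.ofReal_mul (p := R * s) (by positivity),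
        ENNReal.ofReal_mul (p := (D : ℝ)) (by positivity), ENNReal.ofReal_coe_nnreal]
      gcongr
    -- Because R s ≤ 1 and q ≥ 1, one factor R s may be kept out of (R s)^q; it pays for the number
    -- and the volume of the balls.
    have h2 : e ^ q ≤ ENNReal.ofReal (R * s) * ((D * F : ℝ≥0∞) ^ q * Q) := by
      refine (ENNReal.rpow_le_rpow h1 hq0.le).trans ?_
      rw [ENNReal.mul_rpow_of_nonneg _ _ hq0.le, ← mul_assoc (D : ℝ≥0∞),
        ENNReal.mul_rpow_of_nonneg _ _ hq0.le, hQn]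
      refine mul_le_mul' ?_ le_rfl
      rw [ENNReal.ofReal_rpow_of_nonneg (by positivity) hq0.le]
      refine ENNReal.ofReal_le_ofReal ?_
      calc (R * s) ^ q ≤ (R * s) ^ (1 : ℝ) :=
            Real.rpow_le_rpow_of_exponent_ge (by positivity) hgrid2 (by linarith)
        _ = R * s := Real.rpow_one _
    calc _ ≤ (N : ℝ≥0∞) * (ENNReal.ofReal (R * s) * ((D * F : ℝ≥0∞) ^ q * Q) *
          (ENNReal.ofReal (R ^ (d + 1)) * W)) := by gcongr
      _ = (N * ENNReal.ofReal (R ^ (d + 1)) * ENNReal.ofReal (R * s)) *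
          (W * ((D * F : ℝ≥0∞) ^ q * Q)) := by ring
      _ ≤ 1 * (W * ((D * F : ℝ≥0∞) ^ q * Q)) := by
          refine mul_le_mul' ?_ le_rfl
          rw [← ENNReal.ofReal_natCast, ← ENNReal.ofReal_mul (by positivity),
            ← ENNReal.ofReal_mul (by positivity), ← ENNReal.ofReal_one]
          exact ENNReal.ofReal_le_ofReal hgrid1
      _ = _ := one_mul _
  have hRε : 1 ≤ ENNReal.ofReal (R ^ ε) ^ q := by
    refine ENNReal.one_le_rpow ?_ hq0
    rw [← ENNReal.ofReal_one]
    exact ENNReal.ofReal_le_ofReal (Real.one_le_rpow hR hε.le)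
  have hcardN : (J.card : ℝ≥0∞) ≤ N := by
    exact_mod_cast (Finset.card_le_univ J).trans_eq (Fintype.card_fin N)
  calc ∑ j ∈ J, ∫⁻ y in ball (x j) R, ‖T φ a lam f y‖ₑ ^ q
      ≤ ∑ j ∈ J, (2 : ℝ≥0∞) ^ (q - 1) *
          ((CL * ENNReal.ofReal (R ^ ε)) ^ q * (∫⁻ ω in B d, ‖P j ω‖ₑ ^ q) +
          e ^ q * (ENNReal.ofReal (R ^ (d + 1)) * W)) := Finset.sum_le_sum hball
    _ = (2 : ℝ≥0∞) ^ (q - 1) *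
          ((CL * ENNReal.ofReal (R ^ ε)) ^ q * (∑ j ∈ J, ∫⁻ ω in B d, ‖P j ω‖ₑ ^ q) +
          J.card * (e ^ q * (ENNReal.ofReal (R ^ (d + 1)) * W))) := by
        rw [← Finset.mul_sum, Finset.sum_add_distrib, ← Finset.mul_sum, Finset.sum_const,
          nsmul_eq_mul]
    _ ≤ (2 : ℝ≥0∞) ^ (q - 1) *
          ((CL * ENNReal.ofReal (R ^ ε)) ^ q * (K' * Q) +
          1 * (W * ((D * F : ℝ≥0∞) ^ q * Q))) := by
        rw [one_mul]
        exact mul_le_mul' le_rfl (add_le_add (mul_le_mul' le_rfl hPsum)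
          (le_trans (mul_le_mul' hcardN le_rfl) herr))
    _ ≤ (2 : ℝ≥0∞) ^ (q - 1) *
          ((CL * ENNReal.ofReal (R ^ ε)) ^ q * (K' * Q) +
          ENNReal.ofReal (R ^ ε) ^ q * (W * ((D * F : ℝ≥0∞) ^ q * Q))) := by
        gcongr
    _ = _ := by
        rw [ENNReal.mul_rpow_of_nonneg _ _ hq0.le]
        push_cast
        rw [ENNReal.coe_rpow_of_nonneg _ (by linarith : (0 : ℝ) ≤ q - 1),
          ENNReal.coe_rpow_of_nonneg _ hq0.le, ENNReal.coe_rpow_of_nonneg _ hq0.le,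
          ENNReal.coe_toNNReal hWt]
        push_cast
        ring

/-- Estimates over sparse collections. -/
theorem sparseBounds_of_localBounds (hd : 1 ≤ d) (hφ : IsPhase φ) {pbar : ℝ≥0∞}
    (hpbar : 2 ≤ pbar) (hL : LocalBounds φ pbar) {Cbar : ℝ}
    (hCbar : 3 * ((d + 2) * d + 1) ≤ Cbar) {p : ℝ≥0∞} (hp : pbar ≤ p) :
    SparseBounds φ Cbar p := by
  classical
  intro ε hε a ha
  rcases eq_or_ne p ∞ with rfl | hpt
  · obtain ⟨C, hC⟩ := exists_eLpNorm_top_T_le hφ.smooth ha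
    refine ⟨C, fun lam R hlam hR N x hx f hf => (hC lam hlam f hf _).trans ?_⟩
    refine mul_le_mul' (le_mul_of_one_le_right zero_le ?_) le_rfl
    rw [← ENNReal.ofReal_one]
    exact ENNReal.ofReal_le_ofReal (Real.one_le_rpow hR hε.le)
  obtain ⟨CL, hCL⟩ := hL p hp ε hε a ha
  set q := p.toReal with hq
  have hpq : p = ENNReal.ofReal q := (ENNReal.ofReal_toReal hpt).symm
  have hq2 : 2 ≤ q := by simpa using ENNReal.toReal_mono hpt (hpbar.trans hp)
  have hq0 : 0 < q := by linarith
  obtain ⟨η, hη0, hη1, C, hC⟩ := exists_sum_lintegral_ball_le hd hφ ha hq2 hε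
    (CL := CL) (by rw [← hpq]; exact hCL)
  -- The centres are grouped into clusters of rescaled diameter at most η/2, whose number is
  -- independent of λ, R and N.
  obtain ⟨t, -, htf, htcov⟩ := finite_cover_balls_of_compact
    (isCompact_closedBall (0 : E (d + 1)) 2) (by positivity : 0 < η / 4)
  set t' := htf.toFinset with ht'
  refine ⟨(t'.card * C) ^ (1 / q) + CL * Real.toNNReal ((2 / η) ^ ε), ?_⟩
  intro lam R hlam hR N x hx f hf
  have hlam0 : 0 < lam := by linarith
  -- For R below ηλ/2 the cluster estimate applies. Otherwise one ball of radius λ contains the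
  -- support of T f, and λ^ε ≤ (2/η)^ε R^ε.
  rcases le_or_gt R (η / 2 * lam) with hRlam | hRlam
  · have hJ : ∀ b ∈ t', ∑ j ∈ Finset.univ.filter (fun j => dist (lam⁻¹ • x j) b < η / 4),
        ∫⁻ y in ball (x j) R, ‖T φ a lam f y‖ₑ ^ q ≤
          C * ENNReal.ofReal (R ^ ε) ^ q * ∫⁻ ω in B d, ‖f ω‖ₑ ^ q := by
      intro b _
      refine hC Cbar hCbar lam R hR hRlam N x hx _ (fun j hj k hk => ?_) f (by rwa [← hpq])
      have h1 := (Finset.mem_filter.1 hj).2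
      have h2 := (Finset.mem_filter.1 hk).2
      have h3 := dist_triangle_right (lam⁻¹ • x j) (lam⁻¹ • x k) b
      linarith
    have hterm : ∀ j, ∫⁻ y in ball (x j) R, ‖T φ a lam f y‖ₑ ^ q ≤
        ∑ b ∈ t', if dist (lam⁻¹ • x j) b < η / 4 then
          ∫⁻ y in ball (x j) R, ‖T φ a lam f y‖ₑ ^ q else 0 := by
      intro j
      by_cases hj : lam⁻¹ • x j ∈ closedBall (0 : E (d + 1)) 2
      · obtain ⟨b, hb, hjb⟩ := mem_iUnion₂.1 (htcov hj)
        refine le_trans (le_of_eq ?_) (Finset.single_le_sum (f := fun b =>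
          if dist (lam⁻¹ • x j) b < η / 4 then
            ∫⁻ y in ball (x j) R, ‖T φ a lam f y‖ₑ ^ q else 0) (fun _ _ => zero_le)
          (htf.mem_toFinset.2 hb))
        rw [if_pos (by exact hjb)]
      -- A centre with |x_j| > 2λ contributes nothing: R ≤ λ keeps its ball away from the ball of
      -- radius λ, outside which T f vanishes.
      · have : ∫⁻ y in ball (x j) R, ‖T φ a lam f y‖ₑ ^ q = 0 := by
          rw [setLIntegral_congr_fun (g := fun _ => 0) measurableSet_ball, lintegral_zero]
          intro y hy
          have hy' : lam⁻¹ • y ∉ B (d + 1) := by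
            intro h
            apply hj
            rw [mem_ball] at hy h
            have h1 : dist (lam⁻¹ • x j) (lam⁻¹ • y) = lam⁻¹ * dist (x j) y := by
              rw [dist_smul₀, Real.norm_of_nonneg (by positivity)]
            have h2 : lam⁻¹ * dist (x j) y ≤ 1 := by
              rw [inv_mul_le_iff₀ hlam0, dist_comm]
              nlinarith
            have h3 := dist_triangle (lam⁻¹ • x j) (lam⁻¹ • y) 0
            rw [mem_closedBall]
            linarith
          simp only
          rw [T_eq_zero ha hy', enorm_zero, ENNReal.zero_rpow_of_pos hq0]
        rw [this]
        exact zero_le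
    have htotal : ∫⁻ y in ⋃ j, ball (x j) R, ‖T φ a lam f y‖ₑ ^ q ≤
        t'.card * C * ENNReal.ofReal (R ^ ε) ^ q * ∫⁻ ω in B d, ‖f ω‖ₑ ^ q := by
      calc _ ≤ ∑ j, ∫⁻ y in ball (x j) R, ‖T φ a lam f y‖ₑ ^ q := by
            refine (lintegral_iUnion_le _ _).trans (le_of_eq ?_)
            exact tsum_fintype _
        _ ≤ ∑ j, ∑ b ∈ t', if dist (lam⁻¹ • x j) b < η / 4 then
              ∫⁻ y in ball (x j) R, ‖T φ a lam f y‖ₑ ^ q else 0 :=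
            Finset.sum_le_sum fun j _ => hterm j
        _ = ∑ b ∈ t', ∑ j ∈ Finset.univ.filter (fun j => dist (lam⁻¹ • x j) b < η / 4),
              ∫⁻ y in ball (x j) R, ‖T φ a lam f y‖ₑ ^ q := by
            rw [Finset.sum_comm]
            simp only [Finset.sum_filter]
        _ ≤ ∑ b ∈ t', C * ENNReal.ofReal (R ^ ε) ^ q * ∫⁻ ω in B d, ‖f ω‖ₑ ^ q :=
            Finset.sum_le_sum hJ
        _ = _ := by
            rw [Finset.sum_const, nsmul_eq_mul]
            ring
    rw [← eLpNorm_rpow_eq_lintegral hq0 hpq, ← eLpNorm_rpow_eq_lintegral hq0 hpq] at htotal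
    have hroot := ENNReal.rpow_le_rpow htotal (by positivity : 0 ≤ 1 / q)
    rw [ENNReal.mul_rpow_of_nonneg _ _ (by positivity), ENNReal.mul_rpow_of_nonneg _ _
      (by positivity : 0 ≤ 1 / q)] at hroot
    simp only [← ENNReal.rpow_mul, mul_one_div_cancel hq0.ne', ENNReal.rpow_one] at hroot
    refine hroot.trans (mul_le_mul' (mul_le_mul' ?_ le_rfl) le_rfl)
    rw [ENNReal.coe_add, ENNReal.coe_rpow_of_nonneg _ (by positivity)]
    push_cast
    exact le_self_add
  · have hsupp : Function.support (T φ a lam f) ⊆ ball 0 lam := by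
      intro y hy
      by_contra h
      refine hy (T_eq_zero ha (fun h' => h ?_) f)
      rw [mem_ball_zero_iff] at h' ⊢
      rw [norm_smul, Real.norm_of_nonneg (by positivity), inv_mul_lt_iff₀ hlam0] at h'
      linarith
    calc eLpNorm (T φ a lam f) p (volume.restrict (⋃ j, ball (x j) R))
        ≤ eLpNorm (T φ a lam f) p volume := eLpNorm_mono_measure _ Measure.restrict_le_self
      _ = eLpNorm (T φ a lam f) p (volume.restrict (ball 0 lam)) :=
          (eLpNorm_restrict_eq_of_support_subset hsupp).symm
      _ ≤ CL * ENNReal.ofReal (lam ^ ε) * eLpNorm f p (volume.restrict (B d)) :=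
          hCL lam lam hlam le_rfl 0 f hf
      _ ≤ CL * (ENNReal.ofReal ((2 / η) ^ ε) * ENNReal.ofReal (R ^ ε)) *
            eLpNorm f p (volume.restrict (B d)) := by
          gcongr
          rw [← ENNReal.ofReal_mul (by positivity), ← Real.mul_rpow (by positivity) (by linarith)]
          refine ENNReal.ofReal_le_ofReal (Real.rpow_le_rpow hlam0.le ?_ hε.le)
          rw [div_mul_eq_mul_div, le_div_iff₀ hη0]
          linarith
      _ ≤ _ := by
          rw [← mul_assoc, ENNReal.coe_add, ENNReal.coe_mul]
          gcongr
          exact le_add_self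

end

end EpsRemoval

/-! ### Assembly of the three statements. -/

theorem mainTheorem11 (d : ℕ) (hd : 1 ≤ d) :
    (∀ φ : EpsRemoval.E (d + 1) → EpsRemoval.E d → ℝ, EpsRemoval.IsPhase φ →
      ∀ pbar : ℝ≥0∞, 2 ≤ pbar → EpsRemoval.LocalBounds φ pbar →
        ∀ a : EpsRemoval.E (d + 1) → EpsRemoval.E d → ℝ, EpsRemoval.IsAmplitude φ a →
          ∀ p : ℝ≥0∞, pbar < p → EpsRemoval.GlobalBound φ a p) ∧
    (∃ C₀ : ℝ, 1 ≤ C₀ ∧ ∀ Cbar : ℝ, C₀ ≤ Cbar →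
      ∀ φ : EpsRemoval.E (d + 1) → EpsRemoval.E d → ℝ, EpsRemoval.IsPhase φ →
        ∀ pbar : ℝ≥0∞, 2 ≤ pbar →
          (EpsRemoval.SparseBounds φ Cbar pbar →
            ∀ a : EpsRemoval.E (d + 1) → EpsRemoval.E d → ℝ, EpsRemoval.IsAmplitude φ a →
              ∀ p : ℝ≥0∞, pbar < p → EpsRemoval.GlobalBound φ a p) ∧
          (EpsRemoval.LocalBounds φ pbar →
            ∀ p : ℝ≥0∞, pbar ≤ p → EpsRemoval.SparseBounds φ Cbar p)) := by
  have hC₀ : (1 : ℝ) ≤ 3 * ((d + 2) * d + 1) := by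
    have : (0 : ℝ) ≤ (d + 2) * d := by positivity
    linarith
  refine ⟨fun φ hφ pbar hpbar hL a ha p hp => ?_, 3 * ((d + 2) * d + 1), hC₀,
    fun Cbar hCbar φ hφ pbar hpbar => ⟨fun hS a ha p hp => ?_, fun hL p hp => ?_⟩⟩
  -- Statement 1 mentions no sparseness exponent, so the threshold C₀ itself is taken, with p = pbar
  -- in statement 3.
  · exact EpsRemoval.globalBound_of_sparseBounds hφ hC₀ hpbar
      (EpsRemoval.sparseBounds_of_localBounds hd hφ hpbar hL le_rfl le_rfl) ha hp
  · exact EpsRemoval.globalBound_of_sparseBounds hφ (hC₀.trans hCbar) hpbar hS ha hp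
  · exact EpsRemoval.sparseBounds_of_localBounds hd hφ hpbar hL hCbar hp
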